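/- **Setting.** Let $\varepsilon\in\{1,-1\}$ and let $\rho_1,\rho_2\in H^{1,1}(\mathbb R)=\{f: f'\in L^2(\mathbb R),\ \lambda f(\lambda)\in L^2(\mathbb R)\}$ (with $f'$ the weak derivative; $\rho_1,\rho_2$ denote the continuous representatives). If $\varepsilon=-1$, assume in addition that $|\rho_1(\lambda)|^2+|\rho_2(\lambda)|^2<1$ for all $\lambda\in\mathbb R$. Put $\sigma=\mathrm{diag}(-1,1,1)$, $e^{i\lambda x\,\mathrm{ad}\,\sigma}B=e^{i\lambda x\sigma}Be^{-i\lambda x\sigma}$, $$V(\lambda)=\begin{pmatrix}1+\varepsilon|\rho_1|^2+\varepsilon|\rho_2|^2&\varepsilon\overline{\rho_1}&\varepsilon\overline{\rho_2}\\ \rho_1&1&0\\ \rho_2&0&1\end{pmatrix},\quad W_-(\lambda)=\begin{pmatrix}0&\varepsilon\overline{\rho_1}&\varepsilon\overline{\rho_2}\\0&0&0\\0&0&0\end{pmatrix},\quad W_+(\lambda)=\begin{pmatrix}0&0&0\\ \rho_1&0&0\\ \rho_2&0&0\end{pmatrix},$$ so that $V=(I-W_-)^{-1}(I+W_+)$,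 and $V_x=e^{i\lambda x\,\mathrm{ad}\,\sigma}V$, $W_{x\pm}=e^{i\lambda x\,\mathrm{ad}\,\sigma}W_\pm$. For $f\in L^2(\mathbb R;\mathbb C^{3\times3})$ let $C^\pm f$ be the limit in $L^2$, as $\delta\to0+$, of $\lambda\mapsto\frac1{2\pi i}\int_{\mathbb R}\frac{f(s)}{s-(\lambda\pm i\delta)}\,ds$, and let $\mathcal C_W h=C^+(hW_{x-})+C^-(hW_{x+})$. Fix $x\in\mathbb R$. A solution of the Riemann–Hilbert problem is a function $M:\mathbb C\setminus\mathbb R\to\mathbb C^{3\times3}$ such that (i) $M$ is analytic in $\mathbb C\setminus\mathbb R$; (ii) $M(z)\to I$ as $z\to\infty$ in $\mathbb C\setminus\mathbb R$, and $M(z)=I+\mathcal O(z^{-1})$ as $z\to\infty$ non-tangentially to $\mathbb R$, i.e. in each region $\{|\mathrm{Im}\,z|\ge c|z|\}$, $c>0$; (iii) there are continuous functions $M_\pm$ on $\mathbb R$ such that, for every $\lambda\in\mathbb R$, $M(z)\to M_\pm(\lambda)$ as $z\to\lambda$ from $\mathbb C^\pm$, and $M_+(\lambda)=M_-(\lambda)V_x(\lambda)$.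 **Proposition.** $V(\lambda)+V(\lambda)^\dagger$ is positive definite for every $\lambda\in\mathbb R$. The operator $\mathcal C_W$ is well defined and bounded on $L^2(\mathbb R;\mathbb C^{3\times3})$, and $I-\mathcal C_W$ is Fredholm of index zero and invertible there. The equation $\mu=I+\mathcal C_W\mu$ has exactly one solution $\mu$ with $\mu-I\in L^2$, namely $\mu=I+(I-\mathcal C_W)^{-1}\mathcal C_WI$. The Riemann–Hilbert problem has exactly one solution $M$. It is given by $$M(z)=I+\frac1{2\pi i}\int_{\mathbb R}\frac{\mu(\lambda)\,(W_{x+}(\lambda)+W_{x-}(\lambda))}{\lambda-z}\,d\lambda,\qquad z\in\mathbb C\setminus\mathbb R,$$ and $M_+=\mu(I+W_{x+})$, $M_-=\mu(I-W_{x-})$ almost everywhere on $\mathbb R$. -/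

import Mathlib

open Complex MeasureTheory Filter Topology Asymptotics
open scoped Matrix ENNReal ComplexOrder Matrix.Norms.L2Operator

noncomputable section

/-- Complex `3 × 3` matrices, with the operator norm of `ℂ³` (all norms on this space are
equivalent). -/
abbrev Mat3 : Type := Matrix (Fin 3) (Fin 3) ℂ

/-- The space `L²(ℝ; ℂ^{3×3})`. -/
abbrev L2Mat : Type := Lp Mat3 2 (volume : Measure ℝ)

/-- `f ∈ H^{1,1}(ℝ) = {f : f', x f ∈ L²}`: `f` is (the continuous representative of) a function
whose weak derivative `f' = g` is in `L²`, that is `f` is a primitive of `g`, and `x f ∈ L²`. -/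
def MemH11 (f : ℝ → ℂ) : Prop :=
  (∃ g : ℝ → ℂ, MemLp g 2 volume ∧ ∀ a b : ℝ, f b - f a = ∫ t in a..b, g t) ∧
    MemLp (fun t : ℝ => (t : ℂ) * f t) 2 volume

/-- The diagonal entries of `σ = diag(-1, 1, 1)`. -/
def sigmaDiag : Fin 3 → ℂ := ![-1, 1, 1]

/-- `e^{i l x ad σ} B = e^{i l x σ} B e^{-i l x σ}`, entry by entry. -/
def expAdSigma (x l : ℝ) (B : Mat3) : Mat3 :=
  Matrix.of fun j k => Complex.exp (I * l * x * (sigmaDiag j - sigmaDiag k)) * B j k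

/-- The jump matrix `V(l)`. -/
def jumpV (ε : ℝ) (ρ₁ ρ₂ : ℝ → ℂ) (l : ℝ) : Mat3 :=
  !![1 + (ε : ℂ) * (‖ρ₁ l‖ : ℂ) ^ 2 + (ε : ℂ) * (‖ρ₂ l‖ : ℂ) ^ 2,
        (ε : ℂ) * star (ρ₁ l), (ε : ℂ) * star (ρ₂ l);
     ρ₁ l, 1, 0;
     ρ₂ l, 0, 1]

/-- The factor `W₋` in `V = (I - W₋)⁻¹ (I + W₊)`. -/
def matWminus (ε : ℝ) (ρ₁ ρ₂ : ℝ → ℂ) (l : ℝ) : Mat3 :=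
  !![0, (ε : ℂ) * star (ρ₁ l), (ε : ℂ) * star (ρ₂ l); 0, 0, 0; 0, 0, 0]

/-- The factor `W₊` in `V = (I - W₋)⁻¹ (I + W₊)`. -/
def matWplus (ρ₁ ρ₂ : ℝ → ℂ) (l : ℝ) : Mat3 :=
  !![0, 0, 0; ρ₁ l, 0, 0; ρ₂ l, 0, 0]

/-- `V_x(l) = e^{i l x ad σ} V(l)`. -/
def jumpVx (ε : ℝ) (ρ₁ ρ₂ : ℝ → ℂ) (x l : ℝ) : Mat3 := expAdSigma x l (jumpV ε ρ₁ ρ₂ l)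

/-- `W_{x-}(l) = e^{i l x ad σ} W₋(l)`. -/
def matWxminus (ε : ℝ) (ρ₁ ρ₂ : ℝ → ℂ) (x l : ℝ) : Mat3 := expAdSigma x l (matWminus ε ρ₁ ρ₂ l)

/-- `W_{x+}(l) = e^{i l x ad σ} W₊(l)`. -/
def matWxplus (ρ₁ ρ₂ : ℝ → ℂ) (x l : ℝ) : Mat3 := expAdSigma x l (matWplus ρ₁ ρ₂ l)

/-- The open upper half-plane `ℂ⁺`. -/
def upperHP : Set ℂ := {z | 0 < z.im}

/-- The open lower half-plane `ℂ⁻`. -/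
def lowerHP : Set ℂ := {z | z.im < 0}

/-- `M` solves the Riemann-Hilbert problem on `ℝ` with jump matrix `J`. The values of `M` on `ℝ`
itself play no role. -/
structure SolvesRHP (J : ℝ → Mat3) (M : ℂ → Mat3) : Prop where
  /-- `M` is analytic in `ℂ \ ℝ`. -/
  analytic : DifferentiableOn ℂ M {z : ℂ | z.im ≠ 0}
  /-- `M(z) → I` as `z → ∞` in `ℂ \ ℝ`. -/
  tendsto_one : Tendsto M (Bornology.cobounded ℂ ⊓ 𝓟 {z : ℂ | z.im ≠ 0}) (𝓝 1)
  /-- `M(z) = I + O(1/z)` as `z → ∞` non-tangentially to `ℝ`. -/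
  isBigO : ∀ c : ℝ, 0 < c →
    (fun z : ℂ => M z - 1) =O[Bornology.cobounded ℂ ⊓ 𝓟 {z : ℂ | c * ‖z‖ ≤ |z.im|}]
      (fun z : ℂ => z⁻¹)
  /-- `M` has continuous boundary values `M₊`, `M₋` from `ℂ⁺`, `ℂ⁻`, with `M₊ = M₋ J` on `ℝ`. -/
  jump : ∃ Mp Mm : ℝ → Mat3, Continuous Mp ∧ Continuous Mm ∧
    (∀ l : ℝ, Tendsto M (𝓝[upperHP] (l : ℂ)) (𝓝 (Mp l))) ∧
    (∀ l : ℝ, Tendsto M (𝓝[lowerHP] (l : ℂ)) (𝓝 (Mm l))) ∧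
    ∀ l : ℝ, Mp l = Mm l * J l

/-- The Cauchy integral `(2πi)⁻¹ ∫_ℝ f(s) / (s - z) ds`. -/
def cauchyIntegral (f : ℝ → Mat3) (z : ℂ) : Mat3 :=
  (2 * (Real.pi : ℂ) * I)⁻¹ • ∫ s : ℝ, ((s : ℂ) - z)⁻¹ • f s

/-- `g = C^± f`, where `θ = ±1`: `g ∈ L²` is the `L²`-limit of the functions
`l ↦ (2πi)⁻¹ ∫_ℝ f(s) / (s - (l ± i δ)) ds` as `δ → 0+`. -/
def IsCauchyProjection (θ : ℝ) (f g : ℝ → Mat3) : Prop :=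
  MemLp g 2 volume ∧
    Tendsto (fun δ : ℝ =>
        eLpNorm (fun l : ℝ => cauchyIntegral f ((l : ℂ) + (θ * δ : ℝ) * I) - g l) 2 volume)
      (𝓝[>] 0) (𝓝 0)

/-- `g = C_W h`, where `C_W h = C^+ (h W_{x-}) + C^- (h W_{x+})`. -/
def IsBealsCoifmanImage (ε : ℝ) (ρ₁ ρ₂ : ℝ → ℂ) (x : ℝ) (h g : ℝ → Mat3) : Prop :=
  ∃ gp gm : ℝ → Mat3,
    IsCauchyProjection 1 (fun l => h l * matWxminus ε ρ₁ ρ₂ x l) gp ∧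
    IsCauchyProjection (-1) (fun l => h l * matWxplus ρ₁ ρ₂ x l) gm ∧
    g =ᵐ[volume] fun l => gp l + gm l

/-- `T` is the Beals-Coifman operator `C_W` on `L²(ℝ; ℂ^{3×3})`. -/
def IsBealsCoifmanOperator (ε : ℝ) (ρ₁ ρ₂ : ℝ → ℂ) (x : ℝ) (T : L2Mat →L[ℂ] L2Mat) : Prop :=
  ∀ φ : L2Mat, IsBealsCoifmanImage ε ρ₁ ρ₂ x φ (T φ)

/-- Fredholm of index zero. -/
def IsFredholmIndexZero (T : L2Mat →L[ℂ] L2Mat) : Prop :=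
  T.IsFredholm ∧ Module.finrank ℂ T.ker = Module.finrank ℂ (L2Mat ⧸ T.range)

end

/-!
The proof rests on the boundedness and invertibility of `1 - C_W`, on a regularity estimate that
turns `L²` boundary values into continuous ones, and on Liouville's theorem.

*The operator.* By the Paley-Wiener representation of the Cauchy integral
(`cauchyTransform_eq_integral_fourier`), the limits `C^±` exist in `L²` and are Fourier multipliers
(`tendsto_eLpNorm_cauchyTransform_sub`): `P = C^+` is the orthogonal projection onto the positive
frequencies, and `C^- = P - 1`. Writing `R_B` for right multiplication by `B`, this gives
`1 - C_W = (P + (1 - P) R_V) R_{1 - W₋}`. The second factor is invertible since `W₋² = 0`. The first one is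
block triangular for the decomposition of `L²` by `P`, and its nontrivial diagonal block is the
compression of `R_V`; it is invertible by Lax-Milgram because the real part of `V` is bounded below
uniformly on `ℝ` (`isUnit_proj_add_of_coercive`, `IsAdmissibleJump.isUnit_one_sub_op`). The uniform
bound comes from an explicit formula for the quadratic form of `V` (`le_jumpForm`) and
from the decay of the coefficients at infinity (`exists_sq_norm_le`). In particular `1 - C_W` is
Fredholm of index zero.

*Regularity.* Let `μ = 1 + φ` solve `μ = 1 + C_W μ`. The operators `C^±` commute with translations,
so `φ(· + a) - φ` is `(1 - C_W)⁻¹` applied to terms of the form `C^±(μ(· + a) (W_∓(· + a) - W_∓))`.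
There is no bound on `φ` at this stage, but the mass of `|φ|²` on an interval of length `a` is at
most `2 ‖φ‖ ‖φ(· + a) - φ‖` (`lintegral_Ico_enorm_sq_le`), so that these terms are bounded by a
multiple of `a + √(a ‖φ‖ ‖φ(· + a) - φ‖)`. Absorbing the square root gives `‖φ(· + a) - φ‖ = O(a)`
(`IsAdmissibleJump.exists_norm_translateLp_sub_le`). The density `μ (W₊ + W₋)` is then Lipschitz in
the `L²` mean, hence has an integrable Fourier transform (`integrable_fourier_of_L2Lipschitz`), and
its Cauchy integral, an integral of exponentials over a half-line of frequencies, extends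
continuously to both closed half-planes and vanishes at infinity (`cauchyTransform_boundary`).

*The Riemann-Hilbert problem.* From `φ = C^+(μ W₋) + C^-(μ W₊)` and `C^+ - C^- = 1`, the boundary
values of `M = 1 + C(μ (W₊ + W₋))` are `μ (1 + W₊)` and `μ (1 - W₋)`, and the jump relation holds
almost everywhere, hence everywhere by continuity. If `M'` is another solution, then `M' adj(M)` has
no jump, as `det V = 1`; it is an entire function that tends to `1` at infinity, hence equal to `1`
(`SolvesRHP.mul_adjugate_eq_one`), and likewise for `M adj(M)`.

The conjugation by `e^{i l x σ}` replaces the coefficients `ρ_j` by `e^{2 i x l} ρ_j`, which satisfy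
the same regularity hypotheses (`IsRegularCoeff.exp_mul`), so the argument is made for a general
admissible jump (`IsAdmissibleJump.unique_solvability`).
-/

noncomputable section

section FourierAnalysis

open scoped FourierTransform ContDiff SchwartzMap

/-! ### Pointwise operators on `L²` -/

section MulOp

variable {E F : Type*} [NormedAddCommGroup E] [NormedSpace ℂ E]
  [NormedAddCommGroup F] [NormedSpace ℂ F]

theorem memLp_clm_apply {A : ℝ → E →L[ℂ] F} {C : ℝ} (hA : AEStronglyMeasurable A volume)
    (hC : ∀ s, ‖A s‖ ≤ C) {f : ℝ → E} {p : ℝ≥0∞} (hf : MemLp f p volume) :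
    MemLp (fun s => A s (f s)) p volume :=
  hf.of_le_mul (c := C)
    ((isBoundedBilinearMap_apply (𝕜 := ℂ) (E := E) (F := F)).continuous.comp_aestronglyMeasurable
      (hA.prodMk hf.1))
    (Eventually.of_forall fun s =>
      ((A s).le_opNorm _).trans (mul_le_mul_of_nonneg_right (hC s) (norm_nonneg _)))

/-- The operator `f ↦ (s ↦ A s (f s))` on `L²(ℝ)`, for a bounded operator-valued function `A`. -/
def pointwiseOp (A : ℝ → E →L[ℂ] F) (C : ℝ) (hA : AEStronglyMeasurable A volume)
    (hC : ∀ s, ‖A s‖ ≤ C) :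
    Lp E 2 (volume : Measure ℝ) →L[ℂ] Lp F 2 (volume : Measure ℝ) :=
  LinearMap.mkContinuous
    { toFun := fun f => (memLp_clm_apply hA hC (Lp.memLp f)).toLp _
      map_add' := fun f g => by
        rw [← MemLp.toLp_add]
        refine MemLp.toLp_congr _ _ ?_
        filter_upwards [Lp.coeFn_add f g] with s hs
        rw [hs, Pi.add_apply, map_add, Pi.add_apply]
      map_smul' := fun c f => by
        rw [RingHom.id_apply, ← MemLp.toLp_const_smul]
        refine MemLp.toLp_congr _ _ ?_
        filter_upwards [Lp.coeFn_smul c f] with s hs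
        simp [hs] }
    C fun f => by
      refine Lp.norm_le_mul_norm_of_ae_le_mul ?_
      filter_upwards [MemLp.coeFn_toLp (memLp_clm_apply hA hC (Lp.memLp f))] with s hs
      simp only [LinearMap.coe_mk, AddHom.coe_mk]
      rw [hs]
      exact ((A s).le_opNorm _).trans (mul_le_mul_of_nonneg_right (hC s) (norm_nonneg _))

theorem coeFn_pointwiseOp {A : ℝ → E →L[ℂ] F} {C : ℝ} {hA : AEStronglyMeasurable A volume}
    {hC : ∀ s, ‖A s‖ ≤ C} (f : Lp E 2 (volume : Measure ℝ)) :
    pointwiseOp A C hA hC f =ᵐ[volume] fun s => A s (f s) :=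
  MemLp.coeFn_toLp (memLp_clm_apply hA hC (Lp.memLp f))

end MulOp

/-! ### The Fourier transform on `L¹ ∩ L²` -/

section FourierL1L2

variable {E : Type*} [NormedAddCommGroup E] [InnerProductSpace ℂ E] [CompleteSpace E]

theorem locallyIntegrable_fourier {F : Type*} [NormedAddCommGroup F] [InnerProductSpace ℂ F]
    {f : ℝ → F} (h1 : Integrable f) :
    LocallyIntegrable (𝓕 f) volume :=
  (VectorFourier.fourierIntegral_continuous Real.continuous_fourierChar
    (L := innerₗ ℝ) (by exact continuous_inner) h1).locallyIntegrable

/-- The multiplication formula for the Fourier integral. -/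
theorem integral_fourier_smul_eq {f : ℝ → ℂ} {g : ℝ → E} (hf : Integrable f)
    (hg : Integrable g) : ∫ x, 𝓕 f x • g x = ∫ x, f x • 𝓕 g x := by
  simpa using! VectorFourier.integral_fourierIntegral_smul_eq_flip (L := innerₗ ℝ) (μ := volume)
    (ν := volume) Real.continuous_fourierChar continuous_inner hf hg

/-- On `L¹ ∩ L²` the Fourier transform of `L²` is given by the Fourier integral. -/
theorem coeFn_fourier_toLp {f : ℝ → E} (h1 : Integrable f) (h2 : MemLp f 2 volume) :
    (𝓕 (h2.toLp f) : Lp E 2 (volume : Measure ℝ)) =ᵐ[volume] 𝓕 f := by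
  refine ae_eq_of_integral_contDiff_smul_eq
    ((Lp.memLp _).locallyIntegrable (by norm_num)) (locallyIntegrable_fourier h1) ?_
  intro g g_smooth g_cpt
  have hg₁ : HasCompactSupport (Complex.ofRealCLM ∘ g) := g_cpt.comp_left rfl
  have hg₂ : ContDiff ℝ ∞ (Complex.ofRealCLM ∘ g) := by fun_prop
  set G : 𝓢(ℝ, ℂ) := hg₁.toSchwartzMap hg₂ with hG
  have hGx : ∀ x, G x = (g x : ℂ) := fun x => by simp [hG]
  have key := congrArg (fun T => T G) (Lp.fourier_toTemperedDistribution_eq (h2.toLp f))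
  simp only [TemperedDistribution.fourier_apply, Lp.toTemperedDistribution_apply] at key
  calc ∫ x, g x • (𝓕 (h2.toLp f) : Lp E 2 (volume : Measure ℝ)) x
      = ∫ x, G x • (𝓕 (h2.toLp f) : Lp E 2 (volume : Measure ℝ)) x := by
        simp [hGx]
    _ = ∫ x, (𝓕 G) x • (h2.toLp f) x := key.symm
    _ = ∫ x, (𝓕 (G : ℝ → ℂ)) x • f x := by
        refine integral_congr_ae ?_
        filter_upwards [h2.coeFn_toLp] with x hx
        rw [hx, SchwartzMap.fourier_coe]
    _ = ∫ x, G x • 𝓕 f x :=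
        integral_fourier_smul_eq G.integrable h1
    _ = ∫ x, g x • 𝓕 f x := by simp [hGx]

/-- On `L¹ ∩ L²` the inverse Fourier transform of `L²` is given by the Fourier integral. -/
theorem coeFn_fourierInv_toLp {f : ℝ → E} (h1 : Integrable f) (h2 : MemLp f 2 volume) :
    (𝓕⁻ (h2.toLp f) : Lp E 2 (volume : Measure ℝ)) =ᵐ[volume] 𝓕⁻ f := by
  have hc : 𝓕⁻ f = fun x => 𝓕 f (-x) := by
    ext x; exact Real.fourierInv_eq_fourier_neg f x
  have hloc : LocallyIntegrable (𝓕⁻ f) volume := by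
    rw [hc]
    exact ((VectorFourier.fourierIntegral_continuous Real.continuous_fourierChar
      (L := innerₗ ℝ) (by exact continuous_inner) h1).comp continuous_neg).locallyIntegrable
  refine ae_eq_of_integral_contDiff_smul_eq
    ((Lp.memLp _).locallyIntegrable (by norm_num)) hloc ?_
  intro g g_smooth g_cpt
  have hg₁ : HasCompactSupport (Complex.ofRealCLM ∘ g) := g_cpt.comp_left rfl
  have hg₂ : ContDiff ℝ ∞ (Complex.ofRealCLM ∘ g) := by fun_prop
  set G : 𝓢(ℝ, ℂ) := hg₁.toSchwartzMap hg₂ with hG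
  have hGx : ∀ x, G x = (g x : ℂ) := fun x => by simp [hG]
  have key := congrArg (fun T => T G) (Lp.fourierInv_toTemperedDistribution_eq (h2.toLp f))
  simp only [TemperedDistribution.fourierInv_apply, Lp.toTemperedDistribution_apply] at key
  have hself : ∫ x, (𝓕 (G : ℝ → ℂ)) x • f (-x) = ∫ x, G x • 𝓕 (fun y => f (-y)) x :=
    integral_fourier_smul_eq G.integrable h1.comp_neg
  calc ∫ x, g x • (𝓕⁻ (h2.toLp f) : Lp E 2 (volume : Measure ℝ)) x
      = ∫ x, G x • (𝓕⁻ (h2.toLp f) : Lp E 2 (volume : Measure ℝ)) x := by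
        simp [hGx]
    _ = ∫ x, (𝓕⁻ G) x • (h2.toLp f) x := key.symm
    _ = ∫ x, (𝓕 (G : ℝ → ℂ)) (-x) • f x := by
        refine integral_congr_ae ?_
        filter_upwards [h2.coeFn_toLp] with x hx
        rw [hx, SchwartzMap.fourierInv_coe, Real.fourierInv_eq_fourier_neg]
    _ = ∫ x, (𝓕 (G : ℝ → ℂ)) x • f (-x) := by
        rw [← integral_neg_eq_self]; simp
    _ = ∫ x, G x • 𝓕⁻ f x := by
        rw [hself, Real.fourierInv_eq_fourier_comp_neg]
    _ = ∫ x, g x • 𝓕⁻ f x := by simp [hGx]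

end FourierL1L2

/-! ### The Cauchy kernel as a Fourier transform -/

section HalfLineExp

/-- The function `ξ ↦ ± 1_{± ξ > 0} e^{2π i ξ z}`, for the sign `θ = ±1`. For `± Im z > 0` its
Fourier transform is the Cauchy kernel `(2π i)⁻¹ (s - z)⁻¹`. -/
def halfLineExp (θ : ℝ) (z : ℂ) (ξ : ℝ) : ℂ :=
  if 0 < θ * ξ then θ * Complex.exp (2 * Real.pi * I * ξ * z) else 0

variable {θ : ℝ} {z : ℂ}

theorem measurable_halfLineExp (θ : ℝ) (z : ℂ) : Measurable (halfLineExp θ z) := by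
  unfold halfLineExp
  refine Measurable.ite ?_ (by fun_prop) measurable_const
  exact measurableSet_lt measurable_const (by fun_prop)

theorem norm_halfLineExp (hθ : θ = 1 ∨ θ = -1) (z : ℂ) (ξ : ℝ) :
    ‖halfLineExp θ z ξ‖ = if 0 < θ * ξ then Real.exp (-(2 * Real.pi * ξ * z.im)) else 0 := by
  have h1 : ‖(θ : ℂ)‖ = 1 := by rcases hθ with rfl | rfl <;> simp
  unfold halfLineExp
  split_ifs with h
  · rw [norm_mul, h1, one_mul, Complex.norm_exp]
    congr 1
    simp [Complex.mul_re, Complex.mul_im]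
  · simp

theorem norm_halfLineExp_le_one (hθ : θ = 1 ∨ θ = -1) (hz : 0 ≤ θ * z.im) (ξ : ℝ) :
    ‖halfLineExp θ z ξ‖ ≤ 1 := by
  rw [norm_halfLineExp hθ]
  split_ifs with h
  · rw [Real.exp_le_one_iff, neg_nonpos]
    have h2 : 0 ≤ ξ * z.im := by
      have := mul_nonneg h.le hz
      rcases hθ with rfl | rfl <;> nlinarith
    nlinarith [Real.pi_pos]
  · exact zero_le_one

theorem integrable_halfLineExp (hθ : θ = 1 ∨ θ = -1) (hz : 0 < θ * z.im) :
    Integrable (halfLineExp θ z) := by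
  have hre : (2 * Real.pi * I * z).re = -(2 * Real.pi * z.im) := by
    simp [Complex.mul_re, Complex.mul_im]
  have hpi := Real.pi_pos
  rcases hθ with rfl | rfl
  · have h := integrableOn_exp_mul_complex_Ioi (a := 2 * Real.pi * I * z)
      (by rw [hre]; nlinarith) 0
    refine ((integrable_indicator_iff measurableSet_Ioi).2 h).congr (.of_forall fun ξ => ?_)
    simp only [Set.indicator, Set.mem_Ioi, halfLineExp, one_mul, Complex.ofReal_one]
    congr 2; ring
  · have h := (integrableOn_exp_mul_complex_Iic (a := 2 * Real.pi * I * z)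
      (by rw [hre]; nlinarith) 0).mono_set Set.Iio_subset_Iic_self
    refine ((integrable_indicator_iff measurableSet_Iio).2 h).neg.congr (.of_forall fun ξ => ?_)
    simp only [Set.indicator, Set.mem_Iio, halfLineExp, neg_mul, one_mul, Complex.ofReal_neg,
      Complex.ofReal_one, Left.neg_pos_iff, Pi.neg_apply]
    split_ifs
    · congr 2; ring
    · simp

theorem memLp_halfLineExp (hθ : θ = 1 ∨ θ = -1) (hz : 0 < θ * z.im) :
    MemLp (halfLineExp θ z) 2 volume := by
  rw [memLp_two_iff_integrable_sq_norm (measurable_halfLineExp θ z).aestronglyMeasurable]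
  refine (integrable_halfLineExp hθ hz).norm.mono'
    ((measurable_halfLineExp θ z).norm.pow_const 2).aestronglyMeasurable (.of_forall fun ξ => ?_)
  have h1 := norm_halfLineExp_le_one hθ hz.le ξ
  have h0 := norm_nonneg (halfLineExp θ z ξ)
  rw [Real.norm_of_nonneg (by positivity)]
  nlinarith

/-- The Cauchy kernel is the Fourier transform of an exponential on a half-line. -/
theorem fourier_halfLineExp (hθ : θ = 1 ∨ θ = -1) (hz : 0 < θ * z.im) (s : ℝ) :
    𝓕 (halfLineExp θ z) s = (2 * (Real.pi : ℂ) * I)⁻¹ * ((s : ℂ) - z)⁻¹ := by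
  have hpi := Real.pi_pos
  set a : ℂ := 2 * Real.pi * I * (z - s) with ha
  have hre : a.re = -(2 * Real.pi * z.im) := by
    simp [ha, Complex.mul_re, Complex.mul_im]
  have h0 : -a⁻¹ = (2 * (Real.pi : ℂ) * I)⁻¹ * ((s : ℂ) - z)⁻¹ := by
    rw [ha, mul_inv, ← mul_neg, ← inv_neg, neg_sub]
  rw [← h0, Real.fourier_real_eq_integral_exp_smul]
  rcases hθ with rfl | rfl
  · have h := integral_exp_mul_complex_Ioi (a := a) (by rw [hre]; nlinarith) 0
    rw [← integral_indicator measurableSet_Ioi] at h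
    have h2 : (fun v : ℝ => Complex.exp (↑(-2 * Real.pi * v * s) * I) • halfLineExp 1 z v)
        = (Set.Ioi (0 : ℝ)).indicator fun v : ℝ => Complex.exp (a * v) := by
      ext v
      simp only [Set.indicator, Set.mem_Ioi, halfLineExp, one_mul, Complex.ofReal_one, smul_eq_mul]
      split_ifs
      · rw [← Complex.exp_add]; congr 1; simp only [ha]; push_cast; ring
      · simp
    rw [h2, h]; simp [neg_div]
  · have h := integral_exp_mul_complex_Iic (a := a) (by rw [hre]; nlinarith) 0
    rw [setIntegral_congr_set Iio_ae_eq_Iic.symm, ← integral_indicator measurableSet_Iio] at h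
    have h2 : (fun v : ℝ => Complex.exp (↑(-2 * Real.pi * v * s) * I) • halfLineExp (-1) z v)
        = fun v => -(Set.Iio (0 : ℝ)).indicator (fun v : ℝ => Complex.exp (a * v)) v := by
      ext v
      simp only [Set.indicator, Set.mem_Iio, halfLineExp, neg_mul, one_mul, Complex.ofReal_neg,
        Complex.ofReal_one, Left.neg_pos_iff, smul_eq_mul]
      split_ifs
      · rw [mul_neg, ← Complex.exp_add]; congr 2; simp only [ha]; push_cast; ring
      · simp
    rw [h2, integral_neg, h]; simp

theorem halfLineExp_add_real (θ : ℝ) (z : ℂ) (l ξ : ℝ) :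
    halfLineExp θ (l + z) ξ = Complex.exp (↑(2 * Real.pi * ξ * l) * I) * halfLineExp θ z ξ := by
  unfold halfLineExp
  split_ifs
  · rw [mul_left_comm, ← Complex.exp_add]; congr 2; push_cast; ring
  · simp

theorem continuous_halfLineExp (θ ξ : ℝ) : Continuous fun z => halfLineExp θ z ξ := by
  unfold halfLineExp
  split_ifs <;> fun_prop

end HalfLineExp

/-! ### Boundary values in `L²` of the Cauchy integral -/

section CauchyTransform

/-- The Cauchy integral `(2π i)⁻¹ ∫_ℝ f(s) / (s - z) ds` of a vector-valued function. -/
def cauchyTransform {E : Type*} [NormedAddCommGroup E] [NormedSpace ℂ E] (f : ℝ → E) (z : ℂ) : E :=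
  (2 * (Real.pi : ℂ) * I)⁻¹ • ∫ s : ℝ, ((s : ℂ) - z)⁻¹ • f s

variable {E : Type*} [NormedAddCommGroup E] [InnerProductSpace ℂ E] [CompleteSpace E]
  {θ : ℝ} {z : ℂ}

/-- The Paley-Wiener representation of the Cauchy integral of an `L²` function. -/
theorem cauchyTransform_eq_integral_fourier (hθ : θ = 1 ∨ θ = -1) (hz : 0 < θ * z.im)
    (f : Lp E 2 (volume : Measure ℝ)) :
    cauchyTransform f z =
      ∫ ξ, halfLineExp θ z ξ • (𝓕 f : Lp E 2 (volume : Measure ℝ)) ξ := by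
  -- both sides are continuous in `f`, being pairings with `L²` functions
  have hk := memLp_halfLineExp hθ hz
  set B : Lp ℂ 2 (volume : Measure ℝ) →L[ℂ] Lp E 2 (volume : Measure ℝ) →L[ℂ] E :=
    (ContinuousLinearMap.lsmul ℂ ℂ (E := E)).lpPairing volume 2 2 with hB
  have hR : ∀ g : Lp E 2 (volume : Measure ℝ),
      B (hk.toLp _) g = ∫ ξ, halfLineExp θ z ξ • g ξ := fun g => by
    rw [hB, ContinuousLinearMap.lpPairing_eq_integral]
    refine integral_congr_ae ?_
    filter_upwards [hk.coeFn_toLp] with ξ hξ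
    simp [hξ]
  have hL : ∀ g : Lp E 2 (volume : Measure ℝ),
      B (𝓕 (hk.toLp _)) g = cauchyTransform g z := fun g => by
    rw [hB, ContinuousLinearMap.lpPairing_eq_integral, cauchyTransform, ← integral_smul]
    refine integral_congr_ae ?_
    filter_upwards [coeFn_fourier_toLp (integrable_halfLineExp hθ hz) hk] with ξ hξ
    simp [hξ, fourier_halfLineExp hθ hz, smul_smul]
  rw [← hR, ← hL]
  refine DenseRange.induction_on (SchwartzMap.denseRange_toLpCLM (E := ℝ) (F := E) (p := 2)
    (μ := volume) ENNReal.ofNat_ne_top) f ?_ fun g => ?_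
  · refine isClosed_eq (B (𝓕 (hk.toLp _))).continuous ((B (hk.toLp _)).continuous.comp ?_)
    exact (Lp.fourierTransformₗᵢ ℝ E).continuous
  · rw [SchwartzMap.toLpCLM_apply, SchwartzMap.toLp_fourier_eq, hR, hL, cauchyTransform,
      ← integral_smul]
    have h := integral_fourier_smul_eq (integrable_halfLineExp hθ hz) (g.integrable (μ := volume))
    calc _ = ∫ x, 𝓕 (halfLineExp θ z) x • g x := by
          refine integral_congr_ae ?_
          filter_upwards [g.coeFn_toLp 2 volume] with x hx
          rw [hx, fourier_halfLineExp hθ hz, smul_smul]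
      _ = _ := h
      _ = _ := by
          refine integral_congr_ae ?_
          filter_upwards [(𝓕 g).coeFn_toLp 2 volume] with x hx
          rw [hx, SchwartzMap.fourier_coe]

/-- Multiplication by `halfLineExp θ z` on `L²(ℝ)`. -/
def halfLineExpOp (hθ : θ = 1 ∨ θ = -1) (hz : 0 ≤ θ * z.im) :
    Lp E 2 (volume : Measure ℝ) →L[ℂ] Lp E 2 (volume : Measure ℝ) :=
  pointwiseOp (fun ξ => halfLineExp θ z ξ • ContinuousLinearMap.id ℂ E) 1
    ((measurable_halfLineExp θ z).aestronglyMeasurable.smul_const _) fun ξ => by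
      rw [norm_smul]
      exact mul_le_one₀ (norm_halfLineExp_le_one hθ hz ξ) (norm_nonneg _)
        ContinuousLinearMap.norm_id_le

theorem coeFn_halfLineExpOp (hθ : θ = 1 ∨ θ = -1) (hz : 0 ≤ θ * z.im)
    (f : Lp E 2 (volume : Measure ℝ)) :
    halfLineExpOp hθ hz f =ᵐ[volume] fun ξ => halfLineExp θ z ξ • f ξ :=
  coeFn_pointwiseOp f

variable (E) in
/-- The Cauchy projection `C^±` on `L²(ℝ; E)` for the sign `θ = ±1`, as a Fourier multiplier:
`C^+` is the restriction of the frequencies to `ξ > 0`, and `-C^-` the one to `ξ < 0`. -/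
def cauchyProj (hθ : θ = 1 ∨ θ = -1) :
    Lp E 2 (volume : Measure ℝ) →L[ℂ] Lp E 2 (volume : Measure ℝ) :=
  (Lp.fourierTransformₗᵢ ℝ E).symm.toContinuousLinearEquiv.toContinuousLinearMap ∘L
    (halfLineExpOp (z := 0) hθ (by simp)) ∘L
    (Lp.fourierTransformₗᵢ ℝ E).toContinuousLinearEquiv.toContinuousLinearMap

theorem cauchyProj_apply (hθ : θ = 1 ∨ θ = -1) (f : Lp E 2 (volume : Measure ℝ)) :
    cauchyProj E hθ f = 𝓕⁻ (halfLineExpOp (z := 0) hθ (by simp) (𝓕 f)) := rfl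

/-- On the line at height `θ δ`, the Cauchy integral is a Fourier multiplier. -/
theorem cauchyTransform_line_ae_eq (hθ : θ = 1 ∨ θ = -1) {δ : ℝ} (hδ : 0 < δ)
    (hz : 0 ≤ θ * (((θ * δ : ℝ) : ℂ) * I).im) (f : Lp E 2 (volume : Measure ℝ)) :
    (fun l : ℝ => cauchyTransform f ((l : ℂ) + (θ * δ : ℝ) * I)) =ᵐ[volume]
      (𝓕⁻ (halfLineExpOp hθ hz (𝓕 f)) : Lp E 2 (volume : Measure ℝ)) := by
  have hsq : θ * θ = 1 := by rcases hθ with rfl | rfl <;> norm_num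
  have hz' : 0 < θ * (((θ * δ : ℝ) : ℂ) * I).im := by
    simp [-Complex.ofReal_mul, ← mul_assoc, hsq, hδ]
  have hae := coeFn_halfLineExpOp hθ hz (𝓕 f)
  have hint : Integrable (halfLineExpOp hθ hz (𝓕 f)) volume := by
    refine Integrable.congr ?_ hae.symm
    exact memLp_one_iff_integrable.1 ((Lp.memLp (𝓕 f)).smul (memLp_halfLineExp hθ hz'))
  have h := coeFn_fourierInv_toLp hint (Lp.memLp _)
  rw [Lp.toLp_coeFn] at h
  refine EventuallyEq.trans (Eventually.of_forall fun l => ?_) h.symm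
  have hzl : 0 < θ * ((l : ℂ) + (θ * δ : ℝ) * I).im := by
    simpa [-Complex.ofReal_mul] using hz'
  beta_reduce
  rw [cauchyTransform_eq_integral_fourier hθ hzl, Real.fourierInv_eq']
  refine integral_congr_ae ?_
  filter_upwards [hae] with ξ hξ
  rw [hξ, halfLineExp_add_real, smul_smul]
  congr 4
  simp; ring

/-- The boundary values of the Cauchy integral exist in `L²`. -/
theorem tendsto_eLpNorm_cauchyTransform_sub (hθ : θ = 1 ∨ θ = -1)
    (f : Lp E 2 (volume : Measure ℝ)) :
    Tendsto (fun δ : ℝ => eLpNorm (fun l : ℝ =>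
      cauchyTransform f ((l : ℂ) + (θ * δ : ℝ) * I) - cauchyProj E hθ f l) 2 volume)
      (𝓝[>] 0) (𝓝 0) := by
  have hsq : θ * θ = 1 := by rcases hθ with rfl | rfl <;> norm_num
  have hz : ∀ {δ : ℝ}, 0 < δ → 0 ≤ θ * (((θ * δ : ℝ) : ℂ) * I).im := fun {δ} hδ => by
    simp [-Complex.ofReal_mul, ← mul_assoc, hsq, hδ.le]
  set u : Lp E 2 (volume : Measure ℝ) := 𝓕 f with hu
  -- by Plancherel, the norm is the norm of the difference of the multipliers applied to `𝓕 f`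
  have key : ∀ δ : ℝ, 0 < δ → eLpNorm (fun l : ℝ =>
      cauchyTransform f ((l : ℂ) + (θ * δ : ℝ) * I) - cauchyProj E hθ f l) 2 volume =
      (∫⁻ ξ, ‖(halfLineExp θ ((θ * δ : ℝ) * I) ξ - halfLineExp θ 0 ξ) • u ξ‖ₑ ^ (2 : ℝ))
        ^ (1 / (2 : ℝ)) := by
    intro δ hδ
    have h1 : (fun l : ℝ => cauchyTransform f ((l : ℂ) + (θ * δ : ℝ) * I) - cauchyProj E hθ f l)
        =ᵐ[volume] (𝓕⁻ (halfLineExpOp hθ (hz hδ) u - halfLineExpOp (z := 0) hθ (by simp) u) :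
          Lp E 2 (volume : Measure ℝ)) := by
      have h2 : (𝓕⁻ (halfLineExpOp hθ (hz hδ) u - halfLineExpOp (z := 0) hθ (by simp) u) :
          Lp E 2 (volume : Measure ℝ)) = 𝓕⁻ (halfLineExpOp hθ (hz hδ) u) - cauchyProj E hθ f :=
        (Lp.fourierTransformₗᵢ ℝ E).symm.map_sub _ _
      rw [h2]
      filter_upwards [cauchyTransform_line_ae_eq hθ hδ (hz hδ) f, Lp.coeFn_sub
        (𝓕⁻ (halfLineExpOp hθ (hz hδ) u)) (cauchyProj E hθ f)] with l hl hl'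
      rw [hl', Pi.sub_apply, hl]
    rw [eLpNorm_congr_ae h1, ← Lp.enorm_def]
    have h3 : ‖(𝓕⁻ (halfLineExpOp hθ (hz hδ) u - halfLineExpOp (z := 0) hθ (by simp) u) :
        Lp E 2 (volume : Measure ℝ))‖ₑ =
        ‖halfLineExpOp hθ (hz hδ) u - halfLineExpOp (z := 0) hθ (by simp) u‖ₑ := by
      rw [← ofReal_norm, ← ofReal_norm]
      congr 1
      exact (Lp.fourierTransformₗᵢ ℝ E).symm.norm_map _
    rw [h3, Lp.enorm_def, eLpNorm_eq_lintegral_rpow_enorm_toReal two_ne_zero ENNReal.ofNat_ne_top,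
      ENNReal.toReal_ofNat]
    congr 1
    refine lintegral_congr_ae ?_
    filter_upwards [Lp.coeFn_sub (halfLineExpOp hθ (hz hδ) u)
      (halfLineExpOp (z := 0) hθ (by simp) u), coeFn_halfLineExpOp hθ (hz hδ) u,
      coeFn_halfLineExpOp (z := 0) hθ (by simp) u] with ξ h1 h2 h3
    rw [h1, Pi.sub_apply, h2, h3, sub_smul]
  have hlim : Tendsto (fun δ : ℝ =>
      ∫⁻ ξ, ‖(halfLineExp θ ((θ * δ : ℝ) * I) ξ - halfLineExp θ 0 ξ) • u ξ‖ₑ ^ (2 : ℝ))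
      (𝓝[>] 0) (𝓝 (∫⁻ _ : ℝ, 0)) := by
    refine tendsto_lintegral_filter_of_dominated_convergence
      (fun ξ => (2 * ‖u ξ‖ₑ) ^ (2 : ℝ)) (Eventually.of_forall fun δ => ?_) ?_ ?_ ?_
    · exact
        ((((measurable_halfLineExp _ _).sub (measurable_halfLineExp _ _)).stronglyMeasurable.smul
        (Lp.stronglyMeasurable u)).enorm.pow_const _)
    · filter_upwards [self_mem_nhdsWithin] with δ hδ
      refine Eventually.of_forall fun ξ => ?_
      gcongr
      rw [enorm_smul]
      gcongr
      rw [← ofReal_norm, ← ENNReal.ofReal_ofNat]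
      refine ENNReal.ofReal_le_ofReal ((norm_sub_le _ _).trans ?_)
      have h1 := norm_halfLineExp_le_one hθ (hz hδ) ξ
      have h2 := norm_halfLineExp_le_one (z := 0) hθ (by simp) ξ
      linarith
    · have h := (Lp.memLp u).2
      rw [eLpNorm_lt_top_iff_lintegral_rpow_enorm_lt_top two_ne_zero ENNReal.ofNat_ne_top,
        ENNReal.toReal_ofNat] at h
      simp_rw [ENNReal.mul_rpow_of_nonneg _ _ zero_le_two]
      rw [lintegral_const_mul' _ _ (by simp)]
      exact ENNReal.mul_ne_top (by simp) h.ne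
    · refine Eventually.of_forall fun ξ => ?_
      have hc : Continuous fun δ : ℝ =>
          ‖(halfLineExp θ ((θ * δ : ℝ) * I) ξ - halfLineExp θ 0 ξ) • u ξ‖ₑ ^ (2 : ℝ) := by
        have := (continuous_halfLineExp θ ξ).comp
          (by fun_prop : Continuous fun δ : ℝ => ((θ * δ : ℝ) : ℂ) * I)
        exact ENNReal.continuous_rpow_const.comp
          (((this.sub continuous_const).smul continuous_const).enorm)
      have := (hc.tendsto 0).mono_left (nhdsWithin_le_nhds (s := Set.Ioi (0 : ℝ)))
      simpa using this
  have hfin := (ENNReal.continuous_rpow_const (y := 1 / (2 : ℝ))).tendsto _ |>.comp hlim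
  simp only [lintegral_zero] at hfin
  rw [ENNReal.zero_rpow_of_pos (by norm_num)] at hfin
  refine hfin.congr' ?_
  filter_upwards [self_mem_nhdsWithin] with δ hδ
  exact (key δ hδ).symm

end CauchyTransform

/-! ### The Cauchy integral of an integrable function -/

section CauchyTransformGeneral

variable {E : Type*} [NormedAddCommGroup E] [NormedSpace ℂ E]

theorem abs_im_le_norm_ofReal_sub (s : ℝ) (z : ℂ) : |z.im| ≤ ‖(s : ℂ) - z‖ := by
  simpa using Complex.abs_im_le_norm ((s : ℂ) - z)

theorem norm_cauchyTransform_le {f : ℝ → E} (hf : Integrable f) {z : ℂ} (hz : z.im ≠ 0) :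
    ‖cauchyTransform f z‖ ≤ (2 * Real.pi)⁻¹ * ((∫ s, ‖f s‖) * |z.im|⁻¹) := by
  have hpi := Real.pi_pos
  have h0 : 0 < |z.im| := abs_pos.2 hz
  rw [cauchyTransform, norm_smul]
  refine mul_le_mul (by simp [abs_of_pos hpi]) ?_ (norm_nonneg _) (by positivity)
  rw [← integral_mul_const]
  refine norm_integral_le_of_norm_le (hf.norm.mul_const _) (.of_forall fun s => ?_)
  rw [norm_smul, norm_inv, mul_comm]
  gcongr
  exact abs_im_le_norm_ofReal_sub s z

instance isCountablyGenerated_cobounded : (Bornology.cobounded ℂ).IsCountablyGenerated := by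
  rw [← comap_norm_atTop]; infer_instance

theorem tendsto_cauchyTransform_cobounded {f : ℝ → E} (hf : Integrable f) {δ : ℝ} (hδ : 0 < δ) :
    Tendsto (cauchyTransform f) (Bornology.cobounded ℂ ⊓ 𝓟 {z : ℂ | δ ≤ |z.im|}) (𝓝 0) := by
  have hbd : ∀ (s : ℝ) (z : ℂ), δ ≤ |z.im| → ‖((s : ℂ) - z)⁻¹‖ ≤ δ⁻¹ := fun s z hz => by
    rw [norm_inv]
    gcongr
    exact hz.trans (abs_im_le_norm_ofReal_sub s z)
  have h : Tendsto (fun z : ℂ => ∫ s : ℝ, ((s : ℂ) - z)⁻¹ • f s)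
      (Bornology.cobounded ℂ ⊓ 𝓟 {z : ℂ | δ ≤ |z.im|}) (𝓝 (∫ _ : ℝ, (0 : E))) := by
    refine tendsto_integral_filter_of_dominated_convergence (fun s => δ⁻¹ * ‖f s‖) ?_ ?_
      (hf.norm.const_mul _) ?_
    · refine Eventually.of_forall fun z => ?_
      refine AEStronglyMeasurable.smul ?_ hf.1
      exact (by fun_prop : Measurable fun s : ℝ => ((s : ℂ) - z)⁻¹).aestronglyMeasurable
    · filter_upwards [mem_inf_of_right (mem_principal_self _)] with z hz
      refine Eventually.of_forall fun s => ?_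
      rw [norm_smul]
      gcongr
      exact hbd s z hz
    · refine Eventually.of_forall fun s => ?_
      have h1 : Tendsto (fun z : ℂ => ((s : ℂ) - z)⁻¹) (Bornology.cobounded ℂ) (𝓝 0) :=
        tendsto_inv₀_cobounded.comp (tendsto_const_sub_cobounded (s : ℂ))
      simpa using (h1.mono_left inf_le_left).smul_const (f s)
  have h2 := h.const_smul ((2 * (Real.pi : ℂ) * I)⁻¹)
  rw [integral_zero, smul_zero] at h2
  exact h2

theorem differentiableAt_cauchyTransform [CompleteSpace E] {f : ℝ → E} (hf : Integrable f) {z : ℂ}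
    (hz : z.im ≠ 0) : DifferentiableAt ℂ (cauchyTransform f) z := by
  have h0 : 0 < |z.im| := abs_pos.2 hz
  set r := |z.im| / 2 with hr
  have hr0 : 0 < r := by positivity
  have him : ∀ w ∈ Metric.ball z r, r ≤ |w.im| := fun w hw => by
    have h1 : |w.im - z.im| ≤ ‖w - z‖ := by simpa using Complex.abs_im_le_norm (w - z)
    have h2 : ‖w - z‖ < r := by simpa [dist_eq_norm] using hw
    have h3 : |z.im| - |w.im| ≤ |w.im - z.im| := by
      rw [abs_sub_comm]; exact abs_sub_abs_le_abs_sub _ _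
    linarith
  have hbd : ∀ (s : ℝ), ∀ w ∈ Metric.ball z r, r ≤ ‖(s : ℂ) - w‖ := fun s w hw =>
    (him w hw).trans (abs_im_le_norm_ofReal_sub s w)
  have hmeas : ∀ w : ℂ, AEStronglyMeasurable (fun s : ℝ => ((s : ℂ) - w)⁻¹ • f s) volume :=
    fun w => AEStronglyMeasurable.smul
      (by fun_prop : Measurable fun s : ℝ => ((s : ℂ) - w)⁻¹).aestronglyMeasurable hf.1
  have key := hasDerivAt_integral_of_dominated_loc_of_deriv_le (𝕜 := ℂ) (μ := volume)
    (F := fun (w : ℂ) (s : ℝ) => ((s : ℂ) - w)⁻¹ • f s)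
    (F' := fun (w : ℂ) (s : ℝ) => (((s : ℂ) - w) ^ 2)⁻¹ • f s)
    (bound := fun s => (r ^ 2)⁻¹ * ‖f s‖) (x₀ := z) (Metric.ball_mem_nhds z hr0)
    (Eventually.of_forall hmeas) ?_ ?_ ?_ (hf.norm.const_mul _) ?_
  · exact (key.2.differentiableAt).const_smul _
  · refine (hf.norm.const_mul r⁻¹).mono' (hmeas z) (.of_forall fun s => ?_)
    rw [norm_smul, norm_inv]
    gcongr
    exact hbd s z (Metric.mem_ball_self hr0)
  · exact AEStronglyMeasurable.smul
      (by fun_prop : Measurable fun s : ℝ => (((s : ℂ) - z) ^ 2)⁻¹).aestronglyMeasurable hf.1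
  · refine Eventually.of_forall fun s w hw => ?_
    rw [norm_smul, norm_inv, norm_pow]
    gcongr
    exact hbd s w hw
  · refine Eventually.of_forall fun s w hw => ?_
    have hne : (s : ℂ) - w ≠ 0 := norm_pos_iff.1 (hr0.trans_le (hbd s w hw))
    have h1 : HasDerivAt (fun w : ℂ => ((s : ℂ) - w)⁻¹) ((((s : ℂ) - w) ^ 2)⁻¹) w := by
      have := ((hasDerivAt_id w).const_sub (s : ℂ)).inv hne
      simpa [neg_div] using! this
    exact h1.smul_const _

end CauchyTransformGeneral

/-! ### Functions that are Lipschitz in the `L²` mean -/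

/-- A function that is Lipschitz in the `L²` mean: `‖f(· + h) - f‖₂ ≤ C h` for `0 < h ≤ 1`. -/
def L2Lipschitz {E : Type*} [NormedAddCommGroup E] (f : ℝ → E) : Prop :=
  ∃ C : ℝ, ∀ h : ℝ, 0 < h → h ≤ 1 →
    eLpNorm (fun s => f (s + h) - f s) 2 volume ≤ ENNReal.ofReal (C * h)

theorem integrable_of_memLp_two_of_memLp_mul {E : Type*} [NormedAddCommGroup E] [NormedSpace ℂ E]
    {f : ℝ → E} (hf : MemLp f 2 volume) (hf' : MemLp (fun t : ℝ => (t : ℂ) • f t) 2 volume) :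
    Integrable f := by
  have h1 := (memLp_two_iff_integrable_sq_norm hf.1).1 hf
  have h2 := (memLp_two_iff_integrable_sq_norm hf'.1).1 hf'
  refine ((h1.add h2).add integrable_inv_one_add_sq).mono' hf.1 (.of_forall fun t => ?_)
  have h3 : ‖(t : ℂ) • f t‖ ^ 2 = t ^ 2 * ‖f t‖ ^ 2 := by
    rw [norm_smul, mul_pow, Complex.norm_real, Real.norm_eq_abs, sq_abs]
  simp only [Pi.add_apply, h3]
  have h4 : 0 < 1 + t ^ 2 := by positivity
  -- `x ≤ a x² + 1 / a` with `a = 1 + t²`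
  have h5 : 0 ≤ (1 + t ^ 2)⁻¹ * ((1 + t ^ 2) * ‖f t‖ - 1) ^ 2 := by positivity
  have h6 : (1 + t ^ 2)⁻¹ * ((1 + t ^ 2) * ‖f t‖ - 1) ^ 2 =
      (1 + t ^ 2) * ‖f t‖ ^ 2 - 2 * ‖f t‖ + (1 + t ^ 2)⁻¹ := by
    field_simp; ring
  have := norm_nonneg (f t)
  linarith

section Hilbert

variable {E : Type*} [NormedAddCommGroup E] [InnerProductSpace ℂ E]

theorem fourier_translate_sub {f : ℝ → E} (h1 : Integrable f) (h ξ : ℝ) :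
    𝓕 (fun s => f (s + h) - f s) ξ =
      (Complex.exp (↑(2 * Real.pi * h * ξ) * I) - 1) • 𝓕 f ξ := by
  have h2 : 𝓕 (fun s => f (s + h)) ξ = Complex.exp (↑(2 * Real.pi * h * ξ) * I) • 𝓕 f ξ := by
    rw [Real.fourier_real_eq_integral_exp_smul, Real.fourier_real_eq_integral_exp_smul,
      ← integral_smul, ← integral_sub_right_eq_self _ h]
    refine integral_congr_ae (.of_forall fun v => ?_)
    beta_reduce
    rw [sub_add_cancel, smul_smul, ← Complex.exp_add]
    congr 2
    push_cast; ring
  rw [sub_smul, one_smul, ← h2]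
  simp only [Real.fourier_eq, smul_sub]
  refine integral_sub ?_ ?_
  · exact (Real.fourierIntegral_convergent_iff ξ).2 (h1.comp_add_right h)
  · exact (Real.fourierIntegral_convergent_iff ξ).2 h1

variable [CompleteSpace E]

/-- Plancherel's theorem on `L¹ ∩ L²`. -/
theorem eLpNorm_fourier_eq {f : ℝ → E} (h1 : Integrable f) (h2 : MemLp f 2 volume) :
    eLpNorm (𝓕 f) 2 volume = eLpNorm f 2 volume := by
  rw [← eLpNorm_congr_ae (coeFn_fourier_toLp h1 h2), ← eLpNorm_congr_ae h2.coeFn_toLp,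
    ← Lp.enorm_def, ← Lp.enorm_def, ← ofReal_norm, ← ofReal_norm, Lp.norm_fourier_eq]

/-- If an integrable function is Lipschitz in the `L²` mean, then its Fourier transform is
integrable. -/
theorem integrable_fourier_of_L2Lipschitz {f : ℝ → E} (h1 : Integrable f)
    (h2 : MemLp f 2 volume) (hf : L2Lipschitz f) : Integrable (𝓕 f) := by
  obtain ⟨C, hC⟩ := hf
  have hmeas : AEStronglyMeasurable (𝓕 f) volume :=
    (locallyIntegrable_fourier h1).aestronglyMeasurable
  have hF : MemLp (𝓕 f) 2 volume := ⟨hmeas, by rw [eLpNorm_fourier_eq h1 h2]; exact h2.2⟩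
  refine integrable_of_memLp_two_of_memLp_mul hF ?_
  set d : ℕ → ℝ := fun n => 1 / ((n : ℝ) + 1) with hd
  have hd0 : ∀ n, 0 < d n := fun n => by positivity
  have hd1 : ∀ n, d n ≤ 1 := fun n => by
    rw [hd, div_le_one (by positivity)]; linarith [(Nat.cast_nonneg n : (0 : ℝ) ≤ n)]
  have hdlim : Tendsto d atTop (𝓝[≠] 0) :=
    tendsto_nhdsWithin_iff.2 ⟨tendsto_one_div_add_atTop_nhds_zero_nat,
      .of_forall fun n => (hd0 n).ne'⟩
  -- the multipliers of the difference quotients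
  set m : ℕ → ℝ → ℂ := fun n ξ =>
    ((d n : ℂ))⁻¹ * (Complex.exp (↑(2 * Real.pi * d n * ξ) * I) - 1) with hm
  have hbound : ∀ n, eLpNorm (fun ξ => m n ξ • 𝓕 f ξ) 2 volume ≤ ENNReal.ofReal C := fun n => by
    have e1 : (fun ξ => m n ξ • 𝓕 f ξ) = ((d n : ℂ))⁻¹ • 𝓕 (fun s => f (s + d n) - f s) := by
      ext ξ
      rw [Pi.smul_apply, fourier_translate_sub h1, smul_smul]
    have hi : Integrable (fun s => f (s + d n) - f s) := (h1.comp_add_right _).sub h1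
    have hi2 : MemLp (fun s => f (s + d n) - f s) 2 volume :=
      (h2.comp_measurePreserving (measurePreserving_add_right volume (d n))).sub h2
    rw [e1, eLpNorm_const_smul, eLpNorm_fourier_eq hi hi2]
    refine (mul_le_mul_right (hC _ (hd0 n) (hd1 n)) _).trans (le_of_eq ?_)
    rw [← ofReal_norm, ← ENNReal.ofReal_mul (norm_nonneg _), norm_inv, Complex.norm_real,
      Real.norm_of_nonneg (hd0 n).le]
    congr 1
    field_simp [(hd0 n).ne']
  have hlim : ∀ ξ, Tendsto (fun n => m n ξ • 𝓕 f ξ) atTop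
      (𝓝 ((2 * Real.pi * I * ξ) • 𝓕 f ξ)) := fun ξ => by
    refine Tendsto.smul_const ?_ _
    have hder : HasDerivAt (fun h : ℝ => Complex.exp (↑(2 * Real.pi * h * ξ) * I))
        (2 * Real.pi * I * ξ) 0 := by
      have h3 : HasDerivAt (fun h : ℝ => (h : ℂ) * (2 * Real.pi * I * ξ))
          (2 * Real.pi * I * ξ) 0 := by
        simpa using (Complex.ofRealCLM.hasDerivAt (x := (0 : ℝ))).mul_const (2 * Real.pi * I * ξ)
      have h4 := h3.cexp
      simp only [Complex.ofReal_zero, zero_mul, Complex.exp_zero, one_mul] at h4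
      refine h4.congr_of_eventuallyEq (.of_forall fun h => ?_)
      simp only
      congr 1; push_cast; ring
    have := (hasDerivAt_iff_tendsto_slope.1 hder).comp hdlim
    refine this.congr fun n => ?_
    simp [slope, hm]
  have hle := Lp.eLpNorm_lim_le_liminf_eLpNorm (p := 2) (μ := volume)
    (fun n => AEStronglyMeasurable.smul (by fun_prop : Measurable (m n)).aestronglyMeasurable hmeas)
    _ (.of_forall hlim)
  have hfin : MemLp (fun ξ : ℝ => (2 * Real.pi * I * ξ : ℂ) • 𝓕 f ξ) 2 volume := by
    refine ⟨AEStronglyMeasurable.smul (by fun_prop : Measurable fun ξ : ℝ =>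
      (2 * Real.pi * I * ξ : ℂ)).aestronglyMeasurable hmeas, ?_⟩
    refine (hle.trans ?_).trans_lt (ENNReal.ofReal_lt_top (r := C))
    exact (liminf_le_liminf (.of_forall hbound)).trans (by simp)
  refine (hfin.const_smul (2 * (Real.pi : ℂ) * I)⁻¹).ae_eq (.of_forall fun ξ => ?_)
  have hpi : (2 * (Real.pi : ℂ) * I) ≠ 0 := by simp [Real.pi_ne_zero]
  simp only [Pi.smul_apply, smul_smul]
  rw [inv_mul_cancel_left₀ hpi]

end Hilbert

/-! ### Continuous boundary values of the Cauchy integral -/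

section HalfPlaneExtension

variable {E : Type*} [NormedAddCommGroup E] [InnerProductSpace ℂ E]
  {θ : ℝ}

theorem continuousOn_integral_halfLineExp (hθ : θ = 1 ∨ θ = -1) {G : ℝ → E} (hG : Integrable G) :
    ContinuousOn (fun z => ∫ ξ, halfLineExp θ z ξ • G ξ) {z : ℂ | 0 ≤ θ * z.im} := by
  refine continuousOn_of_dominated (bound := fun ξ => ‖G ξ‖) (fun z _ => ?_) (fun z hz => ?_)
    hG.norm (.of_forall fun ξ => ?_)
  · exact (measurable_halfLineExp θ z).aestronglyMeasurable.smul hG.1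
  · refine .of_forall fun ξ => ?_
    rw [norm_smul]
    exact mul_le_of_le_one_left (norm_nonneg _) (norm_halfLineExp_le_one hθ hz ξ)
  · exact ((continuous_halfLineExp θ ξ).smul continuous_const).continuousOn

theorem norm_halfLineExp_add_sub_le (hθ : θ = 1 ∨ θ = -1) {z : ℂ} (hz : 0 ≤ θ * z.im) {δ : ℝ}
    (hδ : 0 ≤ δ) (ξ : ℝ) :
    ‖halfLineExp θ (z + (θ * δ : ℝ) * I) ξ - halfLineExp θ z ξ‖ ≤
      1 - Real.exp (-(2 * Real.pi * δ * |ξ|)) := by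
  have hle : Real.exp (-(2 * Real.pi * δ * |ξ|)) ≤ 1 := by
    rw [Real.exp_le_one_iff, neg_nonpos]; have := Real.pi_pos; positivity
  by_cases h : 0 < θ * ξ
  · have habs : θ * ξ = |ξ| := by
      rcases hθ with rfl | rfl
      · rw [abs_of_pos (by linarith)]; ring
      · rw [abs_of_neg (by linarith)]; ring
    have h1 : halfLineExp θ (z + (θ * δ : ℝ) * I) ξ =
        halfLineExp θ z ξ * (Real.exp (-(2 * Real.pi * δ * |ξ|)) : ℝ) := by
      unfold halfLineExp
      rw [if_pos h, if_pos h, Complex.ofReal_exp, mul_assoc (θ : ℂ), ← Complex.exp_add, ← habs]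
      congr 2
      push_cast
      linear_combination (2 * Real.pi * ξ * θ * δ : ℂ) * Complex.I_sq
    have h2 : halfLineExp θ z ξ * (Real.exp (-(2 * Real.pi * δ * |ξ|)) : ℝ) - halfLineExp θ z ξ =
        halfLineExp θ z ξ * ((Real.exp (-(2 * Real.pi * δ * |ξ|)) - 1 : ℝ) : ℂ) := by
      push_cast; ring
    rw [h1, h2, norm_mul, Complex.norm_real, Real.norm_eq_abs, abs_sub_comm,
      abs_of_nonneg (sub_nonneg.2 hle)]
    exact mul_le_of_le_one_left (sub_nonneg.2 hle) (norm_halfLineExp_le_one hθ hz ξ)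
  · simp only [halfLineExp, if_neg h, sub_zero, norm_zero]
    exact sub_nonneg.2 hle

theorem tendsto_integral_one_sub_exp_mul {F : Type*} [NormedAddCommGroup F] {G : ℝ → F}
    (hG : Integrable G) :
    Tendsto (fun δ : ℝ => ∫ ξ, (1 - Real.exp (-(2 * Real.pi * δ * |ξ|))) * ‖G ξ‖)
      (𝓝[>] 0) (𝓝 0) := by
  have h : Tendsto (fun δ : ℝ => ∫ ξ, (1 - Real.exp (-(2 * Real.pi * δ * |ξ|))) * ‖G ξ‖)
      (𝓝[>] 0) (𝓝 (∫ _ : ℝ, (0 : ℝ))) := by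
    refine tendsto_integral_filter_of_dominated_convergence (fun ξ => ‖G ξ‖)
      (.of_forall fun δ => ?_) ?_ hG.norm (.of_forall fun ξ => ?_)
    · exact (by fun_prop : Measurable fun ξ : ℝ =>
        1 - Real.exp (-(2 * Real.pi * δ * |ξ|))).aestronglyMeasurable.mul hG.1.norm
    · filter_upwards [self_mem_nhdsWithin] with δ (hδ : 0 < δ)
      refine .of_forall fun ξ => ?_
      have hle : Real.exp (-(2 * Real.pi * δ * |ξ|)) ≤ 1 := by
        rw [Real.exp_le_one_iff, neg_nonpos]; have := Real.pi_pos; positivity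
      rw [norm_mul, norm_norm, Real.norm_of_nonneg (sub_nonneg.2 hle)]
      exact mul_le_of_le_one_left (norm_nonneg _)
        (by linarith [Real.exp_pos (-(2 * Real.pi * δ * |ξ|))])
    · have hc : Continuous fun δ : ℝ => (1 - Real.exp (-(2 * Real.pi * δ * |ξ|))) * ‖G ξ‖ := by
        fun_prop
      have := (hc.tendsto 0).mono_left (nhdsWithin_le_nhds (s := Set.Ioi (0 : ℝ)))
      simpa using this
  simpa using h

variable [CompleteSpace E]

/-- Boundary behaviour of the Cauchy integral of an integrable function that is Lipschitz in the
`L²` mean: it extends continuously to each closed half-plane and vanishes at infinity there. -/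
theorem cauchyTransform_boundary (hθ : θ = 1 ∨ θ = -1) {f : ℝ → E} (h1 : Integrable f)
    (h2 : MemLp f 2 volume) (hf : L2Lipschitz f) :
    (∃ U : ℝ → E, Continuous U ∧
      (∀ l : ℝ, Tendsto (cauchyTransform f) (𝓝[{z | 0 < θ * z.im}] (l : ℂ)) (𝓝 (U l))) ∧
      U =ᵐ[volume] cauchyProj E hθ (h2.toLp f)) ∧
    Tendsto (cauchyTransform f) (Bornology.cobounded ℂ ⊓ 𝓟 {z : ℂ | 0 < θ * z.im}) (𝓝 0) := by
  have hsq : θ * θ = 1 := by rcases hθ with rfl | rfl <;> norm_num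
  have hG := integrable_fourier_of_L2Lipschitz h1 h2 hf
  have hcoe := coeFn_fourier_toLp h1 h2
  set Φ : ℂ → E := fun z => ∫ ξ, halfLineExp θ z ξ • 𝓕 f ξ with hΦ
  have hcont : ContinuousOn Φ {z : ℂ | 0 ≤ θ * z.im} := continuousOn_integral_halfLineExp hθ hG
  have heq : ∀ z : ℂ, 0 < θ * z.im → cauchyTransform f z = Φ z := fun z hz => by
    have h3 : cauchyTransform f z = cauchyTransform (h2.toLp f) z := by
      simp only [cauchyTransform]
      congr 1
      refine integral_congr_ae ?_
      filter_upwards [h2.coeFn_toLp] with s hs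
      rw [hs]
    rw [h3, cauchyTransform_eq_integral_fourier hθ hz]
    refine integral_congr_ae ?_
    filter_upwards [hcoe] with ξ hξ
    rw [hξ]
  refine ⟨⟨fun l => Φ l, ?_, fun l => ?_, ?_⟩, ?_⟩
  · exact hcont.comp_continuous Complex.continuous_ofReal fun l => by simp
  · have h3 : Tendsto Φ (𝓝[{z | 0 < θ * z.im}] (l : ℂ)) (𝓝 (Φ l)) :=
      (hcont l (by simp)).mono_left (nhdsWithin_mono _ fun z hz => by
        simp only [Set.mem_ofPred_eq] at hz ⊢; exact hz.le)
    refine h3.congr' ?_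
    filter_upwards [self_mem_nhdsWithin] with z hz
    exact (heq z hz).symm
  · rw [cauchyProj_apply]
    have hae := coeFn_halfLineExpOp (z := 0) hθ (by simp) (𝓕 (h2.toLp f))
    have hae' : halfLineExpOp (z := 0) hθ (by simp) (𝓕 (h2.toLp f)) =ᵐ[volume]
        fun ξ => halfLineExp θ 0 ξ • 𝓕 f ξ := by
      filter_upwards [hae, hcoe] with ξ hξ hξ'
      rw [hξ, hξ']
    have hint : Integrable (halfLineExpOp (z := 0) hθ (by simp) (𝓕 (h2.toLp f))) volume := by
      refine Integrable.congr ?_ hae'.symm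
      refine hG.norm.mono' ((measurable_halfLineExp θ 0).aestronglyMeasurable.smul hG.1)
        (.of_forall fun ξ => ?_)
      rw [norm_smul]
      exact mul_le_of_le_one_left (norm_nonneg _) (norm_halfLineExp_le_one hθ (by simp) ξ)
    have h := coeFn_fourierInv_toLp hint (Lp.memLp _)
    rw [Lp.toLp_coeFn] at h
    refine EventuallyEq.trans (Eventually.of_forall fun l => ?_) h.symm
    rw [Real.fourierInv_eq']
    refine integral_congr_ae ?_
    filter_upwards [hae'] with ξ hξ
    have h4 := halfLineExp_add_real θ 0 l ξ
    rw [add_zero] at h4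
    rw [hξ, h4, smul_smul]
    congr 4
    simp; ring
  · have hint : ∀ z : ℂ, 0 ≤ θ * z.im → Integrable fun ξ => halfLineExp θ z ξ • 𝓕 f ξ :=
      fun z hz => hG.norm.mono' ((measurable_halfLineExp θ z).aestronglyMeasurable.smul hG.1)
        (.of_forall fun ξ => by
          rw [norm_smul]
          exact mul_le_of_le_one_left (norm_nonneg _) (norm_halfLineExp_le_one hθ hz ξ))
    rw [Metric.tendsto_nhds]
    intro ε hε
    -- a shift by a small `δ` into the half-plane changes the integral by less than `ε / 2`,
    -- uniformly, and at distance `δ` from the line the integral decays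
    obtain ⟨δ, hδlt, hδ⟩ := ((tendsto_integral_one_sub_exp_mul hG).eventually
      (gt_mem_nhds (half_pos hε))).and self_mem_nhdsWithin |>.exists
    have hδ0 : (0 : ℝ) < δ := hδ
    have hshift : Tendsto (fun z : ℂ => z + (θ * δ : ℝ) * I)
        (Bornology.cobounded ℂ ⊓ 𝓟 {z : ℂ | 0 < θ * z.im})
        (Bornology.cobounded ℂ ⊓ 𝓟 {z : ℂ | δ ≤ |z.im|}) := by
      refine tendsto_inf.2 ⟨(tendsto_add_const_cobounded _).mono_left inf_le_left, ?_⟩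
      refine tendsto_principal.2 (mem_inf_of_right fun z hz => ?_)
      have hz' : 0 < θ * z.im := hz
      simp only [Set.mem_ofPred_eq, Complex.add_im, Complex.mul_im, Complex.ofReal_re, Complex.I_im,
        mul_one, Complex.ofReal_im, Complex.I_re, mul_zero, add_zero]
      have h5 : θ * (z.im + θ * δ) = θ * z.im + δ := by linear_combination δ * hsq
      have h6 : |θ * (z.im + θ * δ)| = |z.im + θ * δ| := by
        rw [abs_mul]; rcases hθ with rfl | rfl <;> simp
      rw [← h6, h5, abs_of_pos (by linarith)]
      linarith
    have hdec := (tendsto_cauchyTransform_cobounded h1 hδ0).comp hshift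
    rw [Metric.tendsto_nhds] at hdec
    filter_upwards [hdec (ε / 2) (half_pos hε), mem_inf_of_right (mem_principal_self _)]
      with z hz hz'
    have hz0 : 0 < θ * z.im := hz'
    have hz1 : 0 < θ * (z + (θ * δ : ℝ) * I).im := by
      simp only [Complex.add_im, Complex.mul_im, Complex.ofReal_re, Complex.I_im,
        mul_one, Complex.ofReal_im, Complex.I_re, mul_zero, add_zero]
      have h5 : θ * (z.im + θ * δ) = θ * z.im + δ := by linear_combination δ * hsq
      rw [h5]; linarith
    rw [dist_zero_right] at hz ⊢
    simp only [Function.comp_apply] at hz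
    rw [heq _ hz1] at hz
    rw [heq _ hz0]
    have hdiff : ‖Φ (z + (θ * δ : ℝ) * I) - Φ z‖ ≤
        ∫ ξ, (1 - Real.exp (-(2 * Real.pi * δ * |ξ|))) * ‖𝓕 f ξ‖ := by
      rw [hΦ]
      beta_reduce
      rw [← integral_sub (hint _ hz1.le) (hint _ hz0.le)]
      refine norm_integral_le_of_norm_le ?_ (.of_forall fun ξ => ?_)
      · refine hG.norm.mono' ((by fun_prop : Measurable fun ξ : ℝ =>
          1 - Real.exp (-(2 * Real.pi * δ * |ξ|))).aestronglyMeasurable.mul hG.1.norm)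
          (.of_forall fun ξ => ?_)
        have hle : Real.exp (-(2 * Real.pi * δ * |ξ|)) ≤ 1 := by
          rw [Real.exp_le_one_iff, neg_nonpos]; have := Real.pi_pos; positivity
        rw [norm_mul, norm_norm, Real.norm_of_nonneg (sub_nonneg.2 hle)]
        exact mul_le_of_le_one_left (norm_nonneg _)
          (by linarith [Real.exp_pos (-(2 * Real.pi * δ * |ξ|))])
      · rw [← sub_smul, norm_smul]
        gcongr
        exact norm_halfLineExp_add_sub_le hθ hz0.le hδ0.le ξ
    have h7 : ‖Φ z‖ ≤ ‖Φ (z + (θ * δ : ℝ) * I)‖ + ‖Φ (z + (θ * δ : ℝ) * I) - Φ z‖ := by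
      have := norm_sub_le (Φ (z + (θ * δ : ℝ) * I)) (Φ (z + (θ * δ : ℝ) * I) - Φ z)
      rwa [sub_sub_cancel] at this
    linarith

/-- A continuous integrable function that is Lipschitz in the `L²` mean vanishes at infinity. -/
theorem tendsto_cocompact_of_L2Lipschitz {f : ℝ → E} (hc : Continuous f) (h1 : Integrable f)
    (h2 : MemLp f 2 volume) (hf : L2Lipschitz f) : Tendsto f (cocompact ℝ) (𝓝 0) := by
  have hG := integrable_fourier_of_L2Lipschitz h1 h2 hf
  rw [← hc.fourierInv_fourier_eq h1 hG, Real.fourierInv_eq_fourier_comp_neg]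
  exact Real.zero_at_infty_fourier _

end HalfPlaneExtension

/-! ### Algebra of the Cauchy projections -/

section CauchyProj

variable {E : Type*} [NormedAddCommGroup E] [InnerProductSpace ℂ E] [CompleteSpace E]

theorem halfLineExp_zero (θ ξ : ℝ) : halfLineExp θ 0 ξ = if 0 < θ * ξ then (θ : ℂ) else 0 := by
  simp [halfLineExp]

/-- `C^+ - C^- = 1`. -/
theorem cauchyProj_sub_cauchyProj :
    cauchyProj E (Or.inl rfl : (1 : ℝ) = 1 ∨ (1 : ℝ) = -1) -
      cauchyProj E (Or.inr rfl : (-1 : ℝ) = 1 ∨ (-1 : ℝ) = -1) = 1 := by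
  ext1 f
  have h : halfLineExpOp (z := 0) (Or.inl rfl : (1 : ℝ) = 1 ∨ (1 : ℝ) = -1) (by simp) (𝓕 f) -
      halfLineExpOp (z := 0) (Or.inr rfl : (-1 : ℝ) = 1 ∨ (-1 : ℝ) = -1) (by simp) (𝓕 f) = 𝓕 f := by
    refine Lp.ext ?_
    filter_upwards [coeFn_halfLineExpOp (z := 0) (Or.inl rfl : (1 : ℝ) = 1 ∨ (1 : ℝ) = -1)
      (by simp) (𝓕 f), coeFn_halfLineExpOp (z := 0) (Or.inr rfl : (-1 : ℝ) = 1 ∨ (-1 : ℝ) = -1)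
      (by simp) (𝓕 f), Lp.coeFn_sub
      (halfLineExpOp (z := 0) (Or.inl rfl : (1 : ℝ) = 1 ∨ (1 : ℝ) = -1) (by simp) (𝓕 f))
      (halfLineExpOp (z := 0) (Or.inr rfl : (-1 : ℝ) = 1 ∨ (-1 : ℝ) = -1) (by simp) (𝓕 f)),
      Measure.ae_ne volume (0 : ℝ)] with ξ h1 h2 h3 h4
    rw [h3, Pi.sub_apply, h1, h2, ← sub_smul, halfLineExp_zero, halfLineExp_zero]
    rcases lt_or_gt_of_ne h4 with h5 | h5
    · rw [if_neg (by linarith), if_pos (by linarith)]; simp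
    · rw [if_pos (by linarith), if_neg (by linarith)]; simp
  rw [sub_apply, cauchyProj_apply, cauchyProj_apply]
  have h2 := congrArg (fun u => (Lp.fourierTransformₗᵢ ℝ E).symm u) h
  simp only [map_sub] at h2
  exact h2.trans ((Lp.fourierTransformₗᵢ ℝ E).symm_apply_apply f)

/-- `C^+` is idempotent. -/
theorem cauchyProj_comp_self (hθ : (1 : ℝ) = 1 ∨ (1 : ℝ) = -1) :
    cauchyProj E hθ * cauchyProj E hθ = cauchyProj E hθ := by
  ext1 f
  rw [mul_apply_eq_comp, cauchyProj_apply hθ (cauchyProj E hθ f), cauchyProj_apply,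
    FourierTransform.fourier_fourierInv_eq]
  congr 1
  refine Lp.ext ?_
  filter_upwards [coeFn_halfLineExpOp (z := 0) hθ (by simp) (𝓕 f),
    coeFn_halfLineExpOp (z := 0) hθ (by simp)
      (halfLineExpOp (z := 0) hθ (by simp) (𝓕 f))] with ξ h1 h2
  rw [h2, h1, halfLineExp_zero, smul_smul]
  split_ifs <;> simp

/-- `C^+` is symmetric. -/
theorem inner_cauchyProj_left (hθ : (1 : ℝ) = 1 ∨ (1 : ℝ) = -1)
    (f g : Lp E 2 (volume : Measure ℝ)) :
    inner ℂ (cauchyProj E hθ f) g = inner ℂ f (cauchyProj E hθ g) := by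
  have h1 := Lp.inner_fourier_eq (cauchyProj E hθ f) g
  have h2 := Lp.inner_fourier_eq f (cauchyProj E hθ g)
  rw [← h1, ← h2, cauchyProj_apply, cauchyProj_apply, FourierTransform.fourier_fourierInv_eq,
    FourierTransform.fourier_fourierInv_eq, L2.inner_def, L2.inner_def]
  refine integral_congr_ae ?_
  filter_upwards [coeFn_halfLineExpOp (z := 0) hθ (by simp) (𝓕 f),
    coeFn_halfLineExpOp (z := 0) hθ (by simp) (𝓕 g)] with ξ h1 h2
  rw [h1, h2, halfLineExp_zero]
  split_ifs <;> simp

end CauchyProj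

end FourierAnalysis

/-! ### Square moduli of continuity -/

section Translation

variable {E : Type*} [NormedAddCommGroup E]

theorem eLpNorm_two_sq_eq_lintegral (f : ℝ → E) :
    eLpNorm f 2 volume ^ 2 = ∫⁻ s, ‖f s‖ₑ ^ 2 := by
  rw [eLpNorm_eq_lintegral_rpow_enorm_toReal two_ne_zero ENNReal.ofNat_ne_top,
    ENNReal.toReal_ofNat, ← ENNReal.rpow_natCast, ← ENNReal.rpow_mul]
  norm_num

theorem eLpNorm_two_le_iff (f : ℝ → E) (c : ℝ≥0∞) :
    eLpNorm f 2 volume ≤ c ↔ ∫⁻ s, ‖f s‖ₑ ^ 2 ≤ c ^ 2 := by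
  rw [← eLpNorm_two_sq_eq_lintegral]
  exact (ENNReal.pow_le_pow_left_iff two_ne_zero).symm

theorem lintegral_enorm_mul_enorm_le {F : Type*} [NormedAddCommGroup F] {f : ℝ → E} {g : ℝ → F}
    (hf : AEStronglyMeasurable f volume) (hg : AEStronglyMeasurable g volume) :
    ∫⁻ s, ‖f s‖ₑ * ‖g s‖ₑ ≤ eLpNorm f 2 volume * eLpNorm g 2 volume := by
  have h := ENNReal.lintegral_mul_le_Lp_mul_Lq (volume : Measure ℝ)
    (Real.HolderConjugate.two_two) hf.enorm hg.enorm
  rw [eLpNorm_eq_lintegral_rpow_enorm_toReal two_ne_zero ENNReal.ofNat_ne_top,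
    eLpNorm_eq_lintegral_rpow_enorm_toReal two_ne_zero ENNReal.ofNat_ne_top, ENNReal.toReal_ofNat]
  exact h

theorem eLpNorm_translate {f : ℝ → E} (hf : AEStronglyMeasurable f volume) (h : ℝ) (p : ℝ≥0∞) :
    eLpNorm (fun s => f (s + h)) p volume = eLpNorm f p volume :=
  eLpNorm_comp_measurePreserving hf (measurePreserving_add_right volume h)

theorem aestronglyMeasurable_translate {f : ℝ → E} (hf : AEStronglyMeasurable f volume) (h : ℝ) :
    AEStronglyMeasurable (fun s => f (s + h)) volume :=
  hf.comp_measurePreserving (measurePreserving_add_right volume h)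

theorem lintegral_Ici_translate (f : ℝ → ℝ≥0∞) (t h : ℝ) :
    ∫⁻ s in Set.Ici t, f (s + h) = ∫⁻ s in Set.Ici (t + h), f s := by
  have := (measurePreserving_add_right volume h).setLIntegral_comp_preimage_emb
    (measurableEmbedding_addRight h) f (Set.Ici (t + h))
  rw [← this]
  congr 2
  ext s; simp

/-- The mass of `|f|²` on an interval of length `h` is controlled by the difference of `f` and
its translate by `h`: it is the difference of the masses of `f` and of its translate on a
half-line. -/
theorem lintegral_Ico_enorm_sq_le {f : ℝ → E} (hf : MemLp f 2 volume) {h : ℝ} (hh : 0 ≤ h) (t : ℝ) :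
    ∫⁻ s in Set.Ico t (t + h), ‖f s‖ₑ ^ 2 ≤
      2 * eLpNorm f 2 volume * eLpNorm (fun s => f (s + h) - f s) 2 volume := by
  have hm := hf.1
  have hmt := aestronglyMeasurable_translate hm h
  have hmd : AEStronglyMeasurable (fun s => f (s + h) - f s) volume := hmt.sub hm
  have hfin : ∫⁻ s in Set.Ici (t + h), ‖f s‖ₑ ^ 2 ≠ ∞ := by
    refine ne_top_of_le_ne_top ?_ (setLIntegral_le_lintegral _ _)
    rw [← eLpNorm_two_sq_eq_lintegral]
    exact ENNReal.pow_ne_top hf.2.ne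
  have hsplit : ∫⁻ s in Set.Ici t, ‖f s‖ₑ ^ 2 =
      (∫⁻ s in Set.Ico t (t + h), ‖f s‖ₑ ^ 2) + ∫⁻ s in Set.Ici (t + h), ‖f s‖ₑ ^ 2 := by
    rw [← Set.Ico_union_Ici_eq_Ici (by linarith : t ≤ t + h)]
    refine lintegral_union measurableSet_Ici ?_
    rw [Set.disjoint_left]
    intro s hs hs'
    exact absurd hs.2 (not_lt.2 hs')
  have hpt : ∀ s, ‖f s‖ₑ ^ 2 ≤ ‖f (s + h)‖ₑ ^ 2 +
      (‖f (s + h) - f s‖ₑ * ‖f s‖ₑ + ‖f (s + h) - f s‖ₑ * ‖f (s + h)‖ₑ) := fun s => by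
    have h1 : ‖f s‖ₑ ≤ ‖f (s + h)‖ₑ + ‖f (s + h) - f s‖ₑ := by
      have := enorm_sub_le (a := f (s + h)) (b := f (s + h) - f s)
      rwa [sub_sub_cancel] at this
    calc ‖f s‖ₑ ^ 2 ≤ ‖f s‖ₑ * (‖f (s + h)‖ₑ + ‖f (s + h) - f s‖ₑ) := by
          rw [sq]; gcongr
      _ = ‖f s‖ₑ * ‖f (s + h)‖ₑ + ‖f (s + h) - f s‖ₑ * ‖f s‖ₑ := by ring
      _ ≤ (‖f (s + h)‖ₑ + ‖f (s + h) - f s‖ₑ) * ‖f (s + h)‖ₑ + ‖f (s + h) - f s‖ₑ * ‖f s‖ₑ := by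
          gcongr
      _ = _ := by ring
  have hle : ∫⁻ s in Set.Ici t, ‖f s‖ₑ ^ 2 ≤ (∫⁻ s in Set.Ici (t + h), ‖f s‖ₑ ^ 2) +
      2 * eLpNorm f 2 volume * eLpNorm (fun s => f (s + h) - f s) 2 volume := by
    refine (lintegral_mono hpt).trans ?_
    rw [lintegral_add_left' (hmt.enorm.pow_const 2).restrict,
      lintegral_Ici_translate (fun s => ‖f s‖ₑ ^ 2)]
    gcongr
    refine (setLIntegral_le_lintegral _ _).trans ?_
    rw [lintegral_add_left' (by exact hmd.enorm.mul hm.enorm)]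
    have h1 := lintegral_enorm_mul_enorm_le hmd hm
    have h2 := lintegral_enorm_mul_enorm_le hmd hmt
    rw [eLpNorm_translate hm] at h2
    refine (add_le_add h1 h2).trans (le_of_eq ?_)
    ring
  rw [hsplit, add_comm] at hle
  exact (ENNReal.add_le_add_iff_left hfin).1 hle

/-- A quantitative form of having a derivative in `L²`: `|w(s + h) - w(s)|² ≤ h ∫_s^{s+h} κ` for
`0 < h ≤ 1`, with an integrable weight `κ`, which for `w ∈ H¹` may be taken to be `|w'|²`. -/
def HasSqModulus (κ : ℝ → ℝ≥0∞) (w : ℝ → E) : Prop :=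
  ∀ s h : ℝ, 0 < h → h ≤ 1 →
    ‖w (s + h) - w s‖ₑ ^ 2 ≤ ENNReal.ofReal h * ∫⁻ t in Set.Ioc s (s + h), κ t

/-- Tonelli's theorem on the strip `s < t ≤ s + h`. -/
theorem lintegral_mul_lintegral_Ioc {κ g : ℝ → ℝ≥0∞} (hκ : AEMeasurable κ volume)
    (hg : AEMeasurable g volume) (h : ℝ) :
    ∫⁻ s, g (s + h) * ∫⁻ t in Set.Ioc s (s + h), κ t =
      ∫⁻ t, κ t * ∫⁻ s in Set.Ico t (t + h), g s := by
  have hgt : AEMeasurable (fun s => g (s + h)) volume :=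
    hg.comp_quasiMeasurePreserving (measurePreserving_add_right volume h).quasiMeasurePreserving
  have hS : MeasurableSet {p : ℝ × ℝ | p.1 < p.2 ∧ p.2 ≤ p.1 + h} :=
    (measurableSet_lt measurable_fst measurable_snd).inter
      (measurableSet_le measurable_snd (measurable_fst.add_const h))
  have hmeas : AEMeasurable (Function.uncurry fun s t : ℝ =>
      {p : ℝ × ℝ | p.1 < p.2 ∧ p.2 ≤ p.1 + h}.indicator (fun p => g (p.1 + h) * κ p.2) (s, t))
      (volume.prod volume) := by
    refine AEMeasurable.indicator ?_ hS
    exact hgt.comp_fst.mul hκ.comp_snd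
  calc ∫⁻ s, g (s + h) * ∫⁻ t in Set.Ioc s (s + h), κ t
      = ∫⁻ s, ∫⁻ t, {p : ℝ × ℝ | p.1 < p.2 ∧ p.2 ≤ p.1 + h}.indicator
          (fun p => g (p.1 + h) * κ p.2) (s, t) := by
        refine lintegral_congr fun s => ?_
        rw [← lintegral_const_mul'' _ hκ.restrict, ← lintegral_indicator measurableSet_Ioc]
        refine lintegral_congr fun t => ?_
        simp [Set.indicator]
    _ = ∫⁻ t, ∫⁻ s, {p : ℝ × ℝ | p.1 < p.2 ∧ p.2 ≤ p.1 + h}.indicator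
          (fun p => g (p.1 + h) * κ p.2) (s, t) := lintegral_lintegral_swap hmeas
    _ = ∫⁻ t, κ t * ∫⁻ s in Set.Ico t (t + h), g s := by
        refine lintegral_congr fun t => ?_
        rw [← lintegral_const_mul'' _ hg.restrict, ← lintegral_indicator measurableSet_Ico,
          ← lintegral_add_right_eq_self ((Set.Ico t (t + h)).indicator fun s => κ t * g s) h]
        refine lintegral_congr fun s => ?_
        simp only [Set.indicator, Set.mem_Ico, Set.mem_ofPred_eq]
        have : (s < t ∧ t ≤ s + h) ↔ (t ≤ s + h ∧ s + h < t + h) := by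
          constructor <;> rintro ⟨h1, h2⟩ <;> constructor <;> linarith
        simp only [this, mul_comm]

theorem HasSqModulus.eLpNorm_sub_sq_le {κ : ℝ → ℝ≥0∞} {w : ℝ → E} (hw : HasSqModulus κ w)
    (hκ : AEMeasurable κ volume) {h : ℝ} (h0 : 0 < h) (h1 : h ≤ 1) :
    eLpNorm (fun s => w (s + h) - w s) 2 volume ^ 2 ≤ ENNReal.ofReal h ^ 2 * ∫⁻ t, κ t := by
  rw [eLpNorm_two_sq_eq_lintegral]
  refine (lintegral_mono fun s => hw s h h0 h1).trans ?_
  rw [lintegral_const_mul' _ _ ENNReal.ofReal_ne_top]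
  have h2 := lintegral_mul_lintegral_Ioc hκ (aemeasurable_const (b := (1 : ℝ≥0∞))) h
  simp only [one_mul, lintegral_const, Measure.restrict_apply_univ, Real.volume_Ico,
    add_sub_cancel_left] at h2
  rw [h2, lintegral_mul_const' _ _ ENNReal.ofReal_ne_top]
  exact le_of_eq (by ring)

theorem HasSqModulus.L2Lipschitz {κ : ℝ → ℝ≥0∞} {w : ℝ → E} (hw : HasSqModulus κ w)
    (hκ : AEMeasurable κ volume) (hfin : ∫⁻ t, κ t ≠ ∞) : L2Lipschitz w := by
  refine ⟨√(∫⁻ t, κ t).toReal, fun h h0 h1 => ?_⟩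
  rw [← ENNReal.pow_le_pow_left_iff two_ne_zero]
  refine (hw.eLpNorm_sub_sq_le hκ h0 h1).trans (le_of_eq ?_)
  rw [← ENNReal.ofReal_pow h0.le, ← ENNReal.ofReal_pow (by positivity), mul_pow,
    Real.sq_sqrt ENNReal.toReal_nonneg, ENNReal.ofReal_mul ENNReal.toReal_nonneg,
    ENNReal.ofReal_toReal hfin, mul_comm]

/-- The product of `f` with a difference of `w`, for `f` in `L²` only. For bounded `f` its squared
`L²` norm would be `O(h²)`. Here one factor `h` is replaced by the norm of `f(· + h) - f`, which can
be absorbed when `f` solves an equation that bounds its differences by such products. -/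
theorem HasSqModulus.lintegral_enorm_sq_mul_le {F : Type*} [NormedAddCommGroup F] {κ : ℝ → ℝ≥0∞}
    {w : ℝ → E} (hw : HasSqModulus κ w) (hκ : AEMeasurable κ volume) {f : ℝ → F}
    (hf : MemLp f 2 volume) {h : ℝ} (h0 : 0 < h) (h1 : h ≤ 1) :
    ∫⁻ s, (‖f (s + h)‖ₑ * ‖w (s + h) - w s‖ₑ) ^ 2 ≤ ENNReal.ofReal h * ((∫⁻ t, κ t) *
      (2 * eLpNorm f 2 volume * eLpNorm (fun s => f (s + h) - f s) 2 volume)) := by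
  calc ∫⁻ s, (‖f (s + h)‖ₑ * ‖w (s + h) - w s‖ₑ) ^ 2
      ≤ ∫⁻ s, ENNReal.ofReal h * (‖f (s + h)‖ₑ ^ 2 * ∫⁻ t in Set.Ioc s (s + h), κ t) := by
        refine lintegral_mono fun s => ?_
        rw [mul_pow]
        refine (mul_le_mul_right (hw s h h0 h1) _).trans (le_of_eq (by ring))
    _ = ENNReal.ofReal h * ∫⁻ t, κ t * ∫⁻ s in Set.Ico t (t + h), ‖f s‖ₑ ^ 2 := by
        rw [lintegral_const_mul' _ _ ENNReal.ofReal_ne_top,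
          ← lintegral_mul_lintegral_Ioc hκ (hf.1.enorm.pow_const 2) h]
    _ ≤ _ := by
        gcongr
        refine (lintegral_mono fun t => ?_).trans_eq (lintegral_mul_const'' _ hκ)
        beta_reduce
        gcongr
        exact lintegral_Ico_enorm_sq_le hf h0.le t

end Translation

/-! ### Regular coefficients -/

section Regular

variable {E F : Type*} [NormedAddCommGroup E] [NormedAddCommGroup F]

theorem enorm_add_sq_le (a b : E) : ‖a + b‖ₑ ^ 2 ≤ 2 * ‖a‖ₑ ^ 2 + 2 * ‖b‖ₑ ^ 2 := by
  rw [← ofReal_norm, ← ofReal_norm, ← ofReal_norm, ← ENNReal.ofReal_pow (norm_nonneg _),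
    ← ENNReal.ofReal_pow (norm_nonneg _), ← ENNReal.ofReal_pow (norm_nonneg _),
    ← ENNReal.ofReal_ofNat, ← ENNReal.ofReal_mul zero_le_two, ← ENNReal.ofReal_mul zero_le_two,
    ← ENNReal.ofReal_add (by positivity) (by positivity)]
  refine ENNReal.ofReal_le_ofReal ?_
  have h := norm_add_le a b
  have h0 := norm_nonneg (a + b)
  nlinarith [sq_nonneg (‖a‖ - ‖b‖)]

/-- The properties of the coefficients of the jump matrix that the argument uses: continuity,
integrability and square integrability, and the quantitative `H¹` property `HasSqModulus`. -/
structure IsRegularCoeff (w : ℝ → E) : Prop where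
  continuous : Continuous w
  memLp : MemLp w 2 volume
  integrable : Integrable w
  modulus : ∃ κ : ℝ → ℝ≥0∞, AEMeasurable κ volume ∧ ∫⁻ t, κ t ≠ ∞ ∧ HasSqModulus κ w

theorem IsRegularCoeff.add {v w : ℝ → E} (hv : IsRegularCoeff v) (hw : IsRegularCoeff w) :
    IsRegularCoeff fun t => v t + w t := by
  obtain ⟨κ, hκ, hκ', h⟩ := hv.modulus
  obtain ⟨κ₂, hκ₂, hκ₂', h₂⟩ := hw.modulus
  refine ⟨hv.continuous.add hw.continuous, hv.memLp.add hw.memLp, hv.integrable.add hw.integrable,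
    fun t => 2 * κ t + 2 * κ₂ t, (hκ.const_mul _).add (hκ₂.const_mul _), ?_, fun s a h0 h1 => ?_⟩
  · rw [lintegral_add_left' (hκ.const_mul _), lintegral_const_mul'' _ hκ,
      lintegral_const_mul'' _ hκ₂]
    finiteness
  · rw [lintegral_add_left' (hκ.const_mul _).restrict, lintegral_const_mul'' _ hκ.restrict,
      lintegral_const_mul'' _ hκ₂.restrict]
    have e : v (s + a) + w (s + a) - (v s + w s) = (v (s + a) - v s) + (w (s + a) - w s) := by abel
    rw [e]
    refine (enorm_add_sq_le _ _).trans ?_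
    refine (add_le_add (mul_le_mul_right (h s a h0 h1) _)
      (mul_le_mul_right (h₂ s a h0 h1) _)).trans (le_of_eq (by ring))

theorem IsRegularCoeff.clm_comp [NormedSpace ℝ E] [NormedSpace ℝ F] {w : ℝ → E}
    (hw : IsRegularCoeff w) (L : E →L[ℝ] F) : IsRegularCoeff fun t => L (w t) := by
  obtain ⟨κ, hκ, hκ', h⟩ := hw.modulus
  refine ⟨L.continuous.comp hw.continuous, L.comp_memLp' hw.memLp, L.integrable_comp hw.integrable,
    fun t => ‖L‖ₑ ^ 2 * κ t, hκ.const_mul _, ?_, fun s a h0 h1 => ?_⟩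
  · rw [lintegral_const_mul'' _ hκ]
    finiteness
  · rw [lintegral_const_mul'' _ hκ.restrict, ← map_sub]
    calc ‖L (w (s + a) - w s)‖ₑ ^ 2 ≤ (‖L‖ₑ * ‖w (s + a) - w s‖ₑ) ^ 2 := by
          gcongr
          exact L.le_opENorm _
      _ = ‖L‖ₑ ^ 2 * ‖w (s + a) - w s‖ₑ ^ 2 := by ring
      _ ≤ ‖L‖ₑ ^ 2 * (ENNReal.ofReal a * ∫⁻ t in Set.Ioc s (s + a), κ t) := by
          gcongr
          exact h s a h0 h1
      _ = _ := by ring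

theorem IsRegularCoeff.L2Lipschitz {w : ℝ → E} (hw : IsRegularCoeff w) : L2Lipschitz w := by
  obtain ⟨κ, hκ, hκ', h⟩ := hw.modulus
  exact h.L2Lipschitz hκ hκ'

theorem IsRegularCoeff.tendsto_cocompact {w : ℝ → ℂ} (hw : IsRegularCoeff w) :
    Tendsto w (cocompact ℝ) (𝓝 0) :=
  tendsto_cocompact_of_L2Lipschitz hw.continuous hw.integrable hw.memLp hw.L2Lipschitz

/-- Multiplication by a character preserves regularity. -/
theorem IsRegularCoeff.exp_mul {w : ℝ → ℂ} (hw : IsRegularCoeff w) (x : ℝ) :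
    IsRegularCoeff fun t => Complex.exp ((2 * x * t : ℝ) * I) * w t := by
  obtain ⟨κ, hκ, hκ', h⟩ := hw.modulus
  have hn : ∀ t : ℝ, ‖Complex.exp ((2 * x * t : ℝ) * I)‖ = 1 := fun t =>
    Complex.norm_exp_ofReal_mul_I _
  have hc : Continuous fun t : ℝ => Complex.exp ((2 * x * t : ℝ) * I) * w t :=
    (by fun_prop : Continuous fun t : ℝ => Complex.exp ((2 * x * t : ℝ) * I)).mul hw.continuous
  have hnorm : ∀ t : ℝ, ‖Complex.exp ((2 * x * t : ℝ) * I) * w t‖ = ‖w t‖ := fun t => by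
    rw [norm_mul, hn, one_mul]
  have hw2 : AEMeasurable (fun t => ‖w t‖ₑ ^ 2) volume :=
    hw.continuous.aestronglyMeasurable.enorm.pow_const 2
  have hsum : AEMeasurable (fun t => κ t + ‖w t‖ₑ ^ 2) volume := hκ.add hw2
  refine ⟨hc, hw.memLp.mono hc.aestronglyMeasurable (.of_forall fun t => (hnorm t).le),
    hw.integrable.mono hc.aestronglyMeasurable (.of_forall fun t => (hnorm t).le),
    fun t => (2 + ENNReal.ofReal (16 * x ^ 2)) * (κ t + ‖w t‖ₑ ^ 2),
    hsum.const_mul _, ?_, fun s a h0 h1 => ?_⟩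
  · beta_reduce
    rw [lintegral_const_mul'' _ hsum, lintegral_add_left' hκ,
      ← eLpNorm_two_sq_eq_lintegral]
    have := hw.memLp.2.ne
    finiteness
  · set K := ∫⁻ t in Set.Ioc s (s + a), κ t with hK
    set R := ∫⁻ t in Set.Ioc s (s + a), ‖w t‖ₑ ^ 2 with hR
    -- `|w(s)|²` is compared with the mean of `|w|²` over the interval
    have h2 : ENNReal.ofReal a * ‖w s‖ₑ ^ 2 ≤ 2 * R + 2 * K := by
      have hpt : ∀ t ∈ Set.Ioc s (s + a), ‖w s‖ₑ ^ 2 ≤ 2 * ‖w t‖ₑ ^ 2 + 2 * K := fun t ht => by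
        have e : w s = w t + -(w t - w s) := by abel
        have h3 := h s (t - s) (by linarith [ht.1]) (by linarith [ht.2])
        rw [add_sub_cancel] at h3
        have h4 : ‖w t - w s‖ₑ ^ 2 ≤ K := by
          refine h3.trans ?_
          refine (mul_le_of_le_one_left (by positivity) ?_).trans
            (lintegral_mono_set (Set.Ioc_subset_Ioc_right ht.2))
          exact ENNReal.ofReal_le_one.2 (by linarith [ht.2])
        calc ‖w s‖ₑ ^ 2 = ‖w t + -(w t - w s)‖ₑ ^ 2 := by rw [← e]
          _ ≤ 2 * ‖w t‖ₑ ^ 2 + 2 * ‖-(w t - w s)‖ₑ ^ 2 := enorm_add_sq_le _ _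
          _ ≤ _ := by rw [enorm_neg]; gcongr
      have h5 := setLIntegral_mono' (μ := volume) measurableSet_Ioc hpt
      rw [setLIntegral_const, Real.volume_Ioc, add_sub_cancel_left,
        lintegral_add_left' (hw2.const_mul _).restrict, lintegral_const_mul'' _ hw2.restrict,
        setLIntegral_const, Real.volume_Ioc, add_sub_cancel_left] at h5
      calc ENNReal.ofReal a * ‖w s‖ₑ ^ 2 = ‖w s‖ₑ ^ 2 * ENNReal.ofReal a := mul_comm _ _
        _ ≤ 2 * R + 2 * K * ENNReal.ofReal a := h5
        _ ≤ 2 * R + 2 * K := add_le_add le_rfl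
          (mul_le_of_le_one_right (by positivity) (ENNReal.ofReal_le_one.2 h1))
    have e : Complex.exp ((2 * x * (s + a) : ℝ) * I) * w (s + a) -
        Complex.exp ((2 * x * s : ℝ) * I) * w s =
        Complex.exp ((2 * x * (s + a) : ℝ) * I) * (w (s + a) - w s) +
        Complex.exp ((2 * x * s : ℝ) * I) * (Complex.exp (I * (2 * x * a : ℝ)) - 1) * w s := by
      have : Complex.exp ((2 * x * (s + a) : ℝ) * I) =
          Complex.exp ((2 * x * s : ℝ) * I) * Complex.exp (I * (2 * x * a : ℝ)) := by
        rw [← Complex.exp_add]; congr 1; push_cast; ring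
      rw [this]; ring
    have h6 : ‖Complex.exp ((2 * x * s : ℝ) * I) * (Complex.exp (I * (2 * x * a : ℝ)) - 1) * w s‖ₑ
        ^ 2 ≤ ENNReal.ofReal (4 * x ^ 2) * ENNReal.ofReal a * (ENNReal.ofReal a * ‖w s‖ₑ ^ 2) := by
      rw [← ofReal_norm, ← ofReal_norm, ← ENNReal.ofReal_pow (norm_nonneg _),
        ← ENNReal.ofReal_pow (norm_nonneg _), ← ENNReal.ofReal_mul h0.le,
        ← ENNReal.ofReal_mul (by positivity), ← ENNReal.ofReal_mul (by positivity)]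
      refine ENNReal.ofReal_le_ofReal ?_
      rw [norm_mul, norm_mul, hn, one_mul, mul_pow]
      have h7 := Real.norm_exp_I_mul_ofReal_sub_one_le (x := 2 * x * a)
      rw [Real.norm_eq_abs] at h7
      have h8 : ‖Complex.exp (I * (2 * x * a : ℝ)) - 1‖ ^ 2 ≤ (2 * x * a) ^ 2 := by
        rw [← sq_abs (2 * x * a)]
        exact pow_le_pow_left₀ (norm_nonneg _) h7 2
      calc _ ≤ (2 * x * a) ^ 2 * ‖w s‖ ^ 2 := by gcongr
        _ = _ := by ring
    beta_reduce
    rw [lintegral_const_mul'' _ hsum.restrict, lintegral_add_left' hκ.restrict, ← hK, ← hR,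
      e]
    refine (enorm_add_sq_le _ _).trans ?_
    have h9 : ‖Complex.exp ((2 * x * (s + a) : ℝ) * I) * (w (s + a) - w s)‖ₑ ^ 2 ≤
        ENNReal.ofReal a * K := by
      have : ‖Complex.exp ((2 * x * (s + a) : ℝ) * I) * (w (s + a) - w s)‖ₑ =
          ‖w (s + a) - w s‖ₑ := by
        rw [← ofReal_norm, norm_mul, hn, one_mul, ofReal_norm]
      rw [this]
      exact h s a h0 h1
    have h10 : ENNReal.ofReal (16 * x ^ 2) = 4 * ENNReal.ofReal (4 * x ^ 2) := by
      rw [← ENNReal.ofReal_ofNat 4, ← ENNReal.ofReal_mul (by norm_num)]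
      congr 1; ring
    calc _ ≤ 2 * (ENNReal.ofReal a * K) +
          2 * (ENNReal.ofReal (4 * x ^ 2) * ENNReal.ofReal a * (2 * R + 2 * K)) := by
          refine add_le_add (mul_le_mul_right h9 _) (mul_le_mul_right (h6.trans ?_) _)
          exact mul_le_mul_right h2 _
      _ = ENNReal.ofReal a * ((2 + 4 * ENNReal.ofReal (4 * x ^ 2)) * K +
          4 * ENNReal.ofReal (4 * x ^ 2) * R) := by ring
      _ ≤ ENNReal.ofReal a * ((2 + 4 * ENNReal.ofReal (4 * x ^ 2)) * K +
          (2 + 4 * ENNReal.ofReal (4 * x ^ 2)) * R) := by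
          gcongr
          exact le_add_self
      _ = _ := by rw [h10]; ring

theorem MemH11.isRegularCoeff {f : ℝ → ℂ} (hf : MemH11 f) : IsRegularCoeff f := by
  obtain ⟨⟨g, hg, hfg⟩, hxf⟩ := hf
  have hloc : LocallyIntegrable g volume := hg.locallyIntegrable (by norm_num)
  have hint : ∀ a b, IntervalIntegrable g volume a b := fun a b =>
    (hloc.integrableOn_isCompact isCompact_uIcc).intervalIntegrable
  have hc : Continuous f := by
    have h1 : f = fun b => f 0 + ∫ t in (0 : ℝ)..b, g t := by
      ext b; rw [← hfg 0 b]; ring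
    rw [h1]
    exact continuous_const.add (intervalIntegral.continuous_primitive hint 0)
  have h2 : MemLp f 2 volume := by
    rw [memLp_two_iff_integrable_sq_norm hc.aestronglyMeasurable]
    have h3 := (memLp_two_iff_integrable_sq_norm hxf.1).1 hxf
    have h4 : Integrable ((Set.Icc (-1 : ℝ) 1).indicator fun t => ‖f t‖ ^ 2) :=
      ((hc.norm.pow 2).integrableOn_Icc).integrable_indicator measurableSet_Icc
    refine (h3.add h4).mono' (hc.norm.pow 2).aestronglyMeasurable (.of_forall fun t => ?_)
    have h5 : ‖(t : ℂ) * f t‖ ^ 2 = t ^ 2 * ‖f t‖ ^ 2 := by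
      rw [norm_mul, mul_pow, Complex.norm_real, Real.norm_eq_abs, sq_abs]
    rw [Real.norm_of_nonneg (by positivity), Pi.add_apply, h5]
    by_cases ht : t ∈ Set.Icc (-1 : ℝ) 1
    · rw [Set.indicator_of_mem ht]
      nlinarith [mul_nonneg (sq_nonneg t) (sq_nonneg ‖f t‖)]
    · rw [Set.indicator_of_notMem ht, add_zero]
      have : 1 ≤ t ^ 2 := by
        rw [Set.mem_Icc, not_and_or, not_le, not_le] at ht
        rcases ht with h | h <;> nlinarith
      nlinarith [sq_nonneg ‖f t‖]
  refine ⟨hc, h2, integrable_of_memLp_two_of_memLp_mul h2 (by simpa using hxf),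
    fun t => ‖g t‖ₑ ^ 2, hg.1.enorm.pow_const 2, ?_, fun s a h0 h1 => ?_⟩
  · rw [← eLpNorm_two_sq_eq_lintegral]
    exact ENNReal.pow_ne_top hg.2.ne
  · rw [hfg, intervalIntegral.integral_of_le (by linarith)]
    have h3 := ENNReal.lintegral_mul_le_Lp_mul_Lq (volume.restrict (Set.Ioc s (s + a)))
      Real.HolderConjugate.two_two (aemeasurable_const (b := (1 : ℝ≥0∞))) hg.1.enorm.restrict
    simp only [Pi.mul_apply, one_mul, ENNReal.one_rpow, lintegral_const,
      Measure.restrict_apply_univ, Real.volume_Ioc, add_sub_cancel_left] at h3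
    calc ‖∫ t in Set.Ioc s (s + a), g t‖ₑ ^ 2
        ≤ (∫⁻ t in Set.Ioc s (s + a), ‖g t‖ₑ) ^ 2 := by
          gcongr; exact enorm_integral_le_lintegral_enorm _
      _ ≤ _ := by
          refine (pow_le_pow_left' h3 2).trans (le_of_eq ?_)
          rw [mul_pow, ← ENNReal.rpow_natCast, ← ENNReal.rpow_natCast, ← ENNReal.rpow_mul,
            ← ENNReal.rpow_mul]
          norm_num

end Regular

/-! ### Cauchy projections of matrix-valued functions -/

/-- `ℂ^{3×3}` with the Frobenius (Hilbert space) norm. -/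
abbrev FrobSpace : Type := EuclideanSpace ℂ (Fin 3 × Fin 3)

/-- The matrices as a Hilbert space, entry by entry. -/
def frob : Mat3 ≃L[ℂ] FrobSpace :=
  ((LinearEquiv.curry ℂ ℂ (Fin 3) (Fin 3)).symm ≪≫ₗ
    (WithLp.linearEquiv 2 ℂ (Fin 3 × Fin 3 → ℂ)).symm : Mat3 ≃ₗ[ℂ] FrobSpace).toContinuousLinearEquiv

theorem frob_apply (A : Mat3) (p : Fin 3 × Fin 3) : frob A p = A p.1 p.2 := rfl

/-- `frob` on `L²`. -/
def frobLp : L2Mat ≃L[ℂ] Lp FrobSpace 2 (volume : Measure ℝ) :=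
  ContinuousLinearEquiv.equivOfInverse ((frob : Mat3 →L[ℂ] FrobSpace).compLpL 2 volume)
    ((frob.symm : FrobSpace →L[ℂ] Mat3).compLpL 2 volume)
    (fun f => by
      refine Lp.ext ?_
      filter_upwards [ContinuousLinearMap.coeFn_compLpL (frob : Mat3 →L[ℂ] FrobSpace) f,
        ContinuousLinearMap.coeFn_compLpL (frob.symm : FrobSpace →L[ℂ] Mat3)
          ((frob : Mat3 →L[ℂ] FrobSpace).compLpL 2 volume f)] with s h1 h2
      rw [h2, h1]; simp)
    (fun f => by
      refine Lp.ext ?_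
      filter_upwards [ContinuousLinearMap.coeFn_compLpL (frob.symm : FrobSpace →L[ℂ] Mat3) f,
        ContinuousLinearMap.coeFn_compLpL (frob : Mat3 →L[ℂ] FrobSpace)
          ((frob.symm : FrobSpace →L[ℂ] Mat3).compLpL 2 volume f)] with s h1 h2
      rw [h2, h1]; simp)

theorem coeFn_frobLp (f : L2Mat) : frobLp f =ᵐ[volume] fun s => frob (f s) :=
  ContinuousLinearMap.coeFn_compLpL (frob : Mat3 →L[ℂ] FrobSpace) f

theorem coeFn_frobLp_symm (f : Lp FrobSpace 2 (volume : Measure ℝ)) :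
    frobLp.symm f =ᵐ[volume] fun s => frob.symm (f s) :=
  ContinuousLinearMap.coeFn_compLpL (frob.symm : FrobSpace →L[ℂ] Mat3) f

theorem frob_cauchyIntegral (f : ℝ → Mat3) (z : ℂ) :
    frob (cauchyIntegral f z) = cauchyTransform (fun s => frob (f s)) z := by
  rw [cauchyIntegral, cauchyTransform, map_smul, ← ContinuousLinearEquiv.integral_comp_comm]
  simp only [map_smul]

/-- The Cauchy projection `C^±` on `L²(ℝ; ℂ^{3×3})`, for the sign `θ = ±1`. -/
def matCauchyProj {θ : ℝ} (hθ : θ = 1 ∨ θ = -1) : L2Mat →L[ℂ] L2Mat :=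
  (frobLp.symm : Lp FrobSpace 2 (volume : Measure ℝ) →L[ℂ] L2Mat) ∘L cauchyProj FrobSpace hθ ∘L
    (frobLp : L2Mat →L[ℂ] Lp FrobSpace 2 (volume : Measure ℝ))

theorem cauchyIntegral_congr_ae {f g : ℝ → Mat3} (h : f =ᵐ[volume] g) (z : ℂ) :
    cauchyIntegral f z = cauchyIntegral g z := by
  rw [cauchyIntegral, cauchyIntegral]
  congr 1
  refine integral_congr_ae ?_
  filter_upwards [h] with s hs
  rw [hs]

theorem IsCauchyProjection.congr_ae {θ : ℝ} {f f' g g' : ℝ → Mat3} (h : IsCauchyProjection θ f g)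
    (hf : f =ᵐ[volume] f') (hg : g =ᵐ[volume] g') : IsCauchyProjection θ f' g' := by
  refine ⟨h.1.ae_eq hg, h.2.congr fun δ => ?_⟩
  refine eLpNorm_congr_ae ?_
  filter_upwards [hg] with l hl
  rw [hl, cauchyIntegral_congr_ae hf]

theorem isCauchyProjection_matCauchyProj {θ : ℝ} (hθ : θ = 1 ∨ θ = -1) (f : L2Mat) :
    IsCauchyProjection θ f (matCauchyProj hθ f) := by
  refine ⟨Lp.memLp _, ?_⟩
  have h := tendsto_eLpNorm_cauchyTransform_sub hθ (frobLp f)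
  set K := ‖(frob.symm : FrobSpace →L[ℂ] Mat3)‖ₑ with hK
  have h2 := ENNReal.Tendsto.const_mul (a := K) h (Or.inr (by simp [hK]))
  rw [mul_zero] at h2
  refine tendsto_of_tendsto_of_tendsto_of_le_of_le tendsto_const_nhds h2 (fun _ => bot_le)
    fun δ => ?_
  have h3 : ∀ z : ℂ, cauchyIntegral f z = frob.symm (cauchyTransform (frobLp f) z) := fun z => by
    rw [ContinuousLinearEquiv.eq_symm_apply, frob_cauchyIntegral, cauchyTransform, cauchyTransform]
    congr 1
    refine integral_congr_ae ?_
    filter_upwards [coeFn_frobLp f] with s hs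
    rw [hs]
  have h4 : (fun l : ℝ => cauchyIntegral f ((l : ℂ) + (θ * δ : ℝ) * I) - matCauchyProj hθ f l)
      =ᵐ[volume] fun l : ℝ => (frob.symm : FrobSpace →L[ℂ] Mat3)
        (cauchyTransform (frobLp f) ((l : ℂ) + (θ * δ : ℝ) * I) -
          cauchyProj FrobSpace hθ (frobLp f) l) := by
    filter_upwards [coeFn_frobLp_symm (cauchyProj FrobSpace hθ (frobLp f))] with l hl
    rw [h3, map_sub]
    congr 1
  beta_reduce
  rw [eLpNorm_congr_ae h4]
  exact eLpNorm_le_mul_eLpNorm_of_ae_le_mul' (c := ‖(frob.symm : FrobSpace →L[ℂ] Mat3)‖₊)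
    (.of_forall fun l => ContinuousLinearMap.le_opENorm _ _) 2

theorem aestronglyMeasurable_cauchyIntegral_line {f : ℝ → Mat3} (hf : AEStronglyMeasurable f volume)
    (w : ℂ) : AEStronglyMeasurable (fun l : ℝ => cauchyIntegral f ((l : ℂ) + w)) volume := by
  have hk : AEStronglyMeasurable
      (fun p : ℝ × ℝ => (((p.2 : ℝ) : ℂ) - ((p.1 : ℂ) + w))⁻¹) (volume.prod volume) :=
    (by fun_prop : Measurable fun p : ℝ × ℝ =>
      (((p.2 : ℝ) : ℂ) - ((p.1 : ℂ) + w))⁻¹).aestronglyMeasurable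
  have h : AEStronglyMeasurable
      (fun p : ℝ × ℝ => (((p.2 : ℝ) : ℂ) - ((p.1 : ℂ) + w))⁻¹ • f p.2) (volume.prod volume) :=
    hk.smul hf.comp_snd
  exact h.integral_prod_right'.const_smul ((2 * (Real.pi : ℂ) * I)⁻¹)

/-- Cauchy projections are unique up to null sets. -/
theorem IsCauchyProjection.ae_eq {θ : ℝ} {f g g' : ℝ → Mat3} (hf : AEStronglyMeasurable f volume)
    (h : IsCauchyProjection θ f g) (h' : IsCauchyProjection θ f g') : g =ᵐ[volume] g' := by
  have hsum := h.2.add h'.2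
  rw [add_zero] at hsum
  have hle : eLpNorm (g - g') 2 volume ≤ 0 := by
    refine ge_of_tendsto hsum (.of_forall fun δ => ?_)
    have hm := aestronglyMeasurable_cauchyIntegral_line hf ((θ * δ : ℝ) * I)
    have e : g - g' = (fun l : ℝ => cauchyIntegral f ((l : ℂ) + (θ * δ : ℝ) * I) - g' l) -
        fun l : ℝ => cauchyIntegral f ((l : ℂ) + (θ * δ : ℝ) * I) - g l := by
      ext1 l; simp
    rw [e, add_comm]
    exact eLpNorm_sub_le (hm.sub h'.1.1) (hm.sub h.1.1) one_le_two
  have h0 := (eLpNorm_eq_zero_iff (h.1.1.sub h'.1.1) two_ne_zero).1 (le_antisymm hle bot_le)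
  filter_upwards [h0] with s hs
  exact sub_eq_zero.1 hs

theorem cauchyIntegral_translate (f : ℝ → Mat3) (h : ℝ) (z : ℂ) :
    cauchyIntegral (fun s => f (s + h)) z = cauchyIntegral f (h + z) := by
  rw [cauchyIntegral, cauchyIntegral,
    ← integral_add_right_eq_self (fun s : ℝ => ((s : ℂ) - (h + z))⁻¹ • f s) h]
  congr 2
  ext1 s
  congr 2
  push_cast; ring

theorem IsCauchyProjection.translate {θ : ℝ} {f g : ℝ → Mat3} (hf : AEStronglyMeasurable f volume)
    (h : IsCauchyProjection θ f g) (a : ℝ) :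
    IsCauchyProjection θ (fun s => f (s + a)) fun s => g (s + a) := by
  refine ⟨h.1.comp_measurePreserving (measurePreserving_add_right volume a),
    h.2.congr fun δ => ?_⟩
  have hm : AEStronglyMeasurable
      (fun l : ℝ => cauchyIntegral f ((l : ℂ) + (θ * δ : ℝ) * I) - g l) volume :=
    (aestronglyMeasurable_cauchyIntegral_line hf ((θ * δ : ℝ) * I)).sub h.1.1
  rw [← eLpNorm_translate hm a]
  congr 1
  ext1 l
  rw [cauchyIntegral_translate]
  congr 2
  push_cast; ring

/-! ### Translations and right multiplications -/

/-- Translation on `L²(ℝ; ℂ^{3×3})`. -/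
def translateLp (a : ℝ) : L2Mat →ₗᵢ[ℂ] L2Mat :=
  Lp.compMeasurePreservingₗᵢ ℂ (fun s => s + a) (measurePreserving_add_right volume a)

theorem coeFn_translateLp (a : ℝ) (f : L2Mat) : translateLp a f =ᵐ[volume] fun s => f (s + a) :=
  Lp.coeFn_compMeasurePreserving f (measurePreserving_add_right volume a)

theorem matCauchyProj_translateLp {θ : ℝ} (hθ : θ = 1 ∨ θ = -1) (a : ℝ) (f : L2Mat) :
    matCauchyProj hθ (translateLp a f) = translateLp a (matCauchyProj hθ f) := by
  have h1 := (isCauchyProjection_matCauchyProj hθ f).translate (Lp.aestronglyMeasurable f) a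
  have h2 := (isCauchyProjection_matCauchyProj hθ (translateLp a f)).congr_ae
    (coeFn_translateLp a f) (EventuallyEq.refl _ _)
  have h3 := h2.ae_eq (aestronglyMeasurable_translate (Lp.aestronglyMeasurable f) a) h1
  exact Lp.ext (h3.trans (coeFn_translateLp a _).symm)

/-- Right multiplication by a bounded continuous matrix-valued function on `L²(ℝ; ℂ^{3×3})`. -/
def mulRightOp (W : ℝ → Mat3) (C : ℝ) (hW : Continuous W) (hC : ∀ s, ‖W s‖ ≤ C) :
    L2Mat →L[ℂ] L2Mat :=
  pointwiseOp (fun s => (ContinuousLinearMap.mul ℂ Mat3).flip (W s)) C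
    ((ContinuousLinearMap.continuous _).comp hW).aestronglyMeasurable fun s =>
      ContinuousLinearMap.opNorm_le_bound _ ((norm_nonneg _).trans (hC s)) fun A => by
        rw [ContinuousLinearMap.flip_apply, ContinuousLinearMap.mul_apply', mul_comm C]
        exact (norm_mul_le _ _).trans (mul_le_mul_of_nonneg_left (hC s) (norm_nonneg _))

theorem coeFn_mulRightOp {W : ℝ → Mat3} {C : ℝ} {hW : Continuous W} {hC : ∀ s, ‖W s‖ ≤ C}
    (f : L2Mat) : mulRightOp W C hW hC f =ᵐ[volume] fun s => f s * W s :=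
  coeFn_pointwiseOp f

/-! ### Invertibility from coercivity -/

/-- A perturbation of a complementary projection by a multiplication with positive real part is
invertible on a Hilbert space. -/
theorem isUnit_proj_add_of_coercive {H : Type*} [NormedAddCommGroup H] [InnerProductSpace ℂ H]
    [CompleteSpace H] (P A : H →L[ℂ] H) (hP : P * P = P)
    (hPs : ∀ u v, inner ℂ (P u) v = inner ℂ u (P v)) {c : ℝ} (hc : 0 < c)
    (hA : ∀ u, c * ‖u‖ ^ 2 ≤ (inner ℂ (A u) u).re) : IsUnit (P + (1 - P) * A) := by
  set Q := 1 - P with hQ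
  have hPQ : P * Q = 0 := by rw [hQ, mul_sub, mul_one, hP, sub_self]
  have hQs : ∀ u v, inner ℂ (Q u) v = inner ℂ u (Q v) := fun u v => by
    simp [hQ, hPs]
  have hQQ : Q * Q = Q := by rw [hQ, mul_sub, sub_mul, sub_mul, hP]; simp
  -- the diagonal part is coercive
  have hB : IsUnit (P + Q * A * Q) := by
    have hc' : 0 < min 1 c := lt_min one_pos hc
    refine ContinuousLinearMap.isUnit_of_forall_le_norm_inner_map _ (c := ⟨min 1 c, hc'.le⟩) hc'
      fun u => ?_
    have e1 : inner ℂ ((P + Q * A * Q) u) u = inner ℂ (P u) (P u) + inner ℂ (A (Q u)) (Q u) := by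
      have : P u = P (P u) := by
        have := congrArg (fun T : H →L[ℂ] H => T u) hP
        exact this.symm
      rw [add_apply, inner_add_left, this, hPs, ← this]
      congr 1
      exact hQs _ _
    have e2 : ‖u‖ ^ 2 = ‖P u‖ ^ 2 + ‖Q u‖ ^ 2 := by
      have e3 : u = P u + Q u := by simp [hQ]
      have e4 : inner ℂ (P u) (Q u) = 0 := by
        rw [hPs]
        have := congrArg (fun T : H →L[ℂ] H => T u) hPQ
        have h5 : P (Q u) = 0 := this
        rw [h5, inner_zero_right]
      have := norm_add_sq_eq_norm_sq_add_norm_sq_of_inner_eq_zero (𝕜 := ℂ) (P u) (Q u) e4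
      rw [← e3] at this
      simpa [sq] using this
    refine le_trans ?_ (Complex.re_le_norm _)
    rw [e1, Complex.add_re, e2]
    have h1 : (inner ℂ (P u) (P u)).re = ‖P u‖ ^ 2 := by
      rw [inner_self_eq_norm_sq_to_K]; norm_cast
    rw [h1]
    change (‖P u‖ ^ 2 + ‖Q u‖ ^ 2) * min 1 c ≤ _
    have h2 := hA (Q u)
    have h3 : min 1 c ≤ 1 := min_le_left _ _
    have h4 : min 1 c ≤ c := min_le_right _ _
    nlinarith [sq_nonneg ‖P u‖, sq_nonneg ‖Q u‖]
  -- the off-diagonal part is a nilpotent perturbation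
  have hN : IsUnit (1 + Q * A * P) := by
    have h0 : (Q * A * P) * (Q * A * P) = 0 := by
      calc (Q * A * P) * (Q * A * P) = Q * A * (P * Q) * A * P := by noncomm_ring
        _ = 0 := by rw [hPQ]; simp
    refine ⟨⟨1 + Q * A * P, 1 - Q * A * P, ?_, ?_⟩, rfl⟩
    · calc (1 + Q * A * P) * (1 - Q * A * P) = 1 - (Q * A * P) * (Q * A * P) := by noncomm_ring
        _ = 1 := by rw [h0, sub_zero]
    · calc (1 - Q * A * P) * (1 + Q * A * P) = 1 - (Q * A * P) * (Q * A * P) := by noncomm_ring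
        _ = 1 := by rw [h0, sub_zero]
  have : P + Q * A = (1 + Q * A * P) * (P + Q * A * Q) := by
    have e : P + Q = 1 := by simp [hQ]
    calc P + Q * A = P + Q * A * (P + Q) := by rw [e, mul_one]
      _ = P + Q * A * Q + Q * A * P := by noncomm_ring
      _ = P + Q * A * Q + (Q * A * (P * P) + Q * A * (P * Q) * A * Q) := by
        rw [hPQ, hP]; simp
      _ = _ := by noncomm_ring
  rw [this]
  exact hN.mul hB

/-! ### Holomorphic functions without a jump across the real line -/

section RemovableLine

variable {F : Type*} [NormedAddCommGroup F] [NormedSpace ℂ F] [CompleteSpace F]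

/-- A continuous function that is holomorphic off the real line is entire: every rectangle splits
along the line into two rectangles over whose boundary the integral vanishes. -/
theorem differentiable_of_continuous_of_differentiableOn_im_ne_zero {f : ℂ → F}
    (hc : Continuous f) (hd : DifferentiableOn ℂ f {z : ℂ | z.im ≠ 0}) : Differentiable ℂ f := by
  have hcons : Complex.IsConservativeOn f Set.univ := by
    intro z w _
    rw [← add_eq_zero_iff_eq_neg, Complex.wedgeIntegral_add_wedgeIntegral_eq]
    have h1 := Complex.integral_boundary_rect_eq_zero_of_continuousOn_of_differentiableOn f z
      (w.re : ℂ) hc.continuousOn (hd.mono fun u hu => by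
        have h2 := hu.2
        simp only [Set.mem_preimage, Complex.ofReal_im, Set.mem_Ioo] at h2
        rw [Set.mem_ofPred_eq]
        rintro h0
        rw [h0] at h2
        rcases min_lt_iff.1 h2.1 with h | h <;> rcases lt_max_iff.1 h2.2 with h' | h' <;> linarith)
    have h2 := Complex.integral_boundary_rect_eq_zero_of_continuousOn_of_differentiableOn f (z.re : ℂ)
      w hc.continuousOn (hd.mono fun u hu => by
        have h2 := hu.2
        simp only [Set.mem_preimage, Complex.ofReal_im, Set.mem_Ioo] at h2
        rw [Set.mem_ofPred_eq]
        rintro h0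
        rw [h0] at h2
        rcases min_lt_iff.1 h2.1 with h | h <;> rcases lt_max_iff.1 h2.2 with h' | h' <;> linarith)
    have hint : ∀ (a : ℂ) (p q : ℝ), IntervalIntegrable (fun y : ℝ => f (a + y * I)) volume p q :=
      fun a p q => (hc.comp (by fun_prop)).intervalIntegrable p q
    have e1 := intervalIntegral.integral_add_adjacent_intervals (hint w.re z.im 0) (hint w.re 0 w.im)
    have e2 := intervalIntegral.integral_add_adjacent_intervals (hint z.re z.im 0) (hint z.re 0 w.im)
    rw [← e1, ← e2]
    simp only [Complex.ofReal_re, Complex.ofReal_im, Complex.ofReal_zero, zero_mul, add_zero]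
      at h1 h2
    have h3 := congrArg₂ (· + ·) h1 h2
    simp only [add_zero] at h3
    rw [← h3]
    simp only [smul_add]
    abel
  obtain ⟨g, hg⟩ := hcons.isExactOn_univ hc
  have hg' : Differentiable ℂ g := fun z => (hg z trivial).differentiableAt
  have : f = deriv g := funext fun z => (hg z trivial).deriv.symm
  rw [this]
  exact differentiableOn_univ.1 (hg'.differentiableOn.deriv isOpen_univ)

theorem dense_im_ne_zero : Dense {z : ℂ | z.im ≠ 0} := by
  have h : Dense (Complex.im ⁻¹' ({0}ᶜ : Set ℝ)) :=
    (dense_compl_singleton (0 : ℝ)).preimage Complex.isOpenMap_im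
  exact h

theorem setOf_im_ne_zero_eq_union : {z : ℂ | z.im ≠ 0} = upperHP ∪ lowerHP := by
  ext z
  simp only [upperHP, lowerHP, Set.mem_union, Set.mem_ofPred_eq]
  rw [ne_iff_lt_or_gt, or_comm]

/-- A function holomorphic off the real line whose boundary values from both sides agree and which
tends to `c` at infinity is constant. -/
theorem eq_const_of_no_jump {f : ℂ → F} {c : F} {g : ℝ → F}
    (hd : DifferentiableOn ℂ f {z : ℂ | z.im ≠ 0})
    (hup : ∀ l : ℝ, Tendsto f (𝓝[upperHP] (l : ℂ)) (𝓝 (g l)))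
    (hlow : ∀ l : ℝ, Tendsto f (𝓝[lowerHP] (l : ℂ)) (𝓝 (g l)))
    (hinf : Tendsto f (Bornology.cobounded ℂ ⊓ 𝓟 {z : ℂ | z.im ≠ 0}) (𝓝 c)) :
    ∀ z : ℂ, z.im ≠ 0 → f z = c := by
  have hlim : ∀ z : ℂ, ∃ y, Tendsto f (𝓝[{z : ℂ | z.im ≠ 0}] z) (𝓝 y) := by
    intro z
    by_cases hz : z.im = 0
    · obtain ⟨l, rfl⟩ : ∃ l : ℝ, (l : ℂ) = z := ⟨z.re, Complex.ext (by simp) (by simp [hz])⟩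
      refine ⟨g l, ?_⟩
      rw [setOf_im_ne_zero_eq_union, nhdsWithin_union]
      exact (hup l).sup (hlow l)
    · exact ⟨f z, (hd z hz).continuousWithinAt⟩
  -- the continuous extension of `f` across the line is entire, and tends to `c` at infinity
  set φ := extendFrom {z : ℂ | z.im ≠ 0} f with hφ
  have hφc : Continuous φ := continuous_extendFrom dense_im_ne_zero hlim
  have hφeq : ∀ z : ℂ, z.im ≠ 0 → φ z = f z := fun z hz =>
    extendFrom_eq (dense_im_ne_zero z) (hd z hz).continuousWithinAt
  have hφd : Differentiable ℂ φ :=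
    differentiable_of_continuous_of_differentiableOn_im_ne_zero hφc (hd.congr hφeq)
  have hφinf : Tendsto φ (cocompact ℂ) (𝓝 c) := by
    rw [← Metric.cobounded_eq_cocompact]
    refine (closed_nhds_basis c).tendsto_right_iff.2 fun V hV => ?_
    have h1 := hinf hV.1
    rw [mem_map, mem_inf_principal, ← comap_norm_atTop, mem_comap] at h1
    obtain ⟨s, hs, hs'⟩ := h1
    obtain ⟨R, hR⟩ := mem_atTop_sets.1 hs
    rw [← comap_norm_atTop]
    refine mem_comap.2 ⟨Set.Ioi R, Ioi_mem_atTop R, fun z hz => ?_⟩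
    have hzR : R < ‖z‖ := hz
    refine hV.2.mem_of_frequently_of_tendsto ?_ ((hφc.tendsto z).mono_left
      (nhdsWithin_le_nhds (s := {z : ℂ | z.im ≠ 0})))
    have hne : (𝓝[{z : ℂ | z.im ≠ 0}] z).NeBot := mem_closure_iff_nhdsWithin_neBot.1
      (dense_im_ne_zero z)
    refine Eventually.frequently ?_
    filter_upwards [self_mem_nhdsWithin, nhdsWithin_le_nhds
      ((isOpen_lt continuous_const continuous_norm).mem_nhds hzR)] with u hu hu'
    rw [hφeq u hu]
    exact hs' (hR _ (le_of_lt hu')) hu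
  intro z hz
  rw [← hφeq z hz]
  exact hφd.apply_eq_of_tendsto_cocompact z hφinf

end RemovableLine

/-! ### Uniqueness for Riemann-Hilbert problems -/

section Uniqueness

theorem differentiable_matrix_entry (i j : Fin 3) : Differentiable ℂ fun A : Mat3 => A i j :=
  (LinearMap.toContinuousLinearMap (Matrix.entryLinearMap ℂ ℂ i j)).differentiable

theorem differentiable_adjugate : Differentiable ℂ fun A : Mat3 => A.adjugate := by
  have h : Differentiable ℂ fun A : Mat3 => frob A.adjugate := by
    rw [differentiable_euclidean]
    rintro ⟨i, j⟩
    have he := differentiable_matrix_entry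
    simp only [frob_apply, Matrix.adjugate_fin_three]
    fin_cases i <;> fin_cases j <;> simp <;> fun_prop
  have := frob.symm.differentiable.comp h
  rwa [show (frob.symm ∘ fun A : Mat3 => frob A.adjugate) = fun A : Mat3 => A.adjugate from
    funext fun A => frob.symm_apply_apply _] at this

/-- If `M` and `M'` solve the same Riemann-Hilbert problem, whose jump matrix has determinant one,
then `M' adj M` has no jump; it is therefore the identity. -/
theorem SolvesRHP.mul_adjugate_eq_one {J : ℝ → Mat3} (hJ : ∀ l, (J l).det = 1) {M M' : ℂ → Mat3}
    (h : SolvesRHP J M) (h' : SolvesRHP J M') (z : ℂ) (hz : z.im ≠ 0) :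
    M' z * (M z).adjugate = 1 := by
  obtain ⟨Mp, Mm, -, -, hp, hm, hjump⟩ := h.jump
  obtain ⟨Mp', Mm', -, -, hp', hm', hjump'⟩ := h'.jump
  have hadj := differentiable_adjugate.continuous
  refine eq_const_of_no_jump (f := fun z => M' z * (M z).adjugate)
    (g := fun l => Mm' l * (Mm l).adjugate)
    (h'.analytic.mul (differentiable_adjugate.comp_differentiableOn h.analytic)) (fun l => ?_)
    (fun l => ?_) ?_ z hz
  · have h1 := (hp' l).mul ((hadj.tendsto _).comp (hp l))
    have h2 : Mp' l * (Mp l).adjugate = Mm' l * (Mm l).adjugate := by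
      rw [hjump, hjump', Matrix.adjugate_mul_distrib, mul_assoc, ← mul_assoc (J l),
        Matrix.mul_adjugate, hJ, one_smul, one_mul]
    rw [h2] at h1
    exact h1
  · exact (hm' l).mul ((hadj.tendsto _).comp (hm l))
  · have h1 := h'.tendsto_one.mul ((hadj.tendsto _).comp h.tendsto_one)
    rw [Matrix.adjugate_one, one_mul] at h1
    exact h1

theorem SolvesRHP.unique {J : ℝ → Mat3} (hJ : ∀ l, (J l).det = 1) {M M' : ℂ → Mat3}
    (h : SolvesRHP J M) (h' : SolvesRHP J M') (z : ℂ) (hz : z.im ≠ 0) : M' z = M z := by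
  have h1 := h.mul_adjugate_eq_one hJ h z hz
  have h2 := h.mul_adjugate_eq_one hJ h' z hz
  have h3 : (M z).adjugate * M z = 1 := mul_eq_one_comm.1 h1
  calc M' z = M' z * ((M z).adjugate * M z) := by rw [h3, mul_one]
    _ = (M' z * (M z).adjugate) * M z := (mul_assoc _ _ _).symm
    _ = M z := by rw [h2, one_mul]

end Uniqueness

/-! ### Multiplication by regular coefficients -/

section Boundedness

theorem IsRegularCoeff.exists_bound {W : ℝ → Mat3} (hW : IsRegularCoeff W) :
    ∃ C, ∀ s, ‖W s‖ ≤ C := by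
  have h1 : IsRegularCoeff fun t => frob (W t) :=
    hW.clm_comp ((frob : Mat3 →L[ℂ] FrobSpace).restrictScalars ℝ)
  have h2 := tendsto_cocompact_of_L2Lipschitz h1.continuous h1.integrable h1.memLp h1.L2Lipschitz
  have h3 : Tendsto W (cocompact ℝ) (𝓝 0) := by
    have := (frob.symm.continuous.tendsto 0).comp h2
    simpa [Function.comp_def] using this
  have h4 := h3.norm
  rw [norm_zero] at h4
  obtain ⟨x, hx⟩ := (hW.continuous.norm.max (continuous_const (y := (1 : ℝ)))).exists_forall_ge' 0
    (by filter_upwards [h4.eventually (gt_mem_nhds one_pos)] with y hy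
        rw [max_eq_right hy.le]; exact le_max_right _ _)
  exact ⟨_, fun s => (le_max_left _ _).trans (hx s)⟩

/-- Right multiplication by a regular matrix-valued coefficient on `L²(ℝ; ℂ^{3×3})`. -/
def IsRegularCoeff.mulRight {W : ℝ → Mat3} (hW : IsRegularCoeff W) : L2Mat →L[ℂ] L2Mat :=
  mulRightOp W hW.exists_bound.choose hW.continuous hW.exists_bound.choose_spec

theorem IsRegularCoeff.coeFn_mulRight {W : ℝ → Mat3} (hW : IsRegularCoeff W) (f : L2Mat) :
    hW.mulRight f =ᵐ[volume] fun s => f s * W s :=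
  coeFn_mulRightOp f

theorem memLp_mul_of_regular {W : ℝ → Mat3} (hW : IsRegularCoeff W) {f : ℝ → Mat3}
    (hf : MemLp f 2 volume) : MemLp (fun s => f s * W s) 2 volume := by
  refine (Lp.memLp (hW.mulRight (hf.toLp f))).ae_eq ?_
  filter_upwards [hW.coeFn_mulRight (hf.toLp f), hf.coeFn_toLp] with s h1 h2
  rw [h1, h2]

theorem integrable_mul_of_regular {W : ℝ → Mat3} (hW : IsRegularCoeff W) {f : ℝ → Mat3}
    (hf : MemLp f 2 volume) : Integrable (fun s => f s * W s) := by
  refine (hf.norm.integrable_mul hW.memLp.norm).mono' (memLp_mul_of_regular hW hf).1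
    (.of_forall fun s => norm_mul_le _ _)

end Boundedness

section DifferenceEstimate

/-- The `L²` norm of `(1 + f(· + h)) (W(· + h) - W)` for `f` in `L²`: in addition to a term
`O(h)`, there is one that involves the difference `f(· + h) - f`. -/
theorem IsRegularCoeff.norm_mul_sub_le {W : ℝ → Mat3} (hW : IsRegularCoeff W) :
    ∃ K : ℝ, 0 ≤ K ∧ ∀ (f r : L2Mat) (h : ℝ), 0 < h → h ≤ 1 →
      (r =ᵐ[volume] fun s => (1 + f (s + h)) * (W (s + h) - W s)) →
      ‖r‖ ≤ K * h + K * √(h * (‖f‖ * ‖translateLp h f - f‖)) := by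
  obtain ⟨κ, hκ, hfin, hmod⟩ := hW.modulus
  set S := (∫⁻ t, κ t).toReal with hS
  have hS0 : 0 ≤ S := ENNReal.toReal_nonneg
  refine ⟨√S + √(2 * S), by positivity, fun f r h h0 h1 hr => ?_⟩
  have hWm : AEStronglyMeasurable (fun s => W (s + h) - W s) volume :=
    ((hW.continuous.comp (continuous_add_const h)).sub hW.continuous).aestronglyMeasurable
  have hfm := aestronglyMeasurable_translate (Lp.aestronglyMeasurable f) h
  have hD : eLpNorm (fun s => f (s + h) - f s) 2 volume = ENNReal.ofReal ‖translateLp h f - f‖ := by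
    rw [ofReal_norm, Lp.enorm_def]
    refine eLpNorm_congr_ae ?_
    filter_upwards [Lp.coeFn_sub (translateLp h f) f, coeFn_translateLp h f] with s h1 h2
    rw [h1, Pi.sub_apply, h2]
  have hf : eLpNorm f 2 volume = ENNReal.ofReal ‖f‖ := by rw [ofReal_norm, Lp.enorm_def]
  have hκS : ∫⁻ t, κ t = ENNReal.ofReal S := (ENNReal.ofReal_toReal hfin).symm
  have e1 : eLpNorm (fun s => W (s + h) - W s) 2 volume ≤ ENNReal.ofReal (√S * h) := by
    rw [← ENNReal.pow_le_pow_left_iff two_ne_zero]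
    refine (hmod.eLpNorm_sub_sq_le hκ h0 h1).trans (le_of_eq ?_)
    rw [hκS, ← ENNReal.ofReal_pow h0.le, ← ENNReal.ofReal_mul (by positivity),
      ← ENNReal.ofReal_pow (by positivity), mul_pow, Real.sq_sqrt hS0, mul_comm]
  have e2 : eLpNorm (fun s => f (s + h) * (W (s + h) - W s)) 2 volume ≤
      ENNReal.ofReal (√(2 * S) * √(h * (‖f‖ * ‖translateLp h f - f‖))) := by
    rw [eLpNorm_two_le_iff]
    calc ∫⁻ s, ‖f (s + h) * (W (s + h) - W s)‖ₑ ^ 2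
        ≤ ∫⁻ s, (‖f (s + h)‖ₑ * ‖W (s + h) - W s‖ₑ) ^ 2 := by
          refine lintegral_mono fun s => ?_
          gcongr
          rw [← ofReal_norm, ← ofReal_norm, ← ofReal_norm, ← ENNReal.ofReal_mul (norm_nonneg _)]
          exact ENNReal.ofReal_le_ofReal (norm_mul_le _ _)
      _ ≤ _ := hmod.lintegral_enorm_sq_mul_le hκ (Lp.memLp f) h0 h1
      _ = _ := by
          have ha := norm_nonneg f
          have hb := norm_nonneg (translateLp h f - f)
          rw [hD, hf, hκS]
          generalize ‖translateLp h f - f‖ = b at hb ⊢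
          generalize ‖f‖ = a at ha ⊢
          rw [← ENNReal.ofReal_ofNat, ← ENNReal.ofReal_mul zero_le_two,
            ← ENNReal.ofReal_mul (by positivity), ← ENNReal.ofReal_mul hS0,
            ← ENNReal.ofReal_mul h0.le, ← ENNReal.ofReal_pow (by positivity), mul_pow,
            Real.sq_sqrt (by positivity), Real.sq_sqrt (by positivity)]
          congr 1; ring
  have e3 : ENNReal.ofReal ‖r‖ ≤
      ENNReal.ofReal (√S * h + √(2 * S) * √(h * (‖f‖ * ‖translateLp h f - f‖))) := by
    rw [ofReal_norm, Lp.enorm_def, eLpNorm_congr_ae hr,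
      ENNReal.ofReal_add (by positivity) (by positivity)]
    have e4 : (fun s => (1 + f (s + h)) * (W (s + h) - W s)) =
        (fun s => W (s + h) - W s) + fun s => f (s + h) * (W (s + h) - W s) := by
      ext1 s
      rw [Pi.add_apply, add_mul, one_mul]
    rw [e4]
    exact (eLpNorm_add_le hWm (hfm.mul hWm) one_le_two).trans (add_le_add e1 e2)
  have e5 := (ENNReal.ofReal_le_ofReal_iff (by positivity)).1 e3
  have e6 : 0 ≤ √S * √(h * (‖f‖ * ‖translateLp h f - f‖)) := by positivity
  have e7 : 0 ≤ √(2 * S) * h := by positivity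
  linarith

end DifferenceEstimate

/-! ### The operator `C_W` of an admissible jump -/

/-- A jump matrix `V = (1 - W₋)⁻¹ (1 + W₊)` with regular factors, where `W₋² = 0`, of determinant
one, and with uniformly positive real part. As `W₋² = 0`, the inverse of `1 - W₋` is written
`1 + W₋`. Positivity refers to the action on row vectors, with the Frobenius inner product of
matrices. -/
structure IsAdmissibleJump (Wm Wp V : ℝ → Mat3) : Prop where
  regular_minus : IsRegularCoeff Wm
  regular_plus : IsRegularCoeff Wp
  sq_minus : ∀ l, Wm l * Wm l = 0
  eq_mul : ∀ l, V l = (1 + Wm l) * (1 + Wp l)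
  det_eq_one : ∀ l, (V l).det = 1
  coercive : ∃ c : ℝ, 0 < c ∧ ∀ (l : ℝ) (A : Mat3),
    c * ‖frob A‖ ^ 2 ≤ (inner ℂ (frob (A * V l)) (frob A)).re

/-- `g = C_W h` for general factors `W_±`. -/
def IsFactorImage (Wm Wp : ℝ → Mat3) (h g : ℝ → Mat3) : Prop :=
  ∃ gp gm : ℝ → Mat3,
    IsCauchyProjection 1 (fun l => h l * Wm l) gp ∧
    IsCauchyProjection (-1) (fun l => h l * Wp l) gm ∧
    g =ᵐ[volume] fun l => gp l + gm l

/-- The Cauchy projection `C^+`. -/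
abbrev projPlus : L2Mat →L[ℂ] L2Mat := matCauchyProj (Or.inl rfl : (1 : ℝ) = 1 ∨ (1 : ℝ) = -1)

/-- The Cauchy projection `C^-`. -/
abbrev projMinus : L2Mat →L[ℂ] L2Mat := matCauchyProj (Or.inr rfl : (-1 : ℝ) = 1 ∨ (-1 : ℝ) = -1)

theorem projMinus_eq : projMinus = projPlus - 1 := by
  ext1 f
  have h := congrArg (fun T => frobLp.symm (T (frobLp f)))
    (cauchyProj_sub_cauchyProj (E := FrobSpace))
  simp only [sub_apply, map_sub, one_apply_eq_self, ContinuousLinearEquiv.symm_apply_apply] at h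
  have h2 : projPlus f - projMinus f = f := h
  rw [sub_apply, one_apply_eq_self, eq_sub_iff_add_eq, add_comm]
  exact (sub_eq_iff_eq_add.1 h2).symm

theorem isFactorImage_iff {Wm Wp h : ℝ → Mat3} {fm fp : L2Mat}
    (hm : fm =ᵐ[volume] fun l => h l * Wm l) (hp : fp =ᵐ[volume] fun l => h l * Wp l) (g : L2Mat) :
    IsFactorImage Wm Wp h g ↔ g = projPlus fm + projMinus fp := by
  have h1 := (isCauchyProjection_matCauchyProj (Or.inl rfl : (1 : ℝ) = 1 ∨ (1 : ℝ) = -1) fm).congr_ae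
    hm (EventuallyEq.refl _ _)
  have h2 := (isCauchyProjection_matCauchyProj
    (Or.inr rfl : (-1 : ℝ) = 1 ∨ (-1 : ℝ) = -1) fp).congr_ae hp (EventuallyEq.refl _ _)
  constructor
  · rintro ⟨gp, gm, h3, h4, h5⟩
    refine Lp.ext ?_
    filter_upwards [h5, h1.ae_eq ((Lp.aestronglyMeasurable fm).congr hm) h3,
      h2.ae_eq ((Lp.aestronglyMeasurable fp).congr hp) h4,
      Lp.coeFn_add (projPlus fm) (projMinus fp)] with s e1 e2 e3 e4
    rw [e1, e4, Pi.add_apply, e2, e3]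
  · rintro rfl
    exact ⟨_, _, h1, h2, Lp.coeFn_add _ _⟩

namespace IsAdmissibleJump

variable {Wm Wp V : ℝ → Mat3} (h : IsAdmissibleJump Wm Wp V)

/-- The operator `C_W h = C^+(h W₋) + C^-(h W₊)`. -/
def op : L2Mat →L[ℂ] L2Mat :=
  projPlus * h.regular_minus.mulRight + projMinus * h.regular_plus.mulRight

/-- The function `C_W I = C^+ W₋ + C^- W₊`. -/
def source : L2Mat :=
  projPlus (h.regular_minus.memLp.toLp Wm) + projMinus (h.regular_plus.memLp.toLp Wp)

theorem isFactorImage_op (φ : L2Mat) : IsFactorImage Wm Wp φ (h.op φ) :=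
  (isFactorImage_iff (h.regular_minus.coeFn_mulRight φ) (h.regular_plus.coeFn_mulRight φ) _).2 rfl

theorem isFactorImage_one : IsFactorImage Wm Wp (fun _ => 1) h.source := by
  refine (isFactorImage_iff (fm := h.regular_minus.memLp.toLp Wm)
    (fp := h.regular_plus.memLp.toLp Wp) ?_ ?_ _).2 rfl
  · simpa using h.regular_minus.memLp.coeFn_toLp
  · simpa using h.regular_plus.memLp.coeFn_toLp

theorem isFactorImage_one_add_iff (φ g : L2Mat) :
    IsFactorImage Wm Wp (fun l => 1 + φ l) g ↔ g = h.op φ + h.source := by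
  rw [isFactorImage_iff (fm := h.regular_minus.mulRight φ + h.regular_minus.memLp.toLp Wm)
    (fp := h.regular_plus.mulRight φ + h.regular_plus.memLp.toLp Wp)]
  · rw [map_add, map_add, op, source, add_apply, mul_apply_eq_comp, mul_apply_eq_comp]
    constructor <;> rintro rfl <;> abel
  · filter_upwards [h.regular_minus.coeFn_mulRight φ, h.regular_minus.memLp.coeFn_toLp,
      Lp.coeFn_add (h.regular_minus.mulRight φ) (h.regular_minus.memLp.toLp Wm)] with s e1 e2 e3
    rw [e3, Pi.add_apply, e1, e2, add_mul, one_mul, add_comm]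
  · filter_upwards [h.regular_plus.coeFn_mulRight φ, h.regular_plus.memLp.coeFn_toLp,
      Lp.coeFn_add (h.regular_plus.mulRight φ) (h.regular_plus.memLp.toLp Wp)] with s e1 e2 e3
    rw [e3, Pi.add_apply, e1, e2, add_mul, one_mul, add_comm]

/-- Invertibility of `1 - C_W`. With `P = C^+`, it equals `(P + (1 - P) R_V) R_{1 - W₋}`, where `R`
denotes right multiplication. -/
theorem isUnit_one_sub_op : IsUnit (1 - h.op) := by
  set Rm := h.regular_minus.mulRight with hRm
  set Rp := h.regular_plus.mulRight with hRp
  have hsq : Rm * Rm = 0 := by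
    ext1 f
    refine Lp.ext ?_
    filter_upwards [h.regular_minus.coeFn_mulRight f, h.regular_minus.coeFn_mulRight (Rm f),
      Lp.coeFn_zero Mat3 2 (volume : Measure ℝ)] with s e1 e2 e3
    rw [mul_apply_eq_comp, zero_apply, e2, e1, e3, mul_assoc, h.sq_minus, mul_zero, Pi.zero_apply]
  set A := (1 + Rp) * (1 + Rm) with hA
  have hU : IsUnit (1 - Rm) := by
    refine ⟨⟨1 - Rm, 1 + Rm, ?_, ?_⟩, rfl⟩
    · calc (1 - Rm) * (1 + Rm) = 1 - Rm * Rm := by noncomm_ring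
        _ = 1 := by rw [hsq, sub_zero]
    · calc (1 + Rm) * (1 - Rm) = 1 - Rm * Rm := by noncomm_ring
        _ = 1 := by rw [hsq, sub_zero]
  have hfac : 1 - h.op = (projPlus + (1 - projPlus) * A) * (1 - Rm) := by
    have e : (1 + Rm) * (1 - Rm) = 1 := by
      calc (1 + Rm) * (1 - Rm) = 1 - Rm * Rm := by noncomm_ring
        _ = 1 := by rw [hsq, sub_zero]
    calc 1 - h.op = projPlus * (1 - Rm) + (1 - projPlus) * (1 + Rp) := by
          rw [op, projMinus_eq, ← hRm, ← hRp]; noncomm_ring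
      _ = projPlus * (1 - Rm) + (1 - projPlus) * (1 + Rp) * ((1 + Rm) * (1 - Rm)) := by
          rw [e, mul_one]
      _ = _ := by rw [hA]; noncomm_ring
  rw [hfac]
  refine IsUnit.mul ?_ hU
  -- transport to the Hilbert space of matrices with the Frobenius norm
  obtain ⟨c, hc, hcoer⟩ := h.coercive
  have hθ : (1 : ℝ) = 1 ∨ (1 : ℝ) = -1 := Or.inl rfl
  have hunit := isUnit_proj_add_of_coercive (cauchyProj FrobSpace hθ)
    (frobLp.conjContinuousAlgEquiv A)
    (cauchyProj_comp_self hθ) (inner_cauchyProj_left hθ) hc fun u => by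
      set m := frobLp.symm u with hm
      have hAm : A m =ᵐ[volume] fun s => m s * V s := by
        have e : A m = m + Rm m + Rp (m + Rm m) := rfl
        rw [e]
        filter_upwards [Lp.coeFn_add m (Rm m), Lp.coeFn_add (m + Rm m) (Rp (m + Rm m)),
          h.regular_minus.coeFn_mulRight m, h.regular_plus.coeFn_mulRight (m + Rm m)]
          with s e1 e2 e3 e4
        rw [e2, Pi.add_apply, e4, e1, Pi.add_apply, e3, h.eq_mul]
        noncomm_ring
      have hu : u =ᵐ[volume] fun s => frob (m s) := by
        have := coeFn_frobLp m
        rwa [hm, ContinuousLinearEquiv.apply_symm_apply] at this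
      have hAu : frobLp.conjContinuousAlgEquiv A u =ᵐ[volume] fun s => frob (m s * V s) := by
        rw [ContinuousLinearEquiv.conjContinuousAlgEquiv_apply_apply]
        filter_upwards [coeFn_frobLp (A m), hAm] with s e1 e2
        rw [e1, e2]
      have hint := L2.integrable_inner (𝕜 := ℂ) (frobLp.conjContinuousAlgEquiv A u) u
      have e1 : (inner ℂ (frobLp.conjContinuousAlgEquiv A u) u).re =
          ∫ s, (inner ℂ (frobLp.conjContinuousAlgEquiv A u s) (u s)).re := by
        rw [L2.inner_def]
        exact (integral_re hint).symm
      have e2 : c * ‖u‖ ^ 2 = ∫ s, c * ‖u s‖ ^ 2 := by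
        rw [integral_const_mul]
        congr 1
        have e3 : (‖u‖ ^ 2 : ℝ) = (inner ℂ u u : ℂ).re := by
          rw [inner_self_eq_norm_sq_to_K]; norm_cast
        rw [e3, L2.inner_def]
        rw [show (∫ s, inner ℂ (u s) (u s) : ℂ).re = ∫ s, (inner ℂ (u s) (u s) : ℂ).re from
          (integral_re (L2.integrable_inner (𝕜 := ℂ) u u)).symm]
        refine integral_congr_ae (.of_forall fun s => ?_)
        beta_reduce
        rw [inner_self_eq_norm_sq_to_K]; norm_cast
      rw [e1, e2]
      refine integral_mono_ae ?_ hint.re ?_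
      · exact ((memLp_two_iff_integrable_sq_norm (Lp.aestronglyMeasurable u)).1
          (Lp.memLp u)).const_mul c
      · filter_upwards [hu, hAu] with s e3 e4
        rw [e3, e4]
        exact hcoer s (m s)
  have := hunit.map frobLp.conjContinuousAlgEquiv.symm
  convert this using 1
  rw [map_add, map_mul, map_sub, map_one]
  simp only [ContinuousAlgEquiv.symm_apply_apply]
  rfl

end IsAdmissibleJump

/-! ### Regularity of the solution of the singular integral equation -/

section LipschitzLp

theorem L2Lipschitz.congr_ae {f g : ℝ → Mat3} (hf : L2Lipschitz f) (hfg : f =ᵐ[volume] g) :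
    L2Lipschitz g := by
  obtain ⟨C, hC⟩ := hf
  refine ⟨C, fun a h0 h1 => (le_of_eq (eLpNorm_congr_ae ?_)).trans (hC a h0 h1)⟩
  filter_upwards [hfg, (measurePreserving_add_right volume a).quasiMeasurePreserving.ae hfg]
    with s e1 e2
  rw [e1, e2]

theorem l2Lipschitz_of_norm_translateLp_sub_le {u : L2Mat} {C : ℝ}
    (h : ∀ a : ℝ, 0 < a → a ≤ 1 → ‖translateLp a u - u‖ ≤ C * a) : L2Lipschitz u := by
  refine ⟨C, fun a h0 h1 => ?_⟩
  refine le_trans (le_of_eq ?_) (ENNReal.ofReal_le_ofReal (h a h0 h1))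
  rw [ofReal_norm, Lp.enorm_def]
  refine eLpNorm_congr_ae ?_
  filter_upwards [Lp.coeFn_sub (translateLp a u) u, coeFn_translateLp a u] with s e1 e2
  rw [e1, Pi.sub_apply, e2]

/-- `(1 + φ) W` as an element of `L²`. -/
def IsRegularCoeff.oneAddMul {W : ℝ → Mat3} (hW : IsRegularCoeff W) (φ : L2Mat) : L2Mat :=
  hW.mulRight φ + hW.memLp.toLp W

theorem IsRegularCoeff.coeFn_oneAddMul {W : ℝ → Mat3} (hW : IsRegularCoeff W) (φ : L2Mat) :
    hW.oneAddMul φ =ᵐ[volume] fun s => (1 + φ s) * W s := by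
  filter_upwards [hW.coeFn_mulRight φ, hW.memLp.coeFn_toLp,
    Lp.coeFn_add (hW.mulRight φ) (hW.memLp.toLp W)] with s e1 e2 e3
  rw [oneAddMul, e3, Pi.add_apply, e1, e2, add_mul, one_mul, add_comm]

/-- Bound for the part of the difference of `(1 + φ) W` and its translate in which only `W` is
differenced. -/
theorem IsRegularCoeff.norm_translateLp_oneAddMul_sub_le {W : ℝ → Mat3} (hW : IsRegularCoeff W) :
    ∃ K : ℝ, 0 ≤ K ∧ ∀ (φ : L2Mat) (a : ℝ), 0 < a → a ≤ 1 →
      ‖translateLp a (hW.oneAddMul φ) - hW.oneAddMul (translateLp a φ)‖ ≤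
        K * a + K * √(a * (‖φ‖ * ‖translateLp a φ - φ‖)) := by
  obtain ⟨K, hK, h⟩ := hW.norm_mul_sub_le
  refine ⟨K, hK, fun φ a h0 h1 => h φ _ a h0 h1 ?_⟩
  filter_upwards [Lp.coeFn_sub (translateLp a (hW.oneAddMul φ)) (hW.oneAddMul (translateLp a φ)),
    coeFn_translateLp a (hW.oneAddMul φ), hW.coeFn_oneAddMul (translateLp a φ),
    coeFn_translateLp a φ,
    (measurePreserving_add_right volume a).quasiMeasurePreserving.ae (hW.coeFn_oneAddMul φ)]
    with s e1 e2 e3 e4 e5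
  rw [e1, Pi.sub_apply, e2, e3, e4, e5, mul_sub]

theorem IsRegularCoeff.oneAddMul_sub_oneAddMul {W : ℝ → Mat3} (hW : IsRegularCoeff W)
    (φ ψ : L2Mat) : hW.oneAddMul φ - hW.oneAddMul ψ = hW.mulRight (φ - ψ) := by
  rw [oneAddMul, oneAddMul, map_sub]; abel

/-- The term `K √(a N d)` is absorbed by `d`. -/
theorem le_of_le_mul_add_sqrt {K a N d : ℝ} (ha : 0 ≤ a) (hN : 0 ≤ N) (hd : 0 ≤ d)
    (h : d ≤ K * (a + √(a * (N * d)))) : d ≤ (2 * K + K ^ 2 * N) * a := by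
  have hq2 : √(a * (N * d)) ^ 2 = a * (N * d) := Real.sq_sqrt (by positivity)
  have e6 : K * √(a * (N * d)) ≤ (d + K ^ 2 * a * N) / 2 := by
    refine abs_le_of_sq_le_sq' ?_ (by positivity) |>.2
    rw [mul_pow, hq2]
    nlinarith [sq_nonneg (d - K ^ 2 * a * N)]
  linarith

end LipschitzLp

namespace IsAdmissibleJump

variable {Wm Wp V : ℝ → Mat3} (h : IsAdmissibleJump Wm Wp V)

theorem op_add_source (φ : L2Mat) : h.op φ + h.source =
    projPlus (h.regular_minus.oneAddMul φ) + projMinus (h.regular_plus.oneAddMul φ) := by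
  rw [IsRegularCoeff.oneAddMul, IsRegularCoeff.oneAddMul, map_add, map_add, op, source, add_apply,
    mul_apply_eq_comp, mul_apply_eq_comp]
  abel

/-- As `C^±` commute with translations, the difference of a solution `φ = μ - I` and its translate
solves the same linear equation, with a right-hand side in which only `W_±` are differenced. -/
theorem one_sub_op_translateLp_sub {φ : L2Mat} (hφ : φ = h.op φ + h.source) (a : ℝ) :
    (1 - h.op) (translateLp a φ - φ) =
      projPlus (translateLp a (h.regular_minus.oneAddMul φ) -
        h.regular_minus.oneAddMul (translateLp a φ)) +
      projMinus (translateLp a (h.regular_plus.oneAddMul φ) -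
        h.regular_plus.oneAddMul (translateLp a φ)) := by
  have e1 : translateLp a φ = projPlus (translateLp a (h.regular_minus.oneAddMul φ)) +
      projMinus (translateLp a (h.regular_plus.oneAddMul φ)) := by
    rw [matCauchyProj_translateLp, matCauchyProj_translateLp, ← map_add, ← h.op_add_source, ← hφ]
  have e2 := h.op_add_source (translateLp a φ)
  rw [map_sub projPlus, map_sub projMinus]
  generalize projPlus (translateLp a (h.regular_minus.oneAddMul φ)) = p1 at e1 ⊢
  generalize projMinus (translateLp a (h.regular_plus.oneAddMul φ)) = p2 at e1 ⊢
  generalize projPlus (h.regular_minus.oneAddMul (translateLp a φ)) = p3 at e2 ⊢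
  generalize projMinus (h.regular_plus.oneAddMul (translateLp a φ)) = p4 at e2 ⊢
  generalize translateLp a φ = ψ at e1 e2 ⊢
  have e3 : p1 - p3 + (p2 - p4) = ψ - (h.op ψ + h.source) := by rw [e2, e1]; abel
  rw [e3, sub_apply, one_apply_eq_self, map_sub]
  nth_rewrite 1 [hφ]
  abel

/-- The solution of `μ = I + C_W μ` is Lipschitz in the `L²` mean. -/
theorem exists_norm_translateLp_sub_le {φ : L2Mat} (hφ : φ = h.op φ + h.source) :
    ∃ C : ℝ, 0 ≤ C ∧ ∀ a : ℝ, 0 < a → a ≤ 1 → ‖translateLp a φ - φ‖ ≤ C * a := by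
  obtain ⟨Km, hKm0, hKm⟩ := h.regular_minus.norm_translateLp_oneAddMul_sub_le
  obtain ⟨Kp, hKp0, hKp⟩ := h.regular_plus.norm_translateLp_oneAddMul_sub_le
  obtain ⟨S, hS⟩ := h.isUnit_one_sub_op.exists_left_inv
  obtain ⟨A, hA0, hA⟩ : ∃ A : ℝ, 0 ≤ A ∧ ∀ u, ‖u‖ ≤ A * ‖(1 - h.op) u‖ :=
    ⟨‖S‖, S.opNorm_nonneg, fun u => by
      have e : S ((1 - h.op) u) = u := congrArg (fun T : L2Mat →L[ℂ] L2Mat => T u) hS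
      calc ‖u‖ = ‖S ((1 - h.op) u)‖ := by rw [e]
        _ ≤ _ := S.le_opNorm _⟩
  obtain ⟨B, hB0, hB⟩ : ∃ B : ℝ, 0 ≤ B ∧ ∀ u, ‖projPlus u‖ ≤ B * ‖u‖ :=
    ⟨_, projPlus.opNorm_nonneg, projPlus.le_opNorm⟩
  obtain ⟨D, hD0, hD⟩ : ∃ D : ℝ, 0 ≤ D ∧ ∀ u, ‖projMinus u‖ ≤ D * ‖u‖ :=
    ⟨_, projMinus.opNorm_nonneg, projMinus.le_opNorm⟩
  refine ⟨2 * (A * (B * Km + D * Kp)) + (A * (B * Km + D * Kp)) ^ 2 * ‖φ‖, by positivity,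
    fun a h0 h1 => ?_⟩
  refine le_of_le_mul_add_sqrt h0.le (norm_nonneg _) (norm_nonneg _) ?_
  have hm := hKm φ a h0 h1
  have hp := hKp φ a h0 h1
  generalize √(a * (‖φ‖ * ‖translateLp a φ - φ‖)) = q at hm hp ⊢
  calc ‖translateLp a φ - φ‖ ≤ A * ‖(1 - h.op) (translateLp a φ - φ)‖ := hA _
    _ ≤ A * (B * (Km * a + Km * q) + D * (Kp * a + Kp * q)) := by
      rw [h.one_sub_op_translateLp_sub hφ]
      refine mul_le_mul_of_nonneg_left ((norm_add_le _ _).trans (add_le_add ?_ ?_)) hA0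
      · exact (hB _).trans (mul_le_mul_of_nonneg_left hm hB0)
      · exact (hD _).trans (mul_le_mul_of_nonneg_left hp hD0)
    _ = _ := by ring

theorem regular_sum (h : IsAdmissibleJump Wm Wp V) : IsRegularCoeff fun l => Wp l + Wm l :=
  h.regular_plus.add h.regular_minus

/-- The density `μ (W₊ + W₋)` of the Cauchy integral is Lipschitz in the `L²` mean. -/
theorem l2Lipschitz_density {φ : L2Mat} (hφ : φ = h.op φ + h.source) :
    L2Lipschitz fun l => (1 + φ l) * (Wp l + Wm l) := by
  obtain ⟨C, hC0, hC⟩ := h.exists_norm_translateLp_sub_le hφ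
  obtain ⟨K, hK0, hK⟩ := h.regular_sum.norm_translateLp_oneAddMul_sub_le
  refine L2Lipschitz.congr_ae ?_ (h.regular_sum.coeFn_oneAddMul φ)
  set R := h.regular_sum.mulRight with hR
  refine l2Lipschitz_of_norm_translateLp_sub_le (C := K + K * √(‖φ‖ * C) + ‖R‖ * C)
    fun a h0 h1 => ?_
  have e1 : translateLp a (h.regular_sum.oneAddMul φ) - h.regular_sum.oneAddMul φ =
      (translateLp a (h.regular_sum.oneAddMul φ) - h.regular_sum.oneAddMul (translateLp a φ)) +
      R (translateLp a φ - φ) := by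
    rw [hR, ← IsRegularCoeff.oneAddMul_sub_oneAddMul]
    abel
  have e2 : √(a * (‖φ‖ * ‖translateLp a φ - φ‖)) ≤ √(‖φ‖ * C) * a := by
    rw [Real.sqrt_le_left (by positivity), mul_pow, Real.sq_sqrt (by positivity)]
    calc a * (‖φ‖ * ‖translateLp a φ - φ‖) ≤ a * (‖φ‖ * (C * a)) := by
          gcongr; exact hC a h0 h1
      _ = _ := by ring
  rw [e1]
  calc _ ≤ (K * a + K * (√(‖φ‖ * C) * a)) + ‖R‖ * (C * a) := by
        refine (norm_add_le _ _).trans (add_le_add ((hK φ a h0 h1).trans ?_)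
          ((R.le_opNorm _).trans ?_))
        · gcongr
        · gcongr
          exact hC a h0 h1
    _ = _ := by ring

theorem integrable_density (h : IsAdmissibleJump Wm Wp V) (φ : L2Mat) :
    Integrable fun l => (1 + φ l) * (Wp l + Wm l) := by
  have h1 := h.regular_sum.integrable.add (integrable_mul_of_regular h.regular_sum (Lp.memLp φ))
  refine h1.congr (.of_forall fun s => ?_)
  simp only [Pi.add_apply, add_mul, one_mul]

theorem memLp_density (h : IsAdmissibleJump Wm Wp V) (φ : L2Mat) :
    MemLp (fun l => (1 + φ l) * (Wp l + Wm l)) 2 volume :=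
  (Lp.memLp _).ae_eq (h.regular_sum.coeFn_oneAddMul φ)

/-! ### Boundary values of the solution -/

/-- The boundary values of the Cauchy integral of the density, on either side. -/
theorem cauchyIntegral_boundary {θ : ℝ} (hθ : θ = 1 ∨ θ = -1) {φ : L2Mat}
    (hφ : φ = h.op φ + h.source) :
    (∃ U : ℝ → Mat3, Continuous U ∧
      (∀ l : ℝ, Tendsto (cauchyIntegral fun l => (1 + φ l) * (Wp l + Wm l))
        (𝓝[{z | 0 < θ * z.im}] (l : ℂ)) (𝓝 (U l))) ∧
      U =ᵐ[volume] matCauchyProj hθ (h.regular_sum.oneAddMul φ)) ∧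
    Tendsto (cauchyIntegral fun l => (1 + φ l) * (Wp l + Wm l))
      (Bornology.cobounded ℂ ⊓ 𝓟 {z : ℂ | 0 < θ * z.im}) (𝓝 0) := by
  set F : ℝ → Mat3 := fun l => (1 + φ l) * (Wp l + Wm l) with hF
  have hae : frobLp (h.regular_sum.oneAddMul φ) =ᵐ[volume] fun s => frob (F s) := by
    filter_upwards [coeFn_frobLp (h.regular_sum.oneAddMul φ), h.regular_sum.coeFn_oneAddMul φ]
      with s e1 e2
    rw [e1, e2]
  have h1 : Integrable fun s => frob (F s) :=
    (frob : Mat3 →L[ℂ] FrobSpace).integrable_comp (h.integrable_density φ)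
  have h2 : MemLp (fun s => frob (F s)) 2 volume :=
    (frob : Mat3 →L[ℂ] FrobSpace).comp_memLp' (h.memLp_density φ)
  have h3 : L2Lipschitz fun s => frob (F s) := by
    obtain ⟨C, hC⟩ := h.l2Lipschitz_density hφ
    refine ⟨‖(frob : Mat3 →L[ℂ] FrobSpace)‖ * C, fun a h0 h1 => ?_⟩
    rw [mul_assoc, ENNReal.ofReal_mul (norm_nonneg _), ofReal_norm]
    refine le_trans ?_ (mul_le_mul_right (hC a h0 h1) _)
    refine eLpNorm_le_mul_eLpNorm_of_ae_le_mul' (c := ‖(frob : Mat3 →L[ℂ] FrobSpace)‖₊)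
      (.of_forall fun s => ?_) 2
    rw [← map_sub]
    exact ContinuousLinearMap.le_opENorm (frob : Mat3 →L[ℂ] FrobSpace) _
  have hfs : cauchyIntegral F = fun z => frob.symm (cauchyTransform (fun s => frob (F s)) z) := by
    ext1 z
    rw [ContinuousLinearEquiv.eq_symm_apply, frob_cauchyIntegral]
  obtain ⟨⟨U, hU1, hU2, hU3⟩, hinf⟩ := cauchyTransform_boundary hθ h1 h2 h3
  rw [hfs]
  refine ⟨⟨fun l => frob.symm (U l), frob.symm.continuous.comp hU1,
    fun l => (frob.symm.continuous.tendsto _).comp (hU2 l), ?_⟩, ?_⟩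
  · have e : h2.toLp _ = frobLp (h.regular_sum.oneAddMul φ) :=
      Lp.ext (h2.coeFn_toLp.trans hae.symm)
    rw [e] at hU3
    filter_upwards [hU3, coeFn_frobLp_symm (cauchyProj FrobSpace hθ
      (frobLp (h.regular_sum.oneAddMul φ)))] with s e1 e2
    rw [e1]
    exact e2.symm
  · have := (frob.symm.continuous.tendsto 0).comp hinf
    rwa [map_zero] at this

theorem oneAddMul_sum (φ : L2Mat) : h.regular_sum.oneAddMul φ =
    h.regular_plus.oneAddMul φ + h.regular_minus.oneAddMul φ := by
  refine Lp.ext ?_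
  filter_upwards [h.regular_sum.coeFn_oneAddMul φ, h.regular_plus.coeFn_oneAddMul φ,
    h.regular_minus.coeFn_oneAddMul φ,
    Lp.coeFn_add (h.regular_plus.oneAddMul φ) (h.regular_minus.oneAddMul φ)] with s e1 e2 e3 e4
  rw [e1, e4, Pi.add_apply, e2, e3, mul_add]

/-- `C^+(μ (W₊ + W₋)) = φ + μ W₊`, from `φ = C^+(μ W₋) + C^-(μ W₊)` and `C^+ - C^- = 1`. -/
theorem projPlus_oneAddMul_sum {φ : L2Mat} (hφ : φ = h.op φ + h.source) :
    projPlus (h.regular_sum.oneAddMul φ) = φ + h.regular_plus.oneAddMul φ := by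
  rw [op_add_source, projMinus_eq, sub_apply, one_apply_eq_self] at hφ
  rw [h.oneAddMul_sum, map_add, ← sub_eq_iff_eq_add]
  conv_rhs => rw [hφ]
  abel

/-- `C^-(μ (W₊ + W₋)) = φ - μ W₋`, from `φ = C^+(μ W₋) + C^-(μ W₊)` and `C^+ - C^- = 1`. -/
theorem projMinus_oneAddMul_sum {φ : L2Mat} (hφ : φ = h.op φ + h.source) :
    projMinus (h.regular_sum.oneAddMul φ) = φ - h.regular_minus.oneAddMul φ := by
  rw [projMinus_eq, sub_apply, one_apply_eq_self, h.projPlus_oneAddMul_sum hφ, h.oneAddMul_sum]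
  abel

end IsAdmissibleJump

/-! ### Solution of the Riemann-Hilbert problem -/

section Fredholm

theorem isFredholmIndexZero_of_isUnit {T : L2Mat →L[ℂ] L2Mat} (hT : IsUnit T) :
    IsFredholmIndexZero T := by
  obtain ⟨S, hTS⟩ := hT.exists_right_inv
  obtain ⟨S', hST⟩ := hT.exists_left_inv
  have hk : T.ker = ⊥ := LinearMap.ker_eq_bot_of_inverse
    (g := (S' : L2Mat →ₗ[ℂ] L2Mat)) (LinearMap.ext fun u =>
      congrArg (fun T : L2Mat →L[ℂ] L2Mat => T u) hST)
  have hr : T.range = ⊤ := LinearMap.range_eq_top.2 fun u =>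
    ⟨S u, congrArg (fun T : L2Mat →L[ℂ] L2Mat => T u) hTS⟩
  have hsub : Subsingleton (L2Mat ⧸ T.range) := by
    rw [hr]; infer_instance
  refine ⟨?_, ?_⟩
  · obtain ⟨u, rfl⟩ := hT
    exact ContinuousLinearMap.IsFredholm.of_isQuasiInverse
      (v := ((ContinuousLinearEquiv.unitsEquiv ℂ L2Mat u).symm : L2Mat →L[ℂ] L2Mat))
      (ContinuousLinearEquiv.unitsEquiv ℂ L2Mat u).toLinearEquiv.isQuasiInverse
  · rw [hk, finrank_bot, Module.finrank_zero_of_subsingleton]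

end Fredholm

section Solution

theorem isBigO_cauchyIntegral {F : ℝ → Mat3} (hF : Integrable F) {c : ℝ} (hc : 0 < c) :
    cauchyIntegral F =O[Bornology.cobounded ℂ ⊓ 𝓟 {z : ℂ | c * ‖z‖ ≤ |z.im|}]
      fun z : ℂ => z⁻¹ := by
  refine IsBigO.of_bound ((2 * Real.pi)⁻¹ * ((∫ s, ‖F s‖) * c⁻¹)) ?_
  have h1 : ∀ᶠ z : ℂ in Bornology.cobounded ℂ, 0 < ‖z‖ :=
    tendsto_norm_cobounded_atTop.eventually_gt_atTop 0
  rw [eventually_inf_principal]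
  filter_upwards [h1] with z hz hzc
  have hzc' : c * ‖z‖ ≤ |z.im| := hzc
  have h2 : 0 < |z.im| := (mul_pos hc hz).trans_le hzc'
  have hI : 0 ≤ ∫ s, ‖F s‖ := integral_nonneg fun s => norm_nonneg _
  have hpi := Real.pi_pos
  calc ‖cauchyIntegral F z‖ ≤ (2 * Real.pi)⁻¹ * ((∫ s, ‖F s‖) * |z.im|⁻¹) :=
        norm_cauchyTransform_le hF (abs_pos.1 h2)
    _ ≤ (2 * Real.pi)⁻¹ * ((∫ s, ‖F s‖) * (c * ‖z‖)⁻¹) := by gcongr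
    _ = _ := by rw [mul_inv, norm_inv]; ring

namespace IsAdmissibleJump

variable {Wm Wp V : ℝ → Mat3} (h : IsAdmissibleJump Wm Wp V)

theorem continuous_jump (h : IsAdmissibleJump Wm Wp V) : Continuous V := by
  rw [funext h.eq_mul]
  exact (continuous_const.add h.regular_minus.continuous).mul
    (continuous_const.add h.regular_plus.continuous)

/-- The solution of the Riemann-Hilbert problem with density `(1 + φ) (W₊ + W₋)`. -/
def solution (Wm Wp : ℝ → Mat3) (φ : L2Mat) (z : ℂ) : Mat3 :=
  1 + cauchyIntegral (fun l => (1 + φ l) * (Wp l + Wm l)) z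

theorem exists_boundary_upper {φ : L2Mat} (hφ : φ = h.op φ + h.source) :
    ∃ Mp : ℝ → Mat3, Continuous Mp ∧
      (∀ l : ℝ, Tendsto (solution Wm Wp φ) (𝓝[upperHP] (l : ℂ)) (𝓝 (Mp l))) ∧
      Mp =ᵐ[volume] fun l => (1 + φ l) * (1 + Wp l) := by
  obtain ⟨⟨U, hU1, hU2, hU3⟩, -⟩ := h.cauchyIntegral_boundary (Or.inl rfl) hφ
  simp only [one_mul] at hU2
  refine ⟨fun l => 1 + U l, continuous_const.add hU1, fun l => (hU2 l).const_add 1, ?_⟩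
  filter_upwards [hU3, (Lp.ext_iff.1 (h.projPlus_oneAddMul_sum hφ)),
    h.regular_plus.coeFn_oneAddMul φ, Lp.coeFn_add φ (h.regular_plus.oneAddMul φ)] with l e1 e2 e3 e4
  rw [e1, e2, e4, Pi.add_apply, e3]
  noncomm_ring

theorem exists_boundary_lower {φ : L2Mat} (hφ : φ = h.op φ + h.source) :
    ∃ Mm : ℝ → Mat3, Continuous Mm ∧
      (∀ l : ℝ, Tendsto (solution Wm Wp φ) (𝓝[lowerHP] (l : ℂ)) (𝓝 (Mm l))) ∧
      Mm =ᵐ[volume] fun l => (1 + φ l) * (1 - Wm l) := by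
  obtain ⟨⟨U, hU1, hU2, hU3⟩, -⟩ := h.cauchyIntegral_boundary (Or.inr rfl) hφ
  simp only [neg_one_mul, neg_pos] at hU2
  refine ⟨fun l => 1 + U l, continuous_const.add hU1, fun l => (hU2 l).const_add 1, ?_⟩
  filter_upwards [hU3, (Lp.ext_iff.1 (h.projMinus_oneAddMul_sum hφ)),
    h.regular_minus.coeFn_oneAddMul φ, Lp.coeFn_sub φ (h.regular_minus.oneAddMul φ)]
    with l e1 e2 e3 e4
  rw [e1, e2, e4, Pi.sub_apply, e3]
  noncomm_ring

theorem solvesRHP_solution {φ : L2Mat} (hφ : φ = h.op φ + h.source) :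
    SolvesRHP V (solution Wm Wp φ) where
  analytic := fun _ hz =>
    ((differentiableAt_cauchyTransform (h.integrable_density φ) hz).const_add
      (1 : Mat3)).differentiableWithinAt
  tendsto_one := by
    have h1 := (h.cauchyIntegral_boundary (Or.inl rfl) hφ).2
    have h2 := (h.cauchyIntegral_boundary (Or.inr rfl) hφ).2
    simp only [one_mul, neg_one_mul, neg_pos] at h1 h2
    rw [setOf_im_ne_zero_eq_union, ← sup_principal, inf_sup_left]
    have h3 := (h1.sup h2).const_add (1 : Mat3)
    rwa [add_zero] at h3
  isBigO c hc := by
    simpa [solution] using isBigO_cauchyIntegral (h.integrable_density φ) hc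
  jump := by
    obtain ⟨Mp, hp1, hp2, hp3⟩ := h.exists_boundary_upper hφ
    obtain ⟨Mm, hm1, hm2, hm3⟩ := h.exists_boundary_lower hφ
    refine ⟨Mp, Mm, hp1, hm1, hp2, hm2, ?_⟩
    refine congrFun ((hp1.ae_eq_iff_eq volume (hm1.mul h.continuous_jump)).1 ?_)
    filter_upwards [hp3, hm3] with l e1 e2
    -- `(1 - W₋) V = 1 + W₊`
    have e3 : (1 - Wm l) * V l = 1 + Wp l := by
      calc (1 - Wm l) * V l = (1 - Wm l * Wm l) * (1 + Wp l) := by rw [h.eq_mul]; noncomm_ring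
        _ = 1 + Wp l := by rw [h.sq_minus, sub_zero, one_mul]
    rw [e1, Pi.mul_apply, e2, mul_assoc, e3]

/-- The Riemann-Hilbert problem with an admissible jump is uniquely solvable, and its solution is
the Cauchy integral of the density `μ (W₊ + W₋)`, where `μ - I = (1 - C_W)⁻¹ C_W I`. -/
theorem unique_solvability (h : IsAdmissibleJump Wm Wp V) :
    ∃ T : L2Mat →L[ℂ] L2Mat, (∀ φ : L2Mat, IsFactorImage Wm Wp φ (T φ)) ∧
      IsFredholmIndexZero (1 - T) ∧ IsUnit (1 - T) ∧
      ∃ φ : L2Mat,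
        (∃ g : L2Mat, IsFactorImage Wm Wp (fun _ => 1) g ∧ (1 - T) φ = g) ∧
        IsFactorImage Wm Wp (fun l => 1 + φ l) φ ∧
        (∀ ψ : L2Mat, IsFactorImage Wm Wp (fun l => 1 + ψ l) ψ → ψ = φ) ∧
        ∃ M : ℂ → Mat3, SolvesRHP V M ∧
          (∀ M' : ℂ → Mat3, SolvesRHP V M' → ∀ z : ℂ, z.im ≠ 0 → M' z = M z) ∧
          (∀ z : ℂ, z.im ≠ 0 → M z = 1 + cauchyIntegral
            (fun l => (1 + φ l) * (Wp l + Wm l)) z) ∧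
          (∀ᵐ l : ℝ, Tendsto M (𝓝[upperHP] (l : ℂ)) (𝓝 ((1 + φ l) * (1 + Wp l)))) ∧
          (∀ᵐ l : ℝ, Tendsto M (𝓝[lowerHP] (l : ℂ)) (𝓝 ((1 + φ l) * (1 - Wm l)))) := by
  obtain ⟨S, hS⟩ := h.isUnit_one_sub_op.exists_right_inv
  obtain ⟨S', hS'⟩ := h.isUnit_one_sub_op.exists_left_inv
  have hinj : ∀ u v, (1 - h.op) u = (1 - h.op) v → u = v := fun u v huv => by
    have e : ∀ u, S' ((1 - h.op) u) = u := fun u =>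
      congrArg (fun T : L2Mat →L[ℂ] L2Mat => T u) hS'
    rw [← e u, huv, e]
  obtain ⟨φ, hφ⟩ : ∃ φ, (1 - h.op) φ = h.source :=
    ⟨S h.source, congrArg (fun T : L2Mat →L[ℂ] L2Mat => T h.source) hS⟩
  have hiff : ∀ ψ, ψ = h.op ψ + h.source ↔ (1 - h.op) ψ = h.source := fun ψ => by
    rw [sub_apply, one_apply_eq_self, sub_eq_iff_eq_add']
  have hφ' := (hiff φ).2 hφ
  have hM := h.solvesRHP_solution hφ'
  refine ⟨h.op, h.isFactorImage_op, isFredholmIndexZero_of_isUnit h.isUnit_one_sub_op,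
    h.isUnit_one_sub_op, φ, ⟨h.source, h.isFactorImage_one, hφ⟩,
    (h.isFactorImage_one_add_iff φ φ).2 hφ', fun ψ hψ => hinj ψ φ ?_,
    solution Wm Wp φ, hM, fun M' hM' => hM.unique h.det_eq_one hM', fun z _ => rfl, ?_, ?_⟩
  · rw [hφ]
    exact (hiff ψ).1 ((h.isFactorImage_one_add_iff ψ ψ).1 hψ)
  · obtain ⟨Mp, -, hp2, hp3⟩ := h.exists_boundary_upper hφ'
    filter_upwards [hp3] with l hl
    rw [← hl]
    exact hp2 l
  · obtain ⟨Mm, -, hm2, hm3⟩ := h.exists_boundary_lower hφ'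
    filter_upwards [hm3] with l hl
    rw [← hl]
    exact hm2 l

end IsAdmissibleJump

end Solution

/-! ### The conjugated jump matrix -/

section Coefficients

variable {ε x : ℝ} {ρ₁ ρ₂ r₁ r₂ : ℝ → ℂ}

/-- The oscillating coefficient `e^{2 i x l} ρ(l)` of the conjugated jump matrix. -/
def oscCoeff (x : ℝ) (ρ : ℝ → ℂ) (l : ℝ) : ℂ := Complex.exp ((2 * x * l : ℝ) * I) * ρ l

theorem norm_oscCoeff (x : ℝ) (ρ : ℝ → ℂ) (l : ℝ) : ‖oscCoeff x ρ l‖ = ‖ρ l‖ := by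
  rw [oscCoeff, norm_mul, Complex.norm_exp_ofReal_mul_I, one_mul]

theorem star_oscCoeff (x : ℝ) (ρ : ℝ → ℂ) (l : ℝ) :
    star (oscCoeff x ρ l) = Complex.exp (-((2 * x * l : ℝ) * I)) * star (ρ l) := by
  have e : star (Complex.exp ((2 * x * l : ℝ) * I)) = Complex.exp (-((2 * x * l : ℝ) * I)) := by
    change (starRingEnd ℂ) _ = _
    rw [← Complex.exp_conj, map_mul, Complex.conj_ofReal, Complex.conj_I, mul_neg]
  rw [oscCoeff, StarMul.star_mul, e, mul_comm]

theorem exp_sigma_neg (x l : ℝ) :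
    Complex.exp (I * l * x * (-1 - 1)) = Complex.exp (-((2 * x * l : ℝ) * I)) := by
  congr 1; push_cast; ring

theorem exp_sigma_pos (x l : ℝ) :
    Complex.exp (I * l * x * (1 - -1)) = Complex.exp ((2 * x * l : ℝ) * I) := by
  congr 1; push_cast; ring

theorem matWxminus_eq : matWxminus ε ρ₁ ρ₂ x = matWminus ε (oscCoeff x ρ₁) (oscCoeff x ρ₂) := by
  ext1 l
  rw [matWminus, star_oscCoeff, star_oscCoeff, ← exp_sigma_neg]
  ext j k
  fin_cases j <;> fin_cases k <;> simp [matWxminus, expAdSigma, matWminus, sigmaDiag] <;> ring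

theorem matWxplus_eq : matWxplus ρ₁ ρ₂ x = matWplus (oscCoeff x ρ₁) (oscCoeff x ρ₂) := by
  ext1 l
  rw [matWplus, oscCoeff, oscCoeff, ← exp_sigma_pos]
  ext j k
  fin_cases j <;> fin_cases k <;> simp [matWxplus, expAdSigma, matWplus, sigmaDiag]

theorem jumpVx_eq : jumpVx ε ρ₁ ρ₂ x = jumpV ε (oscCoeff x ρ₁) (oscCoeff x ρ₂) := by
  ext1 l
  rw [jumpV, norm_oscCoeff, norm_oscCoeff, star_oscCoeff, star_oscCoeff, ← exp_sigma_neg,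
    oscCoeff, oscCoeff, ← exp_sigma_pos]
  ext j k
  fin_cases j <;> fin_cases k <;> simp [jumpVx, expAdSigma, jumpV, sigmaDiag] <;> ring

theorem isRegularCoeff_matWplus (h₁ : IsRegularCoeff r₁) (h₂ : IsRegularCoeff r₂) :
    IsRegularCoeff (matWplus r₁ r₂) := by
  have h := (h₁.clm_comp ((ContinuousLinearMap.id ℝ ℂ).smulRight
      (!![0, 0, 0; 1, 0, 0; 0, 0, 0] : Mat3))).add
    (h₂.clm_comp ((ContinuousLinearMap.id ℝ ℂ).smulRight (!![0, 0, 0; 0, 0, 0; 1, 0, 0] : Mat3)))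
  convert h using 1
  ext l j k
  fin_cases j <;> fin_cases k <;> simp [matWplus]

theorem isRegularCoeff_matWminus (ε : ℝ) (h₁ : IsRegularCoeff r₁) (h₂ : IsRegularCoeff r₂) :
    IsRegularCoeff (matWminus ε r₁ r₂) := by
  have h := (h₁.clm_comp ((Complex.conjCLE : ℂ →L[ℝ] ℂ).smulRight
      (!![0, (ε : ℂ), 0; 0, 0, 0; 0, 0, 0] : Mat3))).add
    (h₂.clm_comp ((Complex.conjCLE : ℂ →L[ℝ] ℂ).smulRight
      (!![0, 0, (ε : ℂ); 0, 0, 0; 0, 0, 0] : Mat3)))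
  convert h using 1
  ext l j k
  fin_cases j <;> fin_cases k <;> simp [matWminus, mul_comm]

theorem matWminus_mul_self (l : ℝ) : matWminus ε r₁ r₂ l * matWminus ε r₁ r₂ l = 0 := by
  ext j k
  fin_cases j <;> fin_cases k <;> simp [matWminus, Matrix.mul_apply, Fin.sum_univ_three]

theorem jumpV_eq_mul (l : ℝ) :
    jumpV ε r₁ r₂ l = (1 + matWminus ε r₁ r₂ l) * (1 + matWplus r₁ r₂ l) := by
  have e : ∀ r : ℂ, (‖r‖ : ℂ) ^ 2 = star r * r := fun r => (Complex.conj_mul' r).symm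
  rw [jumpV, e, e]
  ext j k
  fin_cases j <;> fin_cases k <;>
    simp [matWminus, matWplus, Matrix.mul_apply, Fin.sum_univ_three, Matrix.one_apply]
  ring

theorem det_jumpV (l : ℝ) : (jumpV ε r₁ r₂ l).det = 1 := by
  have e : ∀ r : ℂ, (‖r‖ : ℂ) ^ 2 = star r * r := fun r => (Complex.conj_mul' r).symm
  rw [jumpV, e, e, Matrix.det_fin_three]
  simp
  ring

end Coefficients

/-! ### Positivity of the jump matrix -/

section Positivity

/-- The real part of the quadratic form of `V` at the row vector `(a, b, c)`, where `r` and `s` are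
the values of the coefficients. -/
def jumpForm (ε : ℝ) (r s a b c : ℂ) : ℝ :=
  (1 + ε * (‖r‖ ^ 2 + ‖s‖ ^ 2)) * ‖a‖ ^ 2 + ‖b‖ ^ 2 + ‖c‖ ^ 2 +
    (1 + ε) * (a * star (b * r + c * s)).re

/-- Lower bound for the quadratic form. For `ε = 1` it is `|a|² + |b + a r̄|² + |c + a s̄|²`; for
`ε = -1` it is diagonal. -/
theorem le_jumpForm {ε : ℝ} (hε : ε = 1 ∨ ε = -1) {R : ℝ} (hR0 : 0 ≤ R) (hR : ε = -1 → R < 1) :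
    ∃ κ : ℝ, 0 < κ ∧ ∀ r s a b c : ℂ, ‖r‖ ^ 2 + ‖s‖ ^ 2 ≤ R →
      κ * (‖a‖ ^ 2 + ‖b‖ ^ 2 + ‖c‖ ^ 2) ≤ jumpForm ε r s a b c := by
  rcases hε with rfl | rfl
  · refine ⟨(2 + 2 * R)⁻¹, by positivity, fun r s a b c h => ?_⟩
    rw [inv_mul_le_iff₀ (by positivity)]
    have e : jumpForm 1 r s a b c = ‖a‖ ^ 2 + ‖b + a * star r‖ ^ 2 + ‖c + a * star s‖ ^ 2 := by
      simp only [jumpForm, Complex.sq_norm, Complex.normSq_apply]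
      simp
      ring
    have hx : ∀ u v w : ℂ, ‖u‖ ^ 2 ≤ 2 * ‖u + v * star w‖ ^ 2 + 2 * (‖v‖ ^ 2 * ‖w‖ ^ 2) :=
      fun u v w => by
        have e1 : u = u + v * star w - v * star w := by ring
        have h1 := norm_sub_le (u + v * star w) (v * star w)
        rw [← e1, norm_mul, norm_star] at h1
        have h2 := pow_le_pow_left₀ (norm_nonneg u) h1 2
        nlinarith [sq_nonneg (‖u + v * star w‖ - ‖v‖ * ‖w‖)]
    have h1 := hx b a r
    have h2 := hx c a s
    have h3 := mul_le_mul_of_nonneg_left h (sq_nonneg ‖a‖)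
    rw [e]
    nlinarith [mul_nonneg hR0 (sq_nonneg ‖b + a * star r‖),
      mul_nonneg hR0 (sq_nonneg ‖c + a * star s‖), sq_nonneg ‖a‖]
  · have h1 := hR rfl
    refine ⟨1 - R, by linarith, fun r s a b c h => ?_⟩
    rw [jumpForm]
    have h3 := mul_le_mul_of_nonneg_left h (sq_nonneg ‖a‖)
    nlinarith [mul_nonneg hR0 (sq_nonneg ‖b‖), mul_nonneg hR0 (sq_nonneg ‖c‖)]

theorem posDef_jumpV_add {ε : ℝ} (hε : ε = 1 ∨ ε = -1) (ρ₁ ρ₂ : ℝ → ℂ) (l : ℝ)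
    (hd : ε = -1 → ‖ρ₁ l‖ ^ 2 + ‖ρ₂ l‖ ^ 2 < 1) :
    (jumpV ε ρ₁ ρ₂ l + (jumpV ε ρ₁ ρ₂ l)ᴴ).PosDef := by
  obtain ⟨κ, hκ, h⟩ := le_jumpForm hε (R := ‖ρ₁ l‖ ^ 2 + ‖ρ₂ l‖ ^ 2) (by positivity) hd
  have e : ∀ r : ℂ, (‖r‖ : ℂ) ^ 2 = star r * r := fun r => (Complex.conj_mul' r).symm
  refine Matrix.PosDef.of_dotProduct_mulVec_pos (Matrix.isHermitian_add_transpose_self _)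
    fun v hv => ?_
  have e1 : star v ⬝ᵥ ((jumpV ε ρ₁ ρ₂ l + (jumpV ε ρ₁ ρ₂ l)ᴴ) *ᵥ v) =
      ((2 * jumpForm ε (ρ₁ l) (ρ₂ l) (star (v 0)) (star (v 1)) (star (v 2)) : ℝ) : ℂ) := by
    simp only [jumpV, jumpForm, e]
    apply Complex.ext
    · simp [Matrix.mulVec, dotProduct, Fin.sum_univ_three, Matrix.conjTranspose_apply,
        Complex.sq_norm, Complex.normSq_apply]
      ring
    · rw [Complex.ofReal_im]
      simp [Matrix.mulVec, dotProduct, Fin.sum_univ_three, Matrix.conjTranspose_apply]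
      ring
  rw [e1]
  have h1 := h (ρ₁ l) (ρ₂ l) (star (v 0)) (star (v 1)) (star (v 2)) le_rfl
  have h2 : 0 < ‖v 0‖ ^ 2 + ‖v 1‖ ^ 2 + ‖v 2‖ ^ 2 := by
    by_contra! hle
    have hz : ∀ i, ‖v i‖ ^ 2 = 0 → v i = 0 := fun i hi => by simpa using hi
    have n0 := sq_nonneg ‖v 0‖
    have n1 := sq_nonneg ‖v 1‖
    have n2 := sq_nonneg ‖v 2‖
    refine hv (funext fun i => ?_)
    fin_cases i <;> exact hz _ (by dsimp; linarith)
  simp only [norm_star] at h1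
  have h3 := mul_pos hκ h2
  exact_mod_cast (by linarith : (0 : ℝ) < 2 * _)

theorem re_inner_frob_mul_jumpV (ε : ℝ) (r₁ r₂ : ℝ → ℂ) (l : ℝ) (A : Mat3) :
    (inner ℂ (frob (A * jumpV ε r₁ r₂ l)) (frob A)).re =
      ∑ j, jumpForm ε (r₁ l) (r₂ l) (A j 0) (A j 1) (A j 2) := by
  have e : ∀ r : ℂ, (‖r‖ : ℂ) ^ 2 = star r * r := fun r => (Complex.conj_mul' r).symm
  rw [PiLp.inner_apply, Fintype.sum_prod_type, Complex.re_sum]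
  refine Finset.sum_congr rfl fun j _ => ?_
  simp only [jumpV, jumpForm, e, frob_apply]
  simp [Matrix.mul_apply, Fin.sum_univ_three, Complex.sq_norm, Complex.normSq_apply]
  ring

/-- As the coefficients are continuous and vanish at infinity, a strict pointwise bound holds
uniformly. -/
theorem exists_sq_norm_le {r₁ r₂ : ℝ → ℂ} (h₁ : IsRegularCoeff r₁) (h₂ : IsRegularCoeff r₂) :
    ∃ R : ℝ, 0 ≤ R ∧ (∀ l, ‖r₁ l‖ ^ 2 + ‖r₂ l‖ ^ 2 ≤ R) ∧
      ((∀ l, ‖r₁ l‖ ^ 2 + ‖r₂ l‖ ^ 2 < 1) → R < 1) := by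
  have hc : Continuous fun l => ‖r₁ l‖ ^ 2 + ‖r₂ l‖ ^ 2 :=
    (h₁.continuous.norm.pow 2).add (h₂.continuous.norm.pow 2)
  have ht : Tendsto (fun l => ‖r₁ l‖ ^ 2 + ‖r₂ l‖ ^ 2) (cocompact ℝ) (𝓝 0) := by
    simpa using (h₁.tendsto_cocompact.norm.pow 2).add (h₂.tendsto_cocompact.norm.pow 2)
  -- a continuous function attains its maximum if it is positive somewhere and vanishes at infinity;
  -- the constant `1 / 2` provides a positive value
  obtain ⟨y, hy⟩ := (hc.max (continuous_const (y := (1 / 2 : ℝ)))).exists_forall_ge' 0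
    (by filter_upwards [ht.eventually (gt_mem_nhds one_half_pos)] with l hl
        rw [max_eq_right hl.le]; exact le_max_right _ _)
  refine ⟨max (‖r₁ y‖ ^ 2 + ‖r₂ y‖ ^ 2) (1 / 2), by positivity,
    fun l => (le_max_left _ _).trans (hy l),
    fun h => max_lt (h y) (by norm_num)⟩

theorem isAdmissibleJump_jumpV {ε : ℝ} (hε : ε = 1 ∨ ε = -1) {r₁ r₂ : ℝ → ℂ}
    (h₁ : IsRegularCoeff r₁) (h₂ : IsRegularCoeff r₂)
    (hd : ε = -1 → ∀ l : ℝ, ‖r₁ l‖ ^ 2 + ‖r₂ l‖ ^ 2 < 1) :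
    IsAdmissibleJump (matWminus ε r₁ r₂) (matWplus r₁ r₂) (jumpV ε r₁ r₂) where
  regular_minus := isRegularCoeff_matWminus ε h₁ h₂
  regular_plus := isRegularCoeff_matWplus h₁ h₂
  sq_minus := matWminus_mul_self
  eq_mul := jumpV_eq_mul
  det_eq_one := det_jumpV
  coercive := by
    obtain ⟨R, hR0, hR, hR1⟩ := exists_sq_norm_le h₁ h₂
    obtain ⟨κ, hκ, h⟩ := le_jumpForm hε hR0 fun e => hR1 (hd e)
    refine ⟨κ, hκ, fun l A => ?_⟩
    rw [re_inner_frob_mul_jumpV]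
    have e : ‖frob A‖ ^ 2 = ∑ j, (‖A j 0‖ ^ 2 + ‖A j 1‖ ^ 2 + ‖A j 2‖ ^ 2) := by
      rw [EuclideanSpace.norm_sq_eq, Fintype.sum_prod_type]
      simp only [Fin.sum_univ_three, frob_apply]
    rw [e, Finset.mul_sum]
    exact Finset.sum_le_sum fun j _ => h _ _ _ _ _ (hR l)

end Positivity

end

theorem mainTheorem3 (ε : ℝ) (hε : ε = 1 ∨ ε = -1) (ρ₁ ρ₂ : ℝ → ℂ)
    (hρ₁ : MemH11 ρ₁) (hρ₂ : MemH11 ρ₂)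
    (hdefocusing : ε = -1 → ∀ l : ℝ, ‖ρ₁ l‖ ^ 2 + ‖ρ₂ l‖ ^ 2 < 1) (x : ℝ) :
    -- `V + V†` is positive definite
    (∀ l : ℝ, (jumpV ε ρ₁ ρ₂ l + (jumpV ε ρ₁ ρ₂ l)ᴴ).PosDef) ∧
    -- `C_W` is a bounded operator on `L²` and `I - C_W` is Fredholm of index zero and invertible
    (∃ T : L2Mat →L[ℂ] L2Mat, IsBealsCoifmanOperator ε ρ₁ ρ₂ x T ∧
      IsFredholmIndexZero (1 - T) ∧ IsUnit (1 - T) ∧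
      -- `μ = I + φ`, `φ = (I - C_W)⁻¹ C_W I`, is the unique solution in `I + L²` of `μ = I + C_W μ`
      ∃ φ : L2Mat,
        (∃ g : L2Mat, IsBealsCoifmanImage ε ρ₁ ρ₂ x (fun _ => 1) g ∧ (1 - T) φ = g) ∧
        IsBealsCoifmanImage ε ρ₁ ρ₂ x (fun l => 1 + φ l) φ ∧
        (∀ ψ : L2Mat, IsBealsCoifmanImage ε ρ₁ ρ₂ x (fun l => 1 + ψ l) ψ → ψ = φ) ∧
        -- the Riemann-Hilbert problem has a unique solution `M`
        ∃ M : ℂ → Mat3, SolvesRHP (jumpVx ε ρ₁ ρ₂ x) M ∧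
          (∀ M' : ℂ → Mat3, SolvesRHP (jumpVx ε ρ₁ ρ₂ x) M' → ∀ z : ℂ, z.im ≠ 0 → M' z = M z) ∧
          -- it is given by `μ`, and `M₊ = μ (I + W_{x+})`, `M₋ = μ (I - W_{x-})` a.e.
          (∀ z : ℂ, z.im ≠ 0 → M z = 1 + cauchyIntegral
            (fun l => (1 + φ l) * (matWxplus ρ₁ ρ₂ x l + matWxminus ε ρ₁ ρ₂ x l)) z) ∧
          (∀ᵐ l : ℝ, Tendsto M (𝓝[upperHP] (l : ℂ)) (𝓝 ((1 + φ l) * (1 + matWxplus ρ₁ ρ₂ x l)))) ∧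
          (∀ᵐ l : ℝ, Tendsto M (𝓝[lowerHP] (l : ℂ))
            (𝓝 ((1 + φ l) * (1 - matWxminus ε ρ₁ ρ₂ x l))))) := by
  refine ⟨fun l => posDef_jumpV_add hε ρ₁ ρ₂ l fun h => hdefocusing h l, ?_⟩
  have h : IsAdmissibleJump (matWxminus ε ρ₁ ρ₂ x) (matWxplus ρ₁ ρ₂ x) (jumpVx ε ρ₁ ρ₂ x) := by
    rw [matWxminus_eq, matWxplus_eq, jumpVx_eq]
    refine isAdmissibleJump_jumpV hε (hρ₁.isRegularCoeff.exp_mul x) (hρ₂.isRegularCoeff.exp_mul x)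
      fun h l => ?_
    rw [norm_oscCoeff, norm_oscCoeff]
    exact hdefocusing h l
  exact h.unique_solvability
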